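/- Let $X$ be a smooth projective split toric variety over $\mathbb{Q}$ of dimension $d\geqslant 1$, defined by a regular complete fan $\triangle$ in a lattice $N\simeq\mathbb{Z}^d$, and assume that the anticanonical line bundle $-K_X$ is globally generated. Let $\triangle(1)$ be the set of the $n=r+d$ rays of $\triangle$, where $r=\operatorname{rank}\operatorname{Pic}(X)$, let $n_\varrho$ be the primitive generator of the ray $\varrho$, and let $D_\varrho$ be the corresponding boundary divisor. Let $\triangle_{\max}$ be the set of maximal cones, and let $\sigma(1)$ be the set of rays of $\sigma\in\triangle_{\max}$, so that $(n_\varrho)_{\varrho\in\sigma(1)}$ is a basis of $N$. For a tuple $\mathbf{X}=(X_\varrho)_{\varrho\in\triangle(1)}$ and $\sigma\in\triangle_{\max}$ put $$\mathbf{X}^{\underline{\sigma}}=\prod_{\varrho\notin\sigma(1)}X_\varrho,\qquad \mathbf{X}^{D_0(\sigma)}=\prod_{\varrho:\,a_\varrho(\sigma)>0}X_\varrho^{a_\varrho(\sigma)},\qquad a_\varrho(\sigma)=1-\langle m(\sigma),n_\varrho\rangle,$$ where $m(\sigma)\in N^\vee$ is the linear form equal to $1$ at $n_\varrho$ for every $\varrho\in\sigma(1)$.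 Let $\mathcal{X}_0\subset\mathbb{A}^n_{\mathbb{Z}}$ be the principal universal torsor over the canonical integral model of $X$, the union over $\sigma\in\triangle_{\max}$ of the open sets $\mathbf{X}^{\underline{\sigma}}\neq 0$; thus $\mathcal{X}_0(R)$ is the set of the tuples in $R^n$ for which the $\mathbf{X}^{\underline{\sigma}}$ generate the unit ideal of $R$. For $B>0$ let $$\mathcal{C}_0(B)^+=\Bigl\{\mathbf{X}\in\mathbb{Z}_{>0}^n:\ \max_{\sigma\in\triangle_{\max}}\mathbf{X}^{D_0(\sigma)}\leqslant B,\ \gcd(\mathbf{X}^{\underline{\sigma}},\ \sigma\in\triangle_{\max})=1\Bigr\}.$$ Fix $\sigma_0\in\triangle_{\max}$, let $(n_\varrho^\vee)_{\varrho\in\sigma_0(1)}$ be the basis dual to $(n_\varrho)_{\varrho\in\sigma_0(1)}$, and write $$\pi(\mathbf{X})=\Bigl(\prod_{\varrho'\in\triangle(1)}X_{\varrho'}^{\langle n_\varrho^\vee,n_{\varrho'}\rangle}\Bigr)_{\varrho\in\sigma_0(1)}\in\mathbb{R}^{d}.$$ Fix real numbers $\lambda_\varrho\in(0,1)$ for $\varrho\in\sigma_0(1)$,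 and let $\mathcal{B}_\infty=\prod_{\varrho\in\sigma_0(1)}(0,\lambda_\varrho]$. For an integer $l\geqslant 1$ and $\boldsymbol{\xi}_l\in\mathcal{X}_0(\mathbb{Z}/l\mathbb{Z})$ let $$\mathcal{C}_0([\boldsymbol{\xi}_l,\mathcal{B}_\infty];B)^+=\{\mathbf{X}\in\mathcal{C}_0(B)^+:\ \pi(\mathbf{X})\in\mathcal{B}_\infty,\ \mathbf{X}\equiv\boldsymbol{\xi}_l\bmod l\}.$$ Let $$\kappa_p=\frac{\#\mathcal{X}_0(\mathbb{Z}/p\mathbb{Z})}{p^n},\qquad \kappa_{(l)}=\frac{1}{l^n}\prod_{p\nmid l}\kappa_p,\qquad \alpha(X)=\frac{1}{(r-1)!}\int_{\overline{\operatorname{Eff}}(X)^\vee}e^{-\langle -K_X,y\rangle}\,dy,$$ where $\overline{\operatorname{Eff}}(X)^\vee\subset\operatorname{Pic}(X)^\vee_{\mathbb{R}}$ is the dual of the effective cone and $dy$ is the Haar measure for which the lattice $\operatorname{Pic}(X)^\vee$ has covolume one. Let $\alpha_0$ be the least number of rays of $\triangle$ that are not all contained in one cone of $\triangle$. **Theorem.**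 The products defining $\kappa_{(l)}$, $l\geqslant 1$, converge. For every $\varepsilon>0$ there is a constant $C$, depending only on $\triangle$, $\sigma_0$, $(\lambda_\varrho)$ and $\varepsilon$, such that for all integers $l\geqslant 1$, all $\boldsymbol{\xi}_l\in\mathcal{X}_0(\mathbb{Z}/l\mathbb{Z})$ and all real $B\geqslant 3$, the set $\mathcal{C}_0([\boldsymbol{\xi}_l,\mathcal{B}_\infty];B)^+$ is finite and $$\Bigl|\#\mathcal{C}_0([\boldsymbol{\xi}_l,\mathcal{B}_\infty];B)^+-\kappa_{(l)}\operatorname{vol}(\mathcal{B}_\infty)\,\alpha(X)\,B(\log B)^{r-1}\Bigr|\leqslant C\,B(\log B)^{r-2+\frac{1}{\alpha_0}+\varepsilon}\log\log B.$$ -/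

import Mathlib

/-- The cone in `ℝ^d` generated by the lattice vectors `ray ρ`, `ρ ∈ σ`. -/
noncomputable def rayCone {d n : ℕ} (ray : Fin n → Fin d → ℤ) (σ : Finset (Fin n)) :
    PointedCone ℝ (Fin d → ℝ) :=
  PointedCone.hull ℝ ((fun ρ i => (ray ρ i : ℝ)) '' (σ : Set (Fin n)))

/-- A regular complete fan in the lattice `N = ℤ^d`, with `n` rays. The rays are numbered by
`Fin n`, and `ray ρ` is the primitive generator of the ray `ρ`. A cone of the fan is recorded by
the set of its rays: `σ ∈ cones` stands for the cone `rayCone ray σ`. As the cones are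
generated by part of a basis, the faces of `σ` are the cones on the subsets of `σ`, its dimension
is its cardinality, and the common face of two cones is the cone on the common rays. -/
structure RegularCompleteFan (d n : ℕ) where
  ray : Fin n → Fin d → ℤ
  cones : Finset (Finset (Fin n))
  ray_injective : Function.Injective ray
  empty_mem : ∅ ∈ cones
  singleton_mem : ∀ ρ, {ρ} ∈ cones
  face_mem : ∀ σ ∈ cones, ∀ τ, τ ⊆ σ → τ ∈ cones
  regular : ∀ σ ∈ cones, ∃ b : Module.Basis (Fin d) ℤ (Fin d → ℤ), ∀ ρ ∈ σ, ray ρ ∈ Set.range b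
  inter : ∀ σ ∈ cones, ∀ τ ∈ cones,
    (rayCone ray σ : Set (Fin d → ℝ)) ∩ (rayCone ray τ : Set (Fin d → ℝ)) = rayCone ray (σ ∩ τ)
  complete : ∀ x : Fin d → ℝ, ∃ σ ∈ cones, x ∈ rayCone ray σ

namespace RegularCompleteFan

variable {d n : ℕ} (F : RegularCompleteFan d n)

/-- The maximal cones, that is, the cones of dimension `d`. -/
abbrev MaxCone : Type := {σ : Finset (Fin n) // σ ∈ F.cones ∧ σ.card = d}

theorem exists_coneBasis (σ : F.MaxCone) :
    ∃ b : Module.Basis σ.1 ℤ (Fin d → ℤ), ∀ ρ, b ρ = F.ray ρ := by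
  obtain ⟨b, hb⟩ := F.regular σ.1 σ.2.1
  choose f hf using fun ρ : σ.1 => hb ρ.1 ρ.2
  have hinj : Function.Injective f := fun x y h =>
    Subtype.ext (F.ray_injective (by rw [← hf x, ← hf y, h]))
  have hbij : Function.Bijective f :=
    (Fintype.bijective_iff_injective_and_card f).2 ⟨hinj, by simp [σ.2.2]⟩
  exact ⟨b.reindex (Equiv.ofBijective f hbij).symm, fun ρ => by simp [hf]⟩

/-- The `ℤ`-basis `(n_ρ)`, `ρ ∈ σ(1)`, of `N` given by a maximal cone `σ`. -/
noncomputable def coneBasis (σ : F.MaxCone) : Module.Basis σ.1 ℤ (Fin d → ℤ) :=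
  (F.exists_coneBasis σ).choose

theorem coneBasis_apply (σ : F.MaxCone) (ρ : σ.1) : F.coneBasis σ ρ = F.ray ρ :=
  (F.exists_coneBasis σ).choose_spec ρ

/-! ### Divisors. A torus-invariant divisor `∑ D ρ • D_ρ` is given by its coefficients, and the
elements of `M = Hom(N, ℤ)` are the linear forms `Module.Dual ℤ (Fin d → ℤ)`. -/

/-- `O(D)` is globally generated: on every chart `U_σ` it is generated by a global section, that
is, by a character `χ^m` with `div(χ^m) + D` effective and vanishing along the `D_ρ`, `ρ ∈ σ(1)`. -/
def GloballyGenerated (D : Fin n → ℤ) : Prop :=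
  ∀ σ : F.MaxCone, ∃ m : Module.Dual ℤ (Fin d → ℤ),
    (∀ ρ ∈ σ.1, m (F.ray ρ) + D ρ = 0) ∧ ∀ ρ ∉ σ.1, 0 ≤ m (F.ray ρ) + D ρ

/-- `D` is ample: its support function is strictly convex. -/
def Ample (D : Fin n → ℤ) : Prop :=
  ∀ σ : F.MaxCone, ∃ m : Module.Dual ℤ (Fin d → ℤ),
    (∀ ρ ∈ σ.1, m (F.ray ρ) + D ρ = 0) ∧ ∀ ρ ∉ σ.1, 0 < m (F.ray ρ) + D ρ

/-- The toric variety of the fan is projective. -/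
def Projective : Prop := ∃ D, F.Ample D

/-- The anticanonical divisor `D₀ = ∑ D_ρ`. -/
def anticanonical (_F : RegularCompleteFan d n) : Fin n → ℤ := fun _ => 1

/-- The map `h : M → ℤ^{Δ(1)}`, `m ↦ (⟨m, n_ρ⟩)_ρ`, sending a character to its divisor. -/
def divMap : Module.Dual ℤ (Fin d → ℤ) →ₗ[ℤ] (Fin n → ℤ) :=
  LinearMap.pi fun ρ => Module.Dual.eval ℤ (Fin d → ℤ) (F.ray ρ)

/-- The Picard group: torus-invariant divisors modulo divisors of characters. -/
abbrev Pic : Type := (Fin n → ℤ) ⧸ LinearMap.range F.divMap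

/-- The Picard rank `r`. -/
noncomputable def picRank : ℕ := Module.finrank ℤ F.Pic

/-- The class of a divisor. -/
def cls (D : Fin n → ℤ) : F.Pic := (LinearMap.range F.divMap).mkQ D

instance : Module.Finite ℤ (Module.Dual ℤ F.Pic) :=
  Module.Finite.of_injective ((LinearMap.range F.divMap).mkQ.dualMap)
    (LinearMap.dualMap_injective_of_surjective (Submodule.mkQ_surjective _))

/-- A `ℤ`-basis of the lattice `Pic(X)^∨`. The resulting identification of `Pic(X)^∨_ℝ` with a
coordinate space turns the Haar measure for which `Pic(X)^∨` has covolume one into the Lebesgue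
measure, whichever basis is used. -/
noncomputable def picDualBasis :
    Module.Basis (Fin (Module.finrank ℤ (Module.Dual ℤ F.Pic))) ℤ (Module.Dual ℤ F.Pic) :=
  Module.finBasis ℤ (Module.Dual ℤ F.Pic)

/-- The pairing of `x ∈ Pic(X)` with the point `y` of `Pic(X)^∨_ℝ` of coordinates `t`. -/
noncomputable def picPairing (x : F.Pic)
    (t : Fin (Module.finrank ℤ (Module.Dual ℤ F.Pic)) → ℝ) : ℝ :=
  ∑ i, t i * (F.picDualBasis i x : ℝ)

/-- The dual of the effective cone, in coordinates: the points of `Pic(X)^∨_ℝ` that are nonnegative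
on the classes of the effective torus-invariant divisors, which generate the effective cone. -/
def effDual : Set (Fin (Module.finrank ℤ (Module.Dual ℤ F.Pic)) → ℝ) :=
  {t | ∀ D : Fin n → ℤ, (∀ ρ, 0 ≤ D ρ) → 0 ≤ F.picPairing (F.cls D) t}

/-- `α(X) = 1/(r-1)! ∫ exp(-⟨-K_X, y⟩) dy` over the dual of the effective cone. -/
noncomputable def alpha : ℝ :=
  1 / (Nat.factorial (F.picRank - 1) : ℝ) *
    ∫ t in F.effDual, Real.exp (-F.picPairing (F.cls F.anticanonical) t)

/-- `α₀`: the least number of rays that are not all contained in one cone of the fan. -/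
noncomputable def alphaZero : ℕ :=
  sInf {k : ℕ | 0 < k ∧ ∃ S : Finset (Fin n), S.card = k ∧ ∀ σ ∈ F.cones, ¬ S ⊆ σ}

/-! ### The universal torsor -/

/-- The monomial `∏ X_ρ` over the rays `ρ` outside `σ`. It cuts out the complement of the chart
`U_{0,σ} = Spec ℤ[X_ρ, X_{ρ'}⁻¹ : ρ ∈ σ(1), ρ' ∉ σ(1)]` in affine space. -/
def coneMonomial {R : Type*} [CommMonoid R] (σ : Finset (Fin n)) (x : Fin n → R) : R :=
  ∏ ρ ∈ σᶜ, x ρ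

/-- The `R`-points of the torsor `𝒳₀`, the union of the charts `U_{0,σ}` inside affine space: the
tuples at which the monomials of the maximal cones generate the unit ideal. -/
def torsorPoints (R : Type*) [CommRing R] : Set (Fin n → R) :=
  {x | Ideal.span (Set.range fun σ : F.MaxCone => coneMonomial σ.1 x) = ⊤}

/-- `κ_p = #𝒳₀(ℤ/p) / p^n`. -/
noncomputable def localDensity (p : ℕ) : ℝ :=
  (F.torsorPoints (ZMod p)).ncard / (p : ℝ) ^ n

/-- `κ_(l) = l^{-n} ∏_{p ∤ l} κ_p`. -/
noncomputable def kappa (l : ℕ) : ℝ :=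
  1 / (l : ℝ) ^ n * ∏' p : {p : ℕ // p.Prime ∧ ¬ p ∣ l}, F.localDensity p

/-- `m_{D₀}(σ)`, the linear form equal to `1` at `n_ρ` for all `ρ ∈ σ(1)`. -/
noncomputable def mSigma (σ : F.MaxCone) : Module.Dual ℤ (Fin d → ℤ) :=
  ∑ ρ, (F.coneBasis σ).coord ρ

/-- `a_ρ(σ) = 1 - ⟨m_{D₀}(σ), n_ρ⟩`. -/
noncomputable def heightExponent (σ : F.MaxCone) (ρ : Fin n) : ℤ :=
  1 - F.mSigma σ (F.ray ρ)

/-- `X^{D₀(σ)}`, the product of the `X_ρ ^ a_ρ(σ)` over the `ρ` with `a_ρ(σ) > 0`. -/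
noncomputable def heightMonomial (σ : F.MaxCone) (X : Fin n → ℕ) : ℕ :=
  ∏ ρ, X ρ ^ (F.heightExponent σ ρ).toNat

/-- `𝒞₀(B)⁺`: positive integral tuples of height at most `B` on the torsor. -/
def primitiveTuples (B : ℝ) : Set (Fin n → ℕ) :=
  {X | (∀ ρ, 0 < X ρ) ∧ (∀ σ : F.MaxCone, (F.heightMonomial σ X : ℝ) ≤ B) ∧
    (Finset.univ.gcd fun σ : F.MaxCone => coneMonomial σ.1 X) = 1}

/-- The coordinates of `π(X)` on the chart `U_σ`: `z_ρ = ∏ X_ρ' ^ ⟨n_ρ^∨, n_ρ'⟩` for `ρ ∈ σ(1)`,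
where `(n_ρ^∨)` is the basis dual to `(n_ρ)`. -/
noncomputable def torsorMap (σ : F.MaxCone) (X : Fin n → ℝ) : σ.1 → ℝ :=
  fun ρ => ∏ ρ' : Fin n, X ρ' ^ ((F.coneBasis σ).coord ρ (F.ray ρ'))

/-- The standard box `∏ ]0, λ_ρ]` in the coordinates of `U_σ`. -/
def standardBox {F : RegularCompleteFan d n} (σ : F.MaxCone) (lam : σ.1 → ℝ) : Set (σ.1 → ℝ) :=
  Set.univ.pi fun ρ => Set.Ioc 0 (lam ρ)

/-- `𝒞₀([ξ, ℬ]; B)⁺`: the elements `X` of `𝒞₀(B)⁺` with `π(X) ∈ ℬ` and `X ≡ ξ mod l`. -/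
def congruenceTuples (σ : F.MaxCone) (box : Set (σ.1 → ℝ)) {l : ℕ} (ξ : Fin n → ZMod l) (B : ℝ) :
    Set (Fin n → ℕ) :=
  {X | X ∈ F.primitiveTuples B ∧ F.torsorMap σ (fun ρ => (X ρ : ℝ)) ∈ box ∧
    ∀ ρ, (X ρ : ZMod l) = ξ ρ}

end RegularCompleteFan

/-!
The theorem is a lattice point count in the universal torsor, with three ingredients.

*The region.* By the choice `λ_ρ < 1`, a tuple `X` with `π(X)` in the box satisfies
`X^{D₀(σ)} ≤ X^{D₀(σ₀)}` for all `σ`, so that its height is a single monomial. In the logarithms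
`t_j = log x_j`, `j ∉ σ₀(1)`, the real region `D(B)` of the tuples with coordinates at least `1`,
height at most `B` and image in the box therefore lies over the points `t` of the dual of the
effective cone with `⟨-K_X, t⟩ ≤ log B`, and its fibres are boxes `∏ ]0, λ_ρ e^{z_ρ(t)}]`, up to the
condition `x_ρ ≥ 1` (`region_eq`). Integration over the cone gives
`vol D(B) = vol(ℬ) α(X) B (log B)^{r-1} + O(B (log B)^{r-2})` (`volume_openRegion`,
`lintegral_exp_cone`, `alpha_eq`, `exists_volume_region_asymptotic`).

*Uniform counting.* The fibres of `D(B)` in the coordinate directions are intervals. Replacing the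
counting measure of a residue class by normalized Lebesgue measure, one coordinate after another,
counts the points of `D(B)` in a product of residue classes, with an error that does not depend on
the moduli: it is at most the number `E(B)` of positive integral tuples of height at most `B` that
have a coordinate equal to `1` (`abs_card_sub_volume_le`, `abs_card_region_sub_le`). A dyadic
decomposition shows that there are `T(B) ≪ B (log B)^{r-1}` tuples of height at most `B`, and that
`E(B) ≪ B (log B)^{r-2}` (`ncard_boundedTuples_le`, `sliceCount_le`).

*The sieve.* A tuple is primitive if for no prime `p` the rays `ρ` with `p ∣ X_ρ` form a nonface,
that is, a set of rays not contained in a cone. Inclusion-exclusion over sets `P` of such bad primes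
has main terms `∏_{p ∈ P} (1 - κ_p)`. For `∏ P ≤ z` uniform counting is applied, and for `∏ P > z`
the number of tuples is bounded by `T(B) ∏_{p ∈ P} O(p^{-α₀})`, because a nonface has at least `α₀`
elements (`card_bad_le`). The total error is
`E(B) z^{1+η} + T(B) z^{1-α₀+2η}` (`exists_congruenceTuples_bound`), and the choice
`z = (log B)^{1/α₀}` balances the two terms.
-/

open MeasureTheory

/-! ### Cones of a complete fan -/

namespace RegularCompleteFan

variable {d n : ℕ}

/-- The `ℝ`-linear extension to `N_ℝ = ℝ^d` of a linear form on the lattice `N = ℤ^d`. -/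
noncomputable def realExt (m : Module.Dual ℤ (Fin d → ℤ)) : (Fin d → ℝ) →ₗ[ℝ] ℝ :=
  ∑ i, (m (Pi.single i 1) : ℝ) • LinearMap.proj i

theorem realExt_intCast (m : Module.Dual ℤ (Fin d → ℤ)) (v : Fin d → ℤ) :
    realExt m (fun i => (v i : ℝ)) = m v := by
  have h : m v = ∑ i, v i * m (Pi.single i 1) := by
    conv_lhs => rw [pi_eq_sum_univ' v, map_sum]
    refine Finset.sum_congr rfl fun i _ => ?_
    rw [map_smul, smul_eq_mul]
  simp only [realExt, LinearMap.sum_apply, LinearMap.smul_apply, LinearMap.proj_apply, smul_eq_mul]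
  rw [h]
  push_cast
  exact Finset.sum_congr rfl fun i _ => mul_comm _ _

/-- The points of a cone as the nonnegative combinations of all generators that are supported on
the cone. -/
theorem mem_rayCone_iff (ray : Fin n → Fin d → ℤ) (σ : Finset (Fin n)) (x : Fin d → ℝ) :
    x ∈ rayCone ray σ ↔ ∃ c : Fin n → ℝ, (∀ ρ, 0 ≤ c ρ) ∧ (∀ ρ ∉ σ, c ρ = 0) ∧
      x = ∑ ρ, c ρ • (fun i => (ray ρ i : ℝ)) := by
  classical
  constructor
  · intro hx
    unfold rayCone PointedCone.hull at hx
    induction hx using Submodule.span_induction with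
    | mem x h =>
      obtain ⟨ρ, hρ, rfl⟩ := h
      refine ⟨Pi.single ρ 1, ?_, ?_, ?_⟩
      · intro ρ'
        by_cases h : ρ' = ρ
        · subst h; simp
        · simp [h]
      · intro ρ' hρ'
        rw [Pi.single_eq_of_ne]
        rintro rfl
        exact hρ' hρ
      · rw [Finset.sum_eq_single ρ]
        · simp
        · intro b _ hb; simp [hb]
        · simp
    | zero => exact ⟨0, by simp, by simp, by simp⟩
    | add x y _ _ hx hy =>
      obtain ⟨c, h1, h2, rfl⟩ := hx
      obtain ⟨c', h1', h2', rfl⟩ := hy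
      refine ⟨c + c', fun ρ => add_nonneg (h1 ρ) (h1' ρ), fun ρ hρ => by simp [h2 ρ hρ, h2' ρ hρ], ?_⟩
      simp [add_smul, Finset.sum_add_distrib]
    | smul a x _ hx =>
      obtain ⟨c, h1, h2, rfl⟩ := hx
      refine ⟨fun ρ => (a : ℝ) * c ρ, fun ρ => mul_nonneg a.2 (h1 ρ), fun ρ hρ => by simp [h2 ρ hρ], ?_⟩
      rw [Finset.smul_sum]
      refine Finset.sum_congr rfl fun ρ _ => ?_
      rw [mul_smul]; rfl
  · rintro ⟨c, h1, h2, rfl⟩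
    refine Submodule.sum_mem _ fun ρ _ => ?_
    by_cases hρ : ρ ∈ σ
    · exact PointedCone.smul_mem _ (h1 ρ) (PointedCone.subset_hull ⟨ρ, hρ, rfl⟩)
    · rw [h2 ρ hρ, zero_smul]; exact Submodule.zero_mem _

variable (F : RegularCompleteFan d n)

/-- The primitive generator of a ray, as a vector of `N_ℝ`. -/
def rayVec (ρ : Fin n) : Fin d → ℝ := fun i => (F.ray ρ i : ℝ)

theorem sum_coord_smul (σ : F.MaxCone) (v : Fin d → ℤ) :
    v = ∑ ρ : σ.1, (F.coneBasis σ).coord ρ v • F.ray ρ := by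
  conv_lhs => rw [← (F.coneBasis σ).sum_repr v]
  simp [coneBasis_apply]

theorem coord_ray (σ : F.MaxCone) (ρ ρ' : σ.1) :
    (F.coneBasis σ).coord ρ (F.ray ρ') = if ρ' = ρ then 1 else 0 := by
  rw [← F.coneBasis_apply σ ρ', Module.Basis.coord_apply, Module.Basis.repr_self,
    Finsupp.single_apply]

theorem realExt_rayVec (m : Module.Dual ℤ (Fin d → ℤ)) (ρ : Fin n) :
    realExt m (F.rayVec ρ) = m (F.ray ρ) := realExt_intCast m _

theorem sum_realExt_smul (σ : F.MaxCone) (x : Fin d → ℝ) :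
    x = ∑ ρ : σ.1, realExt ((F.coneBasis σ).coord ρ) x • F.rayVec ρ := by
  have key : (LinearMap.id : (Fin d → ℝ) →ₗ[ℝ] (Fin d → ℝ)) =
      ∑ ρ : σ.1, (realExt ((F.coneBasis σ).coord ρ)).smulRight (F.rayVec ρ) := by
    refine LinearMap.pi_ext' fun i => LinearMap.ext_ring ?_
    have hi : (LinearMap.single ℝ (fun _ : Fin d => ℝ) i) 1 =
        fun j => (((Pi.single i 1 : Fin d → ℤ) j : ℤ) : ℝ) := by
      ext j
      by_cases h : j = i
      · subst h; simp
      · simp [h]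
    simp only [LinearMap.comp_apply, hi, LinearMap.sum_apply, LinearMap.smulRight_apply,
      realExt_intCast, LinearMap.id_apply]
    ext j
    have := congrFun (F.sum_coord_smul σ (Pi.single i 1)) j
    simp only [Finset.sum_apply, Pi.smul_apply, smul_eq_mul, rayVec] at this ⊢
    exact_mod_cast this
  have := congrArg (fun f => f x) key
  simpa using this

theorem card_le_of_mem_cones {σ : Finset (Fin n)} (hσ : σ ∈ F.cones) : σ.card ≤ d := by
  obtain ⟨b, hb⟩ := F.regular σ hσ
  choose f hf using fun ρ : σ => hb ρ.1 ρ.2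
  have hinj : Function.Injective f := fun x y h =>
    Subtype.ext (F.ray_injective (by rw [← hf x, ← hf y, h]))
  simpa using Fintype.card_le_of_injective f hinj

theorem continuous_realExt (m : Module.Dual ℤ (Fin d → ℤ)) : Continuous (realExt m) :=
  LinearMap.continuous_of_finiteDimensional _

/-- The maximal cones already cover `N_ℝ`: the complement of their union is open, and it is covered
by finitely many proper subspaces. -/
theorem exists_maxCone_real (x : Fin d → ℝ) :
    ∃ σ : F.MaxCone, ∀ ρ, 0 ≤ realExt ((F.coneBasis σ).coord ρ) x := by
  by_contra hcon
  push Not at hcon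
  set U : Set (Fin d → ℝ) :=
    (⋃ σ : F.MaxCone, {x | ∀ ρ, 0 ≤ realExt ((F.coneBasis σ).coord ρ) x})ᶜ with hU
  have hxU : x ∈ U := by
    simp only [hU, Set.mem_compl_iff, Set.mem_iUnion, Set.mem_ofPred_eq, not_exists, not_forall,
      not_le]
    exact hcon
  have hopen : IsOpen U := by
    rw [hU, isOpen_compl_iff]
    refine isClosed_iUnion_of_finite fun σ => ?_
    simp only [Set.ofPred_forall]
    exact isClosed_iInter fun ρ => isClosed_le continuous_const (continuous_realExt _)
  have hpos : 0 < volume U := hopen.measure_pos _ ⟨x, hxU⟩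
  have hsub : U ⊆ ⋃ σ : {σ : Finset (Fin n) // σ ∈ F.cones ∧ σ.card < d},
      (Submodule.span ℝ (F.rayVec '' (σ.1 : Set (Fin n))) : Set (Fin d → ℝ)) := by
    intro y hy
    obtain ⟨σ, hσ, hyσ⟩ := F.complete y
    obtain ⟨c, hc0, hcσ, hyc⟩ := (mem_rayCone_iff _ _ _).1 hyσ
    rcases lt_or_eq_of_le (F.card_le_of_mem_cones hσ) with hlt | heq
    · refine Set.mem_iUnion.2 ⟨⟨σ, hσ, hlt⟩, ?_⟩
      rw [hyc]
      refine Submodule.sum_mem _ fun ρ _ => ?_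
      by_cases hρ : ρ ∈ σ
      · exact Submodule.smul_mem _ _ (Submodule.subset_span ⟨ρ, hρ, rfl⟩)
      · rw [hcσ ρ hρ, zero_smul]; exact Submodule.zero_mem _
    · exfalso
      apply hy
      refine Set.mem_iUnion.2 ⟨⟨σ, hσ, heq⟩, fun ρ => ?_⟩
      rw [hyc, map_sum]
      refine Finset.sum_nonneg fun ρ' _ => ?_
      rw [map_smul, smul_eq_mul]
      by_cases hρ' : ρ' ∈ σ
      · have h2 := F.realExt_rayVec ((F.coneBasis ⟨σ, hσ, heq⟩).coord ρ) ρ'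
        rw [F.coord_ray ⟨σ, hσ, heq⟩ ρ ⟨ρ', hρ'⟩] at h2
        refine mul_nonneg (hc0 _) ?_
        change 0 ≤ realExt _ (F.rayVec ρ')
        rw [h2]; split_ifs <;> simp
      · rw [hcσ ρ' hρ', zero_mul]
  have hzero : volume (⋃ σ : {σ : Finset (Fin n) // σ ∈ F.cones ∧ σ.card < d},
      (Submodule.span ℝ (F.rayVec '' (σ.1 : Set (Fin n))) : Set (Fin d → ℝ))) = 0 := by
    refine measure_iUnion_null fun σ => ?_
    refine Measure.addHaar_submodule _ _ fun htop => ?_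
    have h1 := finrank_span_finset_le_card (R := ℝ) (σ.1.image F.rayVec)
    rw [Finset.coe_image, Set.finrank, htop, finrank_top] at h1
    have h2 := (σ.1.card_image_le (f := F.rayVec)).trans_lt σ.2.2
    simp at h1
    omega
  exact hpos.ne' (measure_mono_null hsub hzero)

theorem exists_maxCone (v : Fin d → ℤ) :
    ∃ σ : F.MaxCone, ∀ ρ, 0 ≤ (F.coneBasis σ).coord ρ v := by
  obtain ⟨σ, hσ⟩ := F.exists_maxCone_real fun i => (v i : ℝ)
  refine ⟨σ, fun ρ => ?_⟩
  have := hσ ρ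
  rw [realExt_intCast] at this
  exact_mod_cast this

/-- Every cone is a face of a maximal cone, namely of one that contains the sum of its
generators. -/
theorem exists_maxCone_superset {τ : Finset (Fin n)} (hτ : τ ∈ F.cones) :
    ∃ σ : F.MaxCone, τ ⊆ σ.1 := by
  classical
  obtain ⟨σ, hσ⟩ := F.exists_maxCone_real (∑ ρ ∈ τ, F.rayVec ρ)
  refine ⟨σ, fun ρ₀ hρ₀ => ?_⟩
  by_contra hnot
  set x := ∑ ρ ∈ τ, F.rayVec ρ with hx
  have h1 : x ∈ rayCone F.ray τ := by
    refine Submodule.sum_mem _ fun ρ hρ => ?_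
    exact PointedCone.subset_hull ⟨ρ, hρ, rfl⟩
  have h2 : x ∈ rayCone F.ray σ.1 := by
    rw [F.sum_realExt_smul σ x]
    refine Submodule.sum_mem _ fun ρ _ => ?_
    exact PointedCone.smul_mem _ (hσ ρ) (PointedCone.subset_hull ⟨ρ.1, ρ.2, rfl⟩)
  have h3 : x ∈ rayCone F.ray (τ ∩ σ.1) := by
    have := F.inter τ hτ σ.1 σ.2.1
    have h4 : x ∈ (rayCone F.ray τ : Set (Fin d → ℝ)) ∩ rayCone F.ray σ.1 := ⟨h1, h2⟩
    rw [this] at h4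
    exact h4
  obtain ⟨b, hb⟩ := F.regular τ hτ
  obtain ⟨i, hi⟩ := hb ρ₀ hρ₀
  have hcoord : ∀ ρ ∈ τ, realExt (b.coord i) (F.rayVec ρ) = if ρ = ρ₀ then 1 else 0 := by
    intro ρ hρ
    obtain ⟨j, hj⟩ := hb ρ hρ
    rw [realExt_rayVec, ← hj, Module.Basis.coord_apply, Module.Basis.repr_self,
      Finsupp.single_apply]
    have : j = i ↔ ρ = ρ₀ := by
      rw [← F.ray_injective.eq_iff, ← hi, ← hj, b.injective.eq_iff]
    by_cases h : j = i
    · simp [h, this.1 h]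
    · simp [h, mt this.2 h]
  have e1 : realExt (b.coord i) x = 1 := by
    rw [hx, map_sum, Finset.sum_congr rfl hcoord]
    simp [hρ₀]
  obtain ⟨c, -, hc, hxc⟩ := (mem_rayCone_iff _ _ _).1 h3
  have e2 : realExt (b.coord i) x = 0 := by
    rw [hxc, map_sum]
    refine Finset.sum_eq_zero fun ρ _ => ?_
    rw [map_smul, smul_eq_mul]
    by_cases hρ : ρ ∈ τ ∩ σ.1
    · have := hcoord ρ (Finset.mem_inter.1 hρ).1
      rw [if_neg] at this
      · exact mul_eq_zero_of_right _ this
      · rintro rfl; exact hnot (Finset.mem_inter.1 hρ).2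
    · rw [hc ρ hρ, zero_mul]
  linarith

/-- A set of rays is a nonface if it is not contained in a cone of the fan. It is enough to test the
maximal cones, see `nonface_iff`. -/
def Nonface (S : Finset (Fin n)) : Prop := ∀ σ : F.MaxCone, ¬ S ⊆ σ.1

theorem nonface_iff (S : Finset (Fin n)) : F.Nonface S ↔ ∀ σ ∈ F.cones, ¬ S ⊆ σ := by
  constructor
  · intro h σ hσ hS
    obtain ⟨σ', hσ'⟩ := F.exists_maxCone_superset hσ
    exact h σ' (hS.trans hσ')
  · exact fun h σ => h σ.1 σ.2.1

theorem Nonface.nonempty {F : RegularCompleteFan d n} {S : Finset (Fin n)} (hS : F.Nonface S) :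
    S.Nonempty := by
  by_contra h
  rw [Finset.not_nonempty_iff_eq_empty] at h
  subst h
  exact (F.nonface_iff _).1 hS ∅ F.empty_mem (Finset.empty_subset _)

theorem Nonface.alphaZero_le {F : RegularCompleteFan d n} {S : Finset (Fin n)} (hS : F.Nonface S) :
    F.alphaZero ≤ S.card :=
  Nat.sInf_le ⟨hS.nonempty.card_pos, S, rfl, (F.nonface_iff _).1 hS⟩

/-- The rays are not all contained in one cone, as a cone of a complete fan in positive dimension
that contained them would be strongly convex and everything. -/
theorem nonface_univ (hd : 1 ≤ d) (σ₀ : F.MaxCone) : F.Nonface Finset.univ := by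
  intro τ hτ
  obtain ⟨σ, hσ⟩ := F.exists_maxCone (-∑ ρ, F.ray ρ)
  have hmem : ∀ ρ, ρ ∈ τ.1 := fun ρ => hτ (Finset.mem_univ ρ)
  obtain ⟨ρ₀, hρ₀⟩ : σ₀.1.Nonempty := by
    rw [← Finset.card_pos, σ₀.2.2]; omega
  have hnonneg : ∀ ρ, 0 ≤ (F.coneBasis τ).coord ⟨ρ₀, hmem ρ₀⟩ (F.ray ρ) := fun ρ => by
    rw [F.coord_ray τ _ ⟨ρ, hmem ρ⟩]; split_ifs <;> simp
  have h1 := congrArg ((F.coneBasis τ).coord ⟨ρ₀, hmem ρ₀⟩) (F.sum_coord_smul σ (-∑ ρ, F.ray ρ))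
  rw [map_neg, map_sum, map_sum] at h1
  have h2 : 0 ≤ ∑ ρ : σ.1, (F.coneBasis τ).coord ⟨ρ₀, hmem ρ₀⟩
      ((F.coneBasis σ).coord ρ (-∑ ρ, F.ray ρ) • F.ray ρ) :=
    Finset.sum_nonneg fun ρ _ => by
      rw [map_smul, smul_eq_mul]; exact mul_nonneg (hσ ρ) (hnonneg ρ)
  have h3 : (F.coneBasis τ).coord ⟨ρ₀, hmem ρ₀⟩ (F.ray ρ₀) ≤
      ∑ ρ, (F.coneBasis τ).coord ⟨ρ₀, hmem ρ₀⟩ (F.ray ρ) :=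
    Finset.single_le_sum (fun ρ _ => hnonneg ρ) (Finset.mem_univ ρ₀)
  rw [F.coord_ray τ _ ⟨ρ₀, hmem ρ₀⟩, if_pos rfl] at h3
  omega

theorem two_le_alphaZero (hd : 1 ≤ d) (σ₀ : F.MaxCone) : 2 ≤ F.alphaZero := by
  have hne : {k : ℕ | 0 < k ∧ ∃ S : Finset (Fin n), S.card = k ∧ ∀ σ ∈ F.cones, ¬ S ⊆ σ}.Nonempty :=
    ⟨_, (F.nonface_univ hd σ₀).nonempty.card_pos, _, rfl,
      (F.nonface_iff _).1 (F.nonface_univ hd σ₀)⟩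
  obtain ⟨hpos, S, hS, hSF⟩ := Nat.sInf_mem hne
  change 2 ≤ sInf _
  by_contra hlt
  have h1 : S.card = 1 := by omega
  obtain ⟨ρ, rfl⟩ := Finset.card_eq_one.1 h1
  exact hSF _ (F.singleton_mem ρ) subset_rfl

/-! ### Heights and relations between the rays -/

theorem mSigma_ray (σ : F.MaxCone) {ρ : Fin n} (hρ : ρ ∈ σ.1) : F.mSigma σ (F.ray ρ) = 1 := by
  rw [mSigma, LinearMap.sum_apply, Finset.sum_eq_single (⟨ρ, hρ⟩ : σ.1)]
  · rw [F.coord_ray σ _ ⟨ρ, hρ⟩, if_pos rfl]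
  · intro ρ' _ h
    rw [F.coord_ray σ _ ⟨ρ, hρ⟩, if_neg (Ne.symm h)]
  · simp

/-- For a globally generated anticanonical bundle the exponents `a_ρ(σ)` are nonnegative. -/
theorem heightExponent_nonneg (hgen : F.GloballyGenerated F.anticanonical) (σ : F.MaxCone)
    (ρ : Fin n) : 0 ≤ F.heightExponent σ ρ := by
  obtain ⟨m, h1, h2⟩ := hgen σ
  have hm : F.mSigma σ = -m := by
    refine (F.coneBasis σ).ext fun ρ => ?_
    rw [F.coneBasis_apply, F.mSigma_ray σ ρ.2]
    have := h1 ρ.1 ρ.2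
    simp only [anticanonical] at this
    simp only [LinearMap.neg_apply]
    omega
  rw [heightExponent]
  by_cases hρ : ρ ∈ σ.1
  · rw [F.mSigma_ray σ hρ]; norm_num
  · have := h2 ρ hρ
    simp only [anticanonical] at this
    rw [hm, LinearMap.neg_apply]
    omega

/-- Expressing the height exponents at one maximal cone in the basis given by another one. -/
theorem mSigma_ray_eq (σ σ₀ : F.MaxCone) (ρ' : Fin n) :
    F.mSigma σ (F.ray ρ') =
      ∑ ρ : σ₀.1, (F.coneBasis σ₀).coord ρ (F.ray ρ') * F.mSigma σ (F.ray ρ) := by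
  conv_lhs => rw [F.sum_coord_smul σ₀ (F.ray ρ'), map_sum]
  exact Finset.sum_congr rfl fun ρ _ => by rw [map_smul, smul_eq_mul]

/-- Every tuple `k` of nonnegative integers is completed to a relation between the rays by a tuple
supported on a cone, and then the height at that cone is `∑ k + ∑ w`. -/
theorem exists_relation (k : Fin n → ℕ) :
    ∃ (w : Fin n → ℕ) (σ : F.MaxCone), (∑ ρ, ((k ρ + w ρ : ℕ) : ℤ) • F.ray ρ = 0) ∧
      ∑ ρ, F.heightExponent σ ρ * k ρ = ((∑ ρ, k ρ + ∑ ρ, w ρ : ℕ) : ℤ) := by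
  classical
  obtain ⟨σ, hσ⟩ := F.exists_maxCone (-∑ ρ, (k ρ : ℤ) • F.ray ρ)
  set v := -∑ ρ, (k ρ : ℤ) • F.ray ρ with hv
  set w : Fin n → ℕ := fun ρ =>
    if h : ρ ∈ σ.1 then ((F.coneBasis σ).coord ⟨ρ, h⟩ v).toNat else 0 with hw
  have hwcast : ∀ ρ : σ.1, (w ρ : ℤ) = (F.coneBasis σ).coord ρ v := fun ρ => by
    simp only [hw, ρ.2, dif_pos]
    exact Int.toNat_of_nonneg (hσ ρ)
  have hsumw : ∀ {M : Type} [AddCommGroup M] (g : Fin n → M),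
      ∑ ρ, (w ρ : ℤ) • g ρ = ∑ ρ : σ.1, (F.coneBasis σ).coord ρ v • g ρ := by
    intro M _ g
    rw [← Finset.sum_subset (Finset.subset_univ σ.1), ← Finset.sum_coe_sort σ.1]
    · exact Finset.sum_congr rfl fun ρ _ => by rw [hwcast]
    · intro ρ _ hρ
      simp [hw, hρ]
  refine ⟨w, σ, ?_, ?_⟩
  · push_cast
    simp only [add_smul, Finset.sum_add_distrib]
    rw [hsumw, ← F.sum_coord_smul σ v, hv, add_neg_cancel]
  · have h1 : ∑ ρ, (w ρ : ℤ) = F.mSigma σ v := by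
      have := hsumw (fun _ => (1 : ℤ))
      simp only [smul_eq_mul, mul_one] at this
      rw [this, mSigma, LinearMap.sum_apply]
    push_cast
    rw [h1, hv, map_neg, map_sum]
    simp only [heightExponent, map_smul, smul_eq_mul, sub_mul, one_mul, Finset.sum_sub_distrib]
    rw [sub_eq_add_neg]
    congr 2
    exact Finset.sum_congr rfl fun ρ _ => mul_comm _ _

end RegularCompleteFan

/-! ### The number of tuples of bounded height -/

/-- Nonnegative integral points of a box that are congruent modulo a subspace are determined by
`dim W` of their coordinates. -/
theorem card_le_pow_finrank {n : ℕ} (K : ℕ) (s : ℕ) (W : Submodule ℝ (Fin n → ℝ))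
    (hW : Module.finrank ℝ W ≤ s) (S : Finset (Fin n → ℕ)) (hS : ∀ x ∈ S, ∀ i, x i ≤ K)
    (hd : ∀ x ∈ S, ∀ y ∈ S, (fun i => (x i : ℝ) - y i) ∈ W) : S.card ≤ (K + 1) ^ s := by
  induction s generalizing W S with
  | zero =>
    have : W = ⊥ := Submodule.finrank_eq_zero.1 (by omega)
    subst this
    rw [pow_zero, Finset.card_le_one]
    intro x hx y hy
    have := hd x hx y hy
    rw [Submodule.mem_bot] at this
    ext i
    have := congrFun this i
    simp only [Pi.zero_apply, sub_eq_zero] at this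
    exact_mod_cast this
  | succ s ih =>
    by_cases hbot : W = ⊥
    · exact (ih W (by rw [hbot]; simp) S hS hd).trans (Nat.pow_le_pow_right (by omega) (by omega))
    · obtain ⟨v, hv, hv0⟩ := Submodule.exists_mem_ne_zero_of_ne_bot hbot
      obtain ⟨j, hj⟩ := Function.ne_iff.1 hv0
      have hlt : W ⊓ LinearMap.ker (LinearMap.proj j : (Fin n → ℝ) →ₗ[ℝ] ℝ) < W := by
        refine lt_of_le_of_ne inf_le_left fun h => hj ?_
        have : v ∈ W ⊓ LinearMap.ker (LinearMap.proj j : (Fin n → ℝ) →ₗ[ℝ] ℝ) := by rw [h]; exact hv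
        simpa using this.2
      have hfr := Submodule.finrank_lt_finrank_of_lt hlt
      have hmaps : ∀ x ∈ S, x j ∈ Finset.range (K + 1) := fun x hx => by
        have := hS x hx j
        simp; omega
      rw [Finset.card_eq_sum_card_fiberwise hmaps, pow_succ, mul_comm]
      refine (Finset.sum_le_card_nsmul _ _ ((K + 1) ^ s) fun a _ => ?_).trans (by simp)
      refine ih _ (Nat.lt_succ_iff.1 (hfr.trans_le hW)) _
        (fun x hx => hS x (Finset.mem_filter.1 hx).1) ?_
      intro x hx y hy
      rw [Finset.mem_filter] at hx hy
      exact ⟨hd x hx.1 y hy.1, by simp [hx.2, hy.2]⟩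

namespace RegularCompleteFan

variable {d n : ℕ} (F : RegularCompleteFan d n)

/-- The space of linear relations between the rays, which is `Pic(X)^∨_ℝ` by the exact sequence
`M → ℤ^n → Pic(X) → 0`. -/
noncomputable def relSpace : Submodule ℝ (Fin n → ℝ) :=
  LinearMap.ker (Fintype.linearCombination ℝ F.rayVec)

theorem mem_relSpace (u : Fin n → ℝ) : u ∈ F.relSpace ↔ ∑ ρ, u ρ • F.rayVec ρ = 0 := by
  simp [relSpace, Fintype.linearCombination_apply]

theorem mem_relSpace_of_int {k : Fin n → ℤ} (h : ∑ ρ, k ρ • F.ray ρ = 0) :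
    (fun ρ => (k ρ : ℝ)) ∈ F.relSpace := by
  rw [mem_relSpace]
  ext j
  have := congrFun h j
  simp only [Finset.sum_apply, Pi.smul_apply, smul_eq_mul, rayVec, Pi.zero_apply] at this ⊢
  exact_mod_cast this

theorem finrank_relSpace (σ₀ : F.MaxCone) : Module.finrank ℝ F.relSpace + d = n := by
  have hsurj : LinearMap.range (Fintype.linearCombination ℝ F.rayVec) = ⊤ := by
    rw [LinearMap.range_eq_top]
    intro x
    have hx := F.sum_realExt_smul σ₀ x
    have : x ∈ LinearMap.range (Fintype.linearCombination ℝ F.rayVec) := by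
      rw [hx]
      refine Submodule.sum_mem _ fun ρ _ => Submodule.smul_mem _ _ ⟨Pi.single ρ.1 1, ?_⟩
      rw [Fintype.linearCombination_apply_single, one_smul]
    exact this
  have := LinearMap.finrank_range_add_finrank_ker (Fintype.linearCombination ℝ F.rayVec)
  rw [hsurj, finrank_top] at this
  simp only [Module.finrank_fin_fun] at this
  rw [relSpace]
  omega

/-- The sum of the coordinates. On the space of relations it is the pairing with `-K_X`. -/
noncomputable def sumForm (n : ℕ) : (Fin n → ℝ) →ₗ[ℝ] ℝ := ∑ i, LinearMap.proj i

theorem sumForm_apply (u : Fin n → ℝ) : sumForm n u = ∑ i, u i := by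
  simp [sumForm]

/-- Every ray occurs in a relation with nonnegative coefficients. -/
theorem exists_pos_relation (i : Fin n) :
    ∃ κ ∈ F.relSpace, 0 < κ i ∧ κ i ≤ sumForm n κ := by
  classical
  obtain ⟨w, σ, h1, -⟩ := F.exists_relation (Pi.single i 1)
  refine ⟨_, F.mem_relSpace_of_int h1, ?_, ?_⟩
  · simp; positivity
  · rw [sumForm_apply]
    exact Finset.single_le_sum (f := fun ρ => ((((Pi.single i 1 : Fin n → ℕ) ρ + w ρ : ℕ) : ℤ) : ℝ))
      (fun ρ _ => by positivity) (Finset.mem_univ i)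

/-- The relations of anticanonical degree `0` form a space of dimension at most `r - 1`. -/
theorem finrank_relSpace_inf (σ₀ : F.MaxCone) (hn : 0 < n) :
    Module.finrank ℝ (F.relSpace ⊓ LinearMap.ker (sumForm n) : Submodule ℝ (Fin n → ℝ)) + 1
      ≤ n - d := by
  obtain ⟨κ, hκ, h1, h2⟩ := F.exists_pos_relation ⟨0, hn⟩
  have hlt : F.relSpace ⊓ LinearMap.ker (sumForm n) < F.relSpace := by
    refine lt_of_le_of_ne inf_le_left fun h => ?_
    have : κ ∈ F.relSpace ⊓ LinearMap.ker (sumForm n) := by rw [h]; exact hκ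
    have h3 := LinearMap.mem_ker.1 this.2
    linarith
  have := Submodule.finrank_lt_finrank_of_lt hlt
  have := F.finrank_relSpace σ₀
  omega

/-- The condition `X^{D₀(σ)} ≤ 2 ^ K`, for all `σ`, on the exponents of a tuple `X = 2 ^ k`. -/
def LogBounded (K : ℕ) (k : Fin n → ℕ) : Prop :=
  ∀ σ : F.MaxCone, ∑ ρ, F.heightExponent σ ρ * k ρ ≤ K

theorem LogBounded.relation {F : RegularCompleteFan d n} {K : ℕ} {k : Fin n → ℕ}
    (hk : F.LogBounded K k) :
    ∃ w : Fin n → ℕ, (∑ ρ, ((k ρ + w ρ : ℕ) : ℤ) • F.ray ρ = 0) ∧ ∑ ρ, k ρ + ∑ ρ, w ρ ≤ K := by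
  obtain ⟨w, σ, h1, h2⟩ := F.exists_relation k
  refine ⟨w, h1, ?_⟩
  have := hk σ
  rw [h2] at this
  exact_mod_cast this

theorem LogBounded.le {F : RegularCompleteFan d n} {K : ℕ} {k : Fin n → ℕ}
    (hk : F.LogBounded K k) (ρ : Fin n) : k ρ ≤ K := by
  obtain ⟨w, -, h⟩ := hk.relation
  have := Finset.single_le_sum (f := k) (fun _ _ => Nat.zero_le _) (Finset.mem_univ ρ)
  omega

theorem sum_half_pow_le (n K : ℕ) :
    ∑ w ∈ Fintype.piFinset (fun _ : Fin n => Finset.range (K + 1)), (1 / 2 : ℝ) ^ (∑ ρ, w ρ) ≤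
      2 ^ n := by
  have h1 : ∀ w : Fin n → ℕ, (1 / 2 : ℝ) ^ (∑ ρ, w ρ) = ∏ ρ, (1 / 2 : ℝ) ^ w ρ := fun w =>
    (Finset.prod_pow_eq_pow_sum _ _ _).symm
  simp_rw [h1]
  rw [← Finset.prod_univ_sum (fun _ : Fin n => Finset.range (K + 1)) fun _ a => (1 / 2 : ℝ) ^ a]
  have h2 : ∑ a ∈ Finset.range (K + 1), (1 / 2 : ℝ) ^ a ≤ 2 :=
    (Summable.sum_le_tsum _ (fun _ _ => by positivity) summable_geometric_two).trans
      tsum_geometric_two.le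
  calc ∏ _ρ : Fin n, ∑ a ∈ Finset.range (K + 1), (1 / 2 : ℝ) ^ a ≤ ∏ _ρ : Fin n, (2 : ℝ) :=
        Finset.prod_le_prod (fun _ _ => Finset.sum_nonneg fun _ _ => by positivity) fun _ _ => h2
    _ = 2 ^ n := by simp

theorem sum_two_pow_le (K : ℕ) : ∑ h ∈ Finset.range (K + 1), (2 : ℝ) ^ h ≤ 2 ^ (K + 1) := by
  rw [geom_sum_eq (by norm_num)]
  norm_num

/-- A dyadic count. Completing `k` to a relation by `w`, the number of tuples of size `2 ^ k` is
`2 ^ h * 2 ^ (- ∑ w)`, where `h` is the height; so the sum is dominated by the pairs `(h, w)` with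
`h` maximal and `w` small, and each pair is taken by few tuples `k`. -/
theorem sum_two_pow_logBounded (K s : ℕ) (W : Submodule ℝ (Fin n → ℝ))
    (hW : Module.finrank ℝ W ≤ s) (S : Finset (Fin n → ℕ)) (hS : ∀ k ∈ S, F.LogBounded K k)
    (hd : ∀ k ∈ S, ∀ k' ∈ S, (fun i => (k i : ℝ) - k' i) ∈ F.relSpace ⊓ LinearMap.ker (sumForm n) →
      (fun i => (k i : ℝ) - k' i) ∈ W) :
    ∑ k ∈ S, (2 : ℝ) ^ (∑ ρ, k ρ) ≤ 2 ^ (K + 1) * 2 ^ n * (K + 1) ^ s := by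
  classical
  choose! w hw1 hw2 using fun k (hk : k ∈ S) => (hS k hk).relation
  set R := (Finset.range (K + 1)) ×ˢ (Fintype.piFinset fun _ : Fin n => Finset.range (K + 1))
    with hR
  set g : (Fin n → ℕ) → ℕ × (Fin n → ℕ) := fun k => (∑ ρ, k ρ + ∑ ρ, w k ρ, w k) with hg
  have hmaps : ∀ k ∈ S, g k ∈ R := by
    intro k hk
    have h1 := hw2 k hk
    simp only [hR, hg, Finset.mem_product, Finset.mem_range, Fintype.mem_piFinset]
    refine ⟨by omega, fun ρ => ?_⟩
    have := Finset.single_le_sum (f := w k) (fun _ _ => Nat.zero_le _) (Finset.mem_univ ρ)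
    omega
  rw [← Finset.sum_fiberwise_of_maps_to hmaps]
  have hfib : ∀ p ∈ R, ∑ k ∈ S with g k = p, (2 : ℝ) ^ (∑ ρ, k ρ) ≤
      (2 : ℝ) ^ p.1 * (1 / 2) ^ (∑ ρ, p.2 ρ) * (K + 1) ^ s := by
    intro p _
    have hval : ∀ k ∈ S.filter (fun k => g k = p), (2 : ℝ) ^ (∑ ρ, k ρ) ≤
        (2 : ℝ) ^ p.1 * (1 / 2) ^ (∑ ρ, p.2 ρ) := by
      intro k hk
      obtain ⟨hk1, rfl⟩ := Finset.mem_filter.1 hk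
      simp only [hg]
      rw [pow_add, mul_assoc, ← mul_pow]
      norm_num
    have hcard : (S.filter fun k => g k = p).card ≤ (K + 1) ^ s := by
      refine card_le_pow_finrank K s W hW _ (fun k hk => (hS k (Finset.mem_filter.1 hk).1).le) ?_
      intro k hk k' hk'
      obtain ⟨hk1, hk2⟩ := Finset.mem_filter.1 hk
      obtain ⟨hk1', hk2'⟩ := Finset.mem_filter.1 hk'
      have e1 : w k = w k' := by
        have := hk2.trans hk2'.symm
        exact (Prod.ext_iff.1 this).2
      have e2 : ∑ ρ, k ρ = ∑ ρ, k' ρ := by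
        have := (Prod.ext_iff.1 (hk2.trans hk2'.symm)).1
        simp only [hg, e1] at this
        omega
      refine hd k hk1 k' hk1' ⟨?_, ?_⟩
      · have a1 := F.mem_relSpace_of_int (hw1 k hk1)
        have a2 := F.mem_relSpace_of_int (hw1 k' hk1')
        have a3 := F.relSpace.sub_mem a1 a2
        have a4 : (fun i => (k i : ℝ) - k' i) = (fun ρ => (((k ρ + w k ρ : ℕ) : ℤ) : ℝ)) -
            fun ρ => (((k' ρ + w k' ρ : ℕ) : ℤ) : ℝ) := by
          ext ρ
          simp [e1]
        rw [a4]
        exact a3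
      · have e3 : ((∑ ρ, k ρ : ℕ) : ℝ) = ((∑ ρ, k' ρ : ℕ) : ℝ) := by rw [e2]
        push_cast at e3
        rw [SetLike.mem_coe, LinearMap.mem_ker, sumForm_apply, Finset.sum_sub_distrib, e3, sub_self]
    refine (Finset.sum_le_card_nsmul _ _ _ hval).trans ?_
    rw [nsmul_eq_mul, mul_comm]
    refine mul_le_mul_of_nonneg_left ?_ (by positivity)
    exact_mod_cast hcard
  refine (Finset.sum_le_sum hfib).trans ?_
  rw [← Finset.sum_mul, hR, Finset.sum_product]
  refine mul_le_mul_of_nonneg_right ?_ (by positivity)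
  simp only [← Finset.mul_sum, ← Finset.sum_mul]
  exact mul_le_mul (sum_two_pow_le K) (sum_half_pow_le n K)
    (Finset.sum_nonneg fun _ _ => by positivity) (by positivity)

/-- If the `i`-th coordinate is proportional to the degree on the relations, then in the completion
of a tuple with `k i = 0` to a relation a positive proportion of the degree is taken by the
completion, so that the tuple itself is small. -/
theorem exists_saving (i : Fin n)
    (hdep : ∀ u ∈ F.relSpace ⊓ LinearMap.ker (sumForm n), u i = 0) :
    ∃ δ : ℝ, 0 < δ ∧ ∀ K : ℕ, ∀ k : Fin n → ℕ, F.LogBounded K k → k i = 0 →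
      ((∑ ρ, k ρ : ℕ) : ℝ) ≤ (1 - δ) * K := by
  obtain ⟨κ, hκ, hκ1, hκ2⟩ := F.exists_pos_relation i
  have hpos : 0 < sumForm n κ := hκ1.trans_le hκ2
  refine ⟨κ i / sumForm n κ, by positivity, fun K k hk hki => ?_⟩
  obtain ⟨w, h1, h2⟩ := hk.relation
  have hrel := F.mem_relSpace_of_int h1
  set u : Fin n → ℝ := fun ρ => ((((k ρ + w ρ : ℕ) : ℤ)) : ℝ) with hu
  -- A relation of degree `0`, whose `i`-th coordinate vanishes by hypothesis.
  have hmem : (sumForm n κ) • u - (sumForm n u) • κ ∈ F.relSpace ⊓ LinearMap.ker (sumForm n) := by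
    refine ⟨F.relSpace.sub_mem (F.relSpace.smul_mem _ hrel) (F.relSpace.smul_mem _ hκ), ?_⟩
    rw [SetLike.mem_coe, LinearMap.mem_ker, map_sub, map_smul, map_smul, smul_eq_mul, smul_eq_mul]
    ring
  have h3 := hdep _ hmem
  simp only [Pi.sub_apply, Pi.smul_apply, smul_eq_mul] at h3
  have hui : u i = w i := by simp [hu, hki]
  have hsum : sumForm n u = ((∑ ρ, k ρ : ℕ) : ℝ) + ((∑ ρ, w ρ : ℕ) : ℝ) := by
    rw [sumForm_apply]
    push_cast
    simp [hu, Finset.sum_add_distrib]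
  have hw : (w i : ℝ) ≤ ((∑ ρ, w ρ : ℕ) : ℝ) := by
    exact_mod_cast Finset.single_le_sum (f := w) (fun _ _ => Nat.zero_le _) (Finset.mem_univ i)
  have hK : sumForm n u ≤ K := by rw [hsum]; exact_mod_cast h2
  have hδ : κ i / sumForm n κ ≤ 1 := (div_le_one hpos).2 hκ2
  have hwi : (w i : ℝ) = κ i / sumForm n κ * sumForm n u := by
    rw [hui] at h3
    field_simp
    linarith
  have : ((∑ ρ, k ρ : ℕ) : ℝ) ≤ (1 - κ i / sumForm n κ) * sumForm n u := by
    rw [sub_mul, one_mul, ← hwi]; linarith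
  exact this.trans (mul_le_mul_of_nonneg_left hK (by linarith))

/-- The positive integral tuples of height at most `B`, without any coprimality condition. -/
def boundedTuples (B : ℝ) : Set (Fin n → ℕ) :=
  {X | (∀ ρ, 0 < X ρ) ∧ ∀ σ : F.MaxCone, (F.heightMonomial σ X : ℝ) ≤ B}

theorem logBounded_log (hgen : F.GloballyGenerated F.anticanonical) {B : ℝ} {X : Fin n → ℕ}
    (hX : X ∈ F.boundedTuples B) :
    F.LogBounded (Nat.log 2 ⌊B⌋₊) (fun ρ => Nat.log 2 (X ρ)) := by
  intro σ
  have h1 : 2 ^ (∑ ρ, (F.heightExponent σ ρ).toNat * Nat.log 2 (X ρ)) ≤ ⌊B⌋₊ := by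
    refine Nat.le_floor (le_trans ?_ (hX.2 σ))
    norm_cast
    rw [← Finset.prod_pow_eq_pow_sum, heightMonomial]
    refine Finset.prod_le_prod' fun ρ _ => ?_
    rw [mul_comm, pow_mul]
    exact Nat.pow_le_pow_left (Nat.pow_log_le_self 2 (hX.1 ρ).ne') _
  have h2 := Nat.le_log_of_pow_le (by norm_num) h1
  have h3 : ∀ ρ, F.heightExponent σ ρ = ((F.heightExponent σ ρ).toNat : ℤ) := fun ρ =>
    (Int.toNat_of_nonneg (F.heightExponent_nonneg hgen σ ρ)).symm
  calc ∑ ρ, F.heightExponent σ ρ * ((Nat.log 2 (X ρ) : ℕ) : ℤ)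
      = ((∑ ρ, (F.heightExponent σ ρ).toNat * Nat.log 2 (X ρ) : ℕ) : ℤ) := by
        push_cast
        exact Finset.sum_congr rfl fun ρ _ => by rw [h3]; simp
    _ ≤ _ := by exact_mod_cast h2

theorem boundedTuples_lt (hgen : F.GloballyGenerated F.anticanonical) {B : ℝ} {X : Fin n → ℕ}
    (hX : X ∈ F.boundedTuples B) (ρ : Fin n) : X ρ < 2 ^ (Nat.log 2 ⌊B⌋₊ + 1) :=
  Nat.lt_pow_of_log_lt (by norm_num) (Nat.lt_succ_of_le ((F.logBounded_log hgen hX).le ρ))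

theorem finite_boundedTuples (hgen : F.GloballyGenerated F.anticanonical) (B : ℝ) :
    (F.boundedTuples B).Finite := by
  refine (Fintype.piFinset fun _ : Fin n =>
    Finset.range (2 ^ (Nat.log 2 ⌊B⌋₊ + 1))).finite_toSet.subset fun X hX => ?_
  simp only [Fintype.coe_piFinset, Set.mem_pi]
  intro ρ _
  simpa using F.boundedTuples_lt hgen hX ρ

/-- Passage from tuples to their dyadic sizes. -/
theorem card_le_sum_two_pow (T : Finset (Fin n → ℕ)) (hT : ∀ X ∈ T, ∀ ρ, 0 < X ρ) :
    (T.card : ℝ) ≤ ∑ k ∈ T.image (fun X ρ => Nat.log 2 (X ρ)), (2 : ℝ) ^ (∑ ρ, k ρ) := by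
  classical
  rw [Finset.card_eq_sum_card_image (fun X ρ => Nat.log 2 (X ρ)) T]
  push_cast
  refine Finset.sum_le_sum fun k _ => ?_
  have hsub : T.filter (fun X => (fun ρ => Nat.log 2 (X ρ)) = k) ⊆
      Fintype.piFinset fun ρ => Finset.Ico (2 ^ k ρ) (2 ^ (k ρ + 1)) := by
    intro X hX
    obtain ⟨h1, rfl⟩ := Finset.mem_filter.1 hX
    rw [Fintype.mem_piFinset]
    intro ρ
    rw [Finset.mem_Ico]
    exact ⟨Nat.pow_log_le_self 2 (hT X h1 ρ).ne', Nat.lt_pow_succ_log_self (by norm_num) _⟩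
  have := Finset.card_le_card hsub
  rw [Fintype.card_piFinset] at this
  have h2 : ∏ ρ, (Finset.Ico (2 ^ k ρ) (2 ^ (k ρ + 1))).card = 2 ^ (∑ ρ, k ρ) := by
    rw [← Finset.prod_pow_eq_pow_sum]
    refine Finset.prod_congr rfl fun ρ _ => ?_
    rw [Nat.card_Ico, pow_succ]; omega
  rw [h2] at this
  exact_mod_cast this

end RegularCompleteFan

theorem one_le_log_of_three_le {B : ℝ} (hB : 3 ≤ B) : 1 ≤ Real.log B := by
  rw [Real.le_log_iff_exp_le (by linarith)]
  exact (Real.exp_one_lt_d9.le.trans (by norm_num)).trans hB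

theorem two_pow_log_floor_le {x : ℝ} (hx : 1 ≤ x) : (2 : ℝ) ^ (Nat.log 2 ⌊x⌋₊) ≤ x := by
  have h0 : ⌊x⌋₊ ≠ 0 := (Nat.floor_pos.2 hx).ne'
  calc (2 : ℝ) ^ (Nat.log 2 ⌊x⌋₊) ≤ (⌊x⌋₊ : ℝ) := by exact_mod_cast Nat.pow_log_le_self 2 h0
    _ ≤ x := Nat.floor_le (by linarith)

theorem log_le_log_floor_add_one {B c : ℝ} (hB : 3 ≤ B) (hc : 1 ≤ c) :
    Real.log B ≤ Nat.log 2 ⌊c * B⌋₊ + 1 := by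
  have h1 : ⌊c * B⌋₊ + 1 ≤ 2 ^ (Nat.log 2 ⌊c * B⌋₊ + 1) :=
    Nat.lt_pow_succ_log_self (by norm_num) _
  have h2 : B ≤ 2 ^ (Nat.log 2 ⌊c * B⌋₊ + 1) := by
    calc B ≤ c * B := by nlinarith
      _ ≤ ⌊c * B⌋₊ + 1 := (Nat.lt_floor_add_one _).le
      _ ≤ _ := by exact_mod_cast h1
  have h3 := Real.log_le_log (by linarith) h2
  rw [Real.log_pow] at h3
  push_cast at h3
  have h4 : Real.log 2 ≤ 1 := by linarith [Real.log_two_lt_d9]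
  calc Real.log B ≤ (Nat.log 2 ⌊c * B⌋₊ + 1) * Real.log 2 := h3
    _ ≤ (Nat.log 2 ⌊c * B⌋₊ + 1) * 1 := by gcongr
    _ = _ := mul_one _

theorem log_floor_add_one_le {B c : ℝ} (hB : 3 ≤ B) (hc : 1 ≤ c) :
    (Nat.log 2 ⌊c * B⌋₊ : ℝ) + 1 ≤ (2 * Real.log c + 3) * Real.log B := by
  have h1 := two_pow_log_floor_le (x := c * B) (by nlinarith)
  have h2 := Real.log_le_log (by positivity) h1
  rw [Real.log_pow, Real.log_mul (by linarith) (by linarith)] at h2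
  have h3 := one_le_log_of_three_le hB
  have h4 := Real.log_nonneg hc
  have h5 : (1 : ℝ) / 2 ≤ Real.log 2 := by linarith [Real.log_two_gt_d9]
  have h6 : (Nat.log 2 ⌊c * B⌋₊ : ℝ) * (1 / 2) ≤ Nat.log 2 ⌊c * B⌋₊ * Real.log 2 := by gcongr
  nlinarith

theorem exists_pow_le_two_rpow (m : ℕ) {δ : ℝ} (hδ : 0 < δ) :
    ∃ C : ℝ, 0 < C ∧ ∀ K : ℕ, ((K : ℝ) + 1) ^ m ≤ C * 2 ^ (δ * K) := by
  have hl : 0 < Real.log 2 := Real.log_pos (by norm_num)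
  refine ⟨(m.factorial : ℝ) / (δ * Real.log 2) ^ m * Real.exp (δ * Real.log 2), by positivity,
    fun K => ?_⟩
  have h1 := Real.pow_div_factorial_le_exp (δ * Real.log 2 * (K + 1)) (by positivity) m
  have h2 : Real.exp (δ * Real.log 2 * (K + 1)) =
      Real.exp (δ * Real.log 2) * 2 ^ (δ * K) := by
    rw [Real.rpow_def_of_pos (by norm_num), ← Real.exp_add]
    congr 1; ring
  rw [h2, mul_pow, div_le_iff₀ (by positivity)] at h1
  have h3 : 0 < (δ * Real.log 2) ^ m := by positivity
  calc ((K : ℝ) + 1) ^ m = ((δ * Real.log 2) ^ m * (K + 1) ^ m) / (δ * Real.log 2) ^ m := by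
        field_simp
    _ ≤ (Real.exp (δ * Real.log 2) * 2 ^ (δ * K) * m.factorial) / (δ * Real.log 2) ^ m := by gcongr
    _ = _ := by ring

namespace RegularCompleteFan

variable {d n : ℕ} (F : RegularCompleteFan d n)

/-- Tuples of bounded height with a further property `P`, for which the logarithms of the tuples
vary in a space `W` of relations of degree `0`. The dyadic sizes contribute
`(log B) ^ dim W`. -/
theorem ncard_le_of_finrank (hgen : F.GloballyGenerated F.anticanonical) (s : ℕ)
    (W : Submodule ℝ (Fin n → ℝ)) (hW : Module.finrank ℝ W ≤ s) {c : ℝ} (hc : 1 ≤ c)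
    (P : (Fin n → ℕ) → Prop)
    (hd : ∀ u ∈ F.relSpace ⊓ LinearMap.ker (sumForm n), ∀ X Y : Fin n → ℕ, P X → P Y →
      (u = fun i => (Nat.log 2 (X i) : ℝ) - Nat.log 2 (Y i)) → u ∈ W) :
    ∃ C : ℝ, 0 ≤ C ∧ ∀ B : ℝ, 3 ≤ B →
      (({X ∈ F.boundedTuples (c * B) | P X}).ncard : ℝ) ≤ C * (B * Real.log B ^ s) := by
  classical
  refine ⟨2 * 2 ^ n * c * (2 * Real.log c + 3) ^ s, by
    have := Real.log_nonneg hc; positivity, fun B hB => ?_⟩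
  have hfin : ({X ∈ F.boundedTuples (c * B) | P X}).Finite :=
    (F.finite_boundedTuples hgen (c * B)).subset fun X hX => hX.1
  rw [Set.ncard_eq_toFinset_card _ hfin]
  have hmem : ∀ X ∈ hfin.toFinset, X ∈ F.boundedTuples (c * B) ∧ P X := fun X hX => by
    simpa using hX
  refine (card_le_sum_two_pow _ fun X hX => (hmem X hX).1.1).trans ?_
  refine (F.sum_two_pow_logBounded (Nat.log 2 ⌊c * B⌋₊) s W hW _ ?_ ?_).trans ?_
  · intro k hk
    obtain ⟨X, hX, rfl⟩ := Finset.mem_image.1 hk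
    exact F.logBounded_log hgen (hmem X hX).1
  · intro k hk k' hk' hu
    obtain ⟨X, hX, rfl⟩ := Finset.mem_image.1 hk
    obtain ⟨Y, hY, rfl⟩ := Finset.mem_image.1 hk'
    exact hd _ hu X Y (hmem X hX).2 (hmem Y hY).2 rfl
  · have h1 := two_pow_log_floor_le (x := c * B) (by nlinarith)
    have h2 := log_floor_add_one_le hB hc
    have h3 := one_le_log_of_three_le hB
    calc (2 : ℝ) ^ (Nat.log 2 ⌊c * B⌋₊ + 1) * 2 ^ n * (Nat.log 2 ⌊c * B⌋₊ + 1) ^ s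
        = 2 * 2 ^ n * (2 ^ (Nat.log 2 ⌊c * B⌋₊) * (Nat.log 2 ⌊c * B⌋₊ + 1) ^ s) := by ring
      _ ≤ 2 * 2 ^ n * ((c * B) * ((2 * Real.log c + 3) * Real.log B) ^ s) := by gcongr
      _ = _ := by rw [mul_pow]; ring

/-- `#{X : H(X) ≤ B} ≪ B (log B) ^ (r - 1)`. -/
theorem ncard_boundedTuples_le (hgen : F.GloballyGenerated F.anticanonical) (σ₀ : F.MaxCone)
    (hn : 0 < n) {c : ℝ} (hc : 1 ≤ c) :
    ∃ C : ℝ, 0 ≤ C ∧ ∀ B : ℝ, 3 ≤ B →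
      ((F.boundedTuples (c * B)).ncard : ℝ) ≤ C * (B * Real.log B ^ ((n : ℝ) - d - 1)) := by
  have hdim := F.finrank_relSpace_inf σ₀ hn
  obtain ⟨C, hC0, hC⟩ := F.ncard_le_of_finrank hgen (n - d - 1)
    (F.relSpace ⊓ LinearMap.ker (sumForm n)) (by omega) hc (fun _ => True)
    (fun u hu _ _ _ _ _ => hu)
  refine ⟨C, hC0, fun B hB => ?_⟩
  have h := hC B hB
  simp only [and_true] at h
  have e : (n : ℝ) - d - 1 = ((n - d - 1 : ℕ) : ℝ) := by
    have : n = (n - d - 1) + d + 1 := by omega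
    rw [this]; push_cast
    have : (n - d - 1) + d + 1 - d - 1 = n - d - 1 := by omega
    rw [this]; ring
  rw [e, Real.rpow_natCast]
  exact h

/-- `#{X : H(X) ≤ B, X_i = 1} ≪ B (log B) ^ (r - 2)`. -/
theorem ncard_slice_le (hgen : F.GloballyGenerated F.anticanonical) (σ₀ : F.MaxCone)
    {c : ℝ} (hc : 1 ≤ c) (i : Fin n) :
    ∃ C : ℝ, 0 ≤ C ∧ ∀ B : ℝ, 3 ≤ B →
      (({X ∈ F.boundedTuples (c * B) | X i = 1}).ncard : ℝ) ≤
        C * (B * Real.log B ^ ((n : ℝ) - d - 2)) := by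
  classical
  have hdim := F.finrank_relSpace_inf σ₀ i.pos
  -- Either `X i = 1` saves a power of `B`, or it lowers the dimension of the space of relations of
  -- degree `0`.
  by_cases hdep : ∀ u ∈ F.relSpace ⊓ LinearMap.ker (sumForm n), u i = 0
  · obtain ⟨δ, hδ, hsave⟩ := F.exists_saving i hdep
    obtain ⟨A, hA0, hA⟩ := exists_pow_le_two_rpow (n + 1) hδ
    refine ⟨A * c, by positivity, fun B hB => ?_⟩
    set K := Nat.log 2 ⌊c * B⌋₊ with hK
    have h1 := two_pow_log_floor_le (x := c * B) (by nlinarith)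
    have h3 := one_le_log_of_three_le hB
    have h4 := log_le_log_floor_add_one hB hc
    rw [← hK] at h1 h4
    have hfin : ({X ∈ F.boundedTuples (c * B) | X i = 1}).Finite :=
      (F.finite_boundedTuples hgen (c * B)).subset fun X hX => hX.1
    rw [Set.ncard_eq_toFinset_card _ hfin]
    have hmem : ∀ X ∈ hfin.toFinset, X ∈ F.boundedTuples (c * B) ∧ X i = 1 := fun X hX => by
      simpa using hX
    refine (card_le_sum_two_pow _ fun X hX => (hmem X hX).1.1).trans ?_
    have hterm : ∀ k ∈ hfin.toFinset.image (fun X ρ => Nat.log 2 (X ρ)),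
        (2 : ℝ) ^ (∑ ρ, k ρ) ≤ 2 ^ ((1 - δ) * (K : ℝ)) := by
      intro k hk
      obtain ⟨X, hX, rfl⟩ := Finset.mem_image.1 hk
      have := hsave K _ (F.logBounded_log hgen (hmem X hX).1) (by simp [(hmem X hX).2])
      rw [← Real.rpow_natCast]
      exact Real.rpow_le_rpow_of_exponent_le (by norm_num) this
    have hcard : (hfin.toFinset.image (fun X ρ => Nat.log 2 (X ρ))).card ≤ (K + 1) ^ n := by
      have hsub : hfin.toFinset.image (fun X ρ => Nat.log 2 (X ρ)) ⊆
          Fintype.piFinset fun _ : Fin n => Finset.range (K + 1) := by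
        intro k hk
        obtain ⟨X, hX, rfl⟩ := Finset.mem_image.1 hk
        rw [Fintype.mem_piFinset]
        intro ρ
        have := (F.logBounded_log hgen (hmem X hX).1).le ρ
        simp only [Finset.mem_range]
        exact Nat.lt_succ_of_le this
      simpa using Finset.card_le_card hsub
    refine (Finset.sum_le_card_nsmul _ _ _ hterm).trans ?_
    rw [nsmul_eq_mul]
    have e1 : (2 : ℝ) ^ ((1 - δ) * (K : ℝ)) * 2 ^ (δ * (K : ℝ)) = 2 ^ K := by
      rw [← Real.rpow_add (by norm_num), ← Real.rpow_natCast]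
      congr 1; ring
    have hL0 : 0 < Real.log B := by linarith
    have e2 : (Real.log B)⁻¹ ≤ Real.log B ^ ((n : ℝ) - d - 2) := by
      rw [← Real.rpow_neg_one]
      refine Real.rpow_le_rpow_of_exponent_le h3 ?_
      have : ((d + 1 : ℕ) : ℝ) ≤ n := by exact_mod_cast (by omega : d + 1 ≤ n)
      push_cast at this
      linarith
    calc ((hfin.toFinset.image (fun X ρ => Nat.log 2 (X ρ))).card : ℝ) * 2 ^ ((1 - δ) * (K : ℝ))
        ≤ ((K : ℝ) + 1) ^ n * 2 ^ ((1 - δ) * (K : ℝ)) := by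
          gcongr; exact_mod_cast hcard
      _ = ((K : ℝ) + 1) ^ (n + 1) * 2 ^ ((1 - δ) * (K : ℝ)) * ((K : ℝ) + 1)⁻¹ := by
          field_simp
          ring
      _ ≤ (A * 2 ^ (δ * (K : ℝ))) * 2 ^ ((1 - δ) * (K : ℝ)) * (Real.log B)⁻¹ := by
          gcongr
          exact hA K
      _ = A * 2 ^ K * (Real.log B)⁻¹ := by rw [← e1]; ring
      _ ≤ A * (c * B) * Real.log B ^ ((n : ℝ) - d - 2) := by gcongr
      _ = _ := by ring
  · push Not at hdep
    obtain ⟨u, hu, hui⟩ := hdep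
    set W₁ := F.relSpace ⊓ LinearMap.ker (sumForm n) with hW₁
    have hlt : W₁ ⊓ LinearMap.ker (LinearMap.proj i : (Fin n → ℝ) →ₗ[ℝ] ℝ) < W₁ := by
      refine lt_of_le_of_ne inf_le_left fun h => hui ?_
      have : u ∈ W₁ ⊓ LinearMap.ker (LinearMap.proj i : (Fin n → ℝ) →ₗ[ℝ] ℝ) := by
        rw [h]; exact hu
      simpa using this.2
    have hfr := Submodule.finrank_lt_finrank_of_lt hlt
    obtain ⟨C, hC0, hC⟩ := F.ncard_le_of_finrank hgen (n - d - 2)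
      (W₁ ⊓ LinearMap.ker (LinearMap.proj i : (Fin n → ℝ) →ₗ[ℝ] ℝ)) (by omega) hc
      (fun X => X i = 1)
      (fun u hu X Y hX hY hXY => ⟨hu, by subst hXY; simp [hX, hY]⟩)
    refine ⟨C, hC0, fun B hB => ?_⟩
    have e : (n : ℝ) - d - 2 = ((n - d - 2 : ℕ) : ℝ) := by
      have : n = (n - d - 2) + d + 2 := by omega
      rw [this]; push_cast
      have : (n - d - 2) + d + 2 - d - 2 = n - d - 2 := by omega
      rw [this]; ring
    rw [e, Real.rpow_natCast]
    exact hC B hB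

end RegularCompleteFan

/-! ### Lattice points and volumes -/

section Hybrid

variable {n : ℕ}

/-- Exchange of one factor of a product measure. On a fibre in the direction `k` the measure `μ k`
exceeds `ν k` by at most `1`, and the nonempty fibres lie over the unit boxes at the points
`⌊x⌋`, `x ∈ D`, with the `k`-th coordinate replaced by `1`. -/
theorem pi_apply_le_add_card (D : Set (Fin n → ℝ)) (hD : MeasurableSet D) (M : ℝ)
    (hDM : ∀ x ∈ D, ∀ i, x i ∈ Set.Icc 1 M) (G : Finset (Fin n → ℕ))
    (hord : ∀ x i, {t | Function.update x i t ∈ D}.OrdConnected) (k : Fin n)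
    (hG : ∀ x ∈ D, Function.update (fun j => ⌊x j⌋₊) k 1 ∈ G)
    (μ ν : Fin n → Measure ℝ) [∀ i, IsFiniteMeasure (μ i)] [∀ i, IsFiniteMeasure (ν i)]
    (hμν : ∀ j, j ≠ k → μ j = ν j)
    (hcmp : ∀ S : Set ℝ, S.OrdConnected → MeasurableSet S → S ⊆ Set.Icc 1 M → μ k S ≤ ν k S + 1)
    (hbox : ∀ j, ∀ m : ℕ, μ j (Set.Ico (m : ℝ) (m + 1)) ≤ 1) :
    Measure.pi μ D ≤ Measure.pi ν D + ((G.filter fun m => m k = 1).card : ENNReal) := by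
  classical
  obtain _ | m := n
  · exact k.elim0
  set e := MeasurableEquiv.piFinSuccAbove (fun _ : Fin (m + 1) => ℝ) k with he
  set D' : Set (ℝ × (Fin m → ℝ)) := e.symm ⁻¹' D with hD'
  have hD'm : MeasurableSet D' := e.symm.measurable hD
  have hpre : e ⁻¹' D' = D := by
    ext x; simp [hD']
  have e1 : Measure.pi μ D = ((μ k).prod (Measure.pi fun j => μ (k.succAbove j))) D' := by
    rw [← (measurePreserving_piFinSuccAbove μ k).measure_preimage hD'm.nullMeasurableSet, ← he, hpre]
  have e2 : Measure.pi ν D = ((ν k).prod (Measure.pi fun j => ν (k.succAbove j))) D' := by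
    rw [← (measurePreserving_piFinSuccAbove ν k).measure_preimage hD'm.nullMeasurableSet, ← he, hpre]
  have e3 : (fun j => ν (k.succAbove j)) = fun j => μ (k.succAbove j) := by
    funext j; rw [hμν _ (Fin.succAbove_ne k j)]
  rw [e1, e2, e3, Measure.prod_apply_symm hD'm, Measure.prod_apply_symm hD'm]
  set R : Set (Fin m → ℝ) := ⋃ g ∈ G.filter (fun g => g k = 1),
    Set.univ.pi fun j => Set.Ico (g (k.succAbove j) : ℝ) (g (k.succAbove j) + 1) with hR
  have hRm : MeasurableSet R :=
    Finset.measurableSet_biUnion _ fun g _ => MeasurableSet.univ_pi fun j => measurableSet_Ico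
  have hRcard : (Measure.pi fun j => μ (k.succAbove j)) R ≤ (G.filter fun g => g k = 1).card := by
    refine (measure_biUnion_finset_le _ _).trans ?_
    refine (Finset.sum_le_card_nsmul _ _ 1 fun g _ => ?_).trans (by simp)
    rw [Measure.pi_pi]
    exact Finset.prod_le_one' fun j _ => hbox _ _
  have hsymm : ∀ t y, e.symm (t, y) = k.insertNth t y := fun _ _ => rfl
  have hpt : ∀ y, μ k ((fun t => (t, y)) ⁻¹' D') ≤
      ν k ((fun t => (t, y)) ⁻¹' D') + R.indicator 1 y := by
    intro y
    -- Only nonempty fibres differ, and those lie over `R`.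
    by_cases hne : ((fun t => (t, y)) ⁻¹' D').Nonempty
    · obtain ⟨t, ht⟩ := hne
      have ht' : k.insertNth t y ∈ D := ht
      have hyR : y ∈ R := by
        simp only [hR, Set.mem_iUnion]
        refine ⟨_, Finset.mem_filter.2 ⟨hG _ ht', by simp⟩, fun j _ => ?_⟩
        have h1 := (hDM _ ht' (k.succAbove j)).1
        simp only [Fin.insertNth_apply_succAbove] at h1
        simp only [Function.update_of_ne (Fin.succAbove_ne k j), Fin.insertNth_apply_succAbove]
        exact ⟨Nat.floor_le (by linarith), Nat.lt_floor_add_one _⟩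
      rw [Set.indicator_of_mem hyR, Pi.one_apply]
      have hset : (fun t => (t, y)) ⁻¹' D' =
          {s | Function.update (k.insertNth t y : Fin (m + 1) → ℝ) k s ∈ D} := by
        ext s
        simp only [Fin.update_insertNth]
        exact Iff.rfl
      refine hcmp _ ?_ (measurable_prodMk_right hD'm) ?_
      · rw [hset]; exact hord _ _
      · intro s hs
        have hs' : k.insertNth s y ∈ D := hs
        have := hDM _ hs' k
        simpa using this
    · rw [Set.not_nonempty_iff_eq_empty.1 hne]; simp
  calc ∫⁻ y, μ k ((fun t => (t, y)) ⁻¹' D') ∂(Measure.pi fun j => μ (k.succAbove j))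
      ≤ ∫⁻ y, ν k ((fun t => (t, y)) ⁻¹' D') + R.indicator 1 y
          ∂(Measure.pi fun j => μ (k.succAbove j)) := lintegral_mono hpt
    _ = ∫⁻ y, ν k ((fun t => (t, y)) ⁻¹' D') ∂(Measure.pi fun j => μ (k.succAbove j)) +
          (Measure.pi fun j => μ (k.succAbove j)) R := by
        rw [lintegral_add_right _ (measurable_one.indicator hRm), lintegral_indicator_one hRm]
    _ ≤ _ := by gcongr

/-- Two product measures whose factors agree on intervals up to `1` agree, on a set with
interval fibres, up to the number of integral points on the coordinate slices `x i = 1`: the factors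
are exchanged one at a time. -/
theorem pi_apply_le_add_sum_card (D : Set (Fin n → ℝ)) (hD : MeasurableSet D) (M : ℝ)
    (hDM : ∀ x ∈ D, ∀ i, x i ∈ Set.Icc 1 M) (G : Finset (Fin n → ℕ))
    (hord : ∀ x i, {t | Function.update x i t ∈ D}.OrdConnected)
    (hG : ∀ x ∈ D, ∀ k, Function.update (fun j => ⌊x j⌋₊) k 1 ∈ G)
    (μ ν : Fin n → Measure ℝ) [∀ i, IsFiniteMeasure (μ i)] [∀ i, IsFiniteMeasure (ν i)]
    (hcmp : ∀ k, ∀ S : Set ℝ, S.OrdConnected → MeasurableSet S → S ⊆ Set.Icc 1 M →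
      μ k S ≤ ν k S + 1)
    (hbox : ∀ j, ∀ m : ℕ, μ j (Set.Ico (m : ℝ) (m + 1)) ≤ 1)
    (hbox' : ∀ j, ∀ m : ℕ, ν j (Set.Ico (m : ℝ) (m + 1)) ≤ 1) :
    Measure.pi μ D ≤ Measure.pi ν D + ((∑ k, (G.filter fun m => m k = 1).card : ℕ) : ENNReal) := by
  classical
  have key : ∀ s : Finset (Fin n), Measure.pi (fun i => if i ∈ s then μ i else ν i) D ≤
      Measure.pi ν D + ((∑ k ∈ s, (G.filter fun m => m k = 1).card : ℕ) : ENNReal) := by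
    intro s
    induction s using Finset.induction_on with
    | empty => simp
    | insert a s ha ih =>
      have inst : ∀ (t : Finset (Fin n)) (i : Fin n),
          IsFiniteMeasure (if i ∈ t then μ i else ν i) := fun t i => by
        split_ifs <;> infer_instance
      have := inst s
      have := inst (insert a s)
      have step := pi_apply_le_add_card D hD M hDM G hord a (fun x hx => hG x hx a)
        (fun i => if i ∈ insert a s then μ i else ν i) (fun i => if i ∈ s then μ i else ν i)
        (fun j hj => by simp [hj]) (by simpa [ha] using hcmp a)
        (fun j m => by split_ifs; exacts [hbox j m, hbox' j m])
      refine step.trans ?_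
      rw [Finset.sum_insert ha, Nat.cast_add, add_comm ((_ : ℕ) : ENNReal), ← add_assoc]
      gcongr
  have := key Finset.univ
  simpa using this

theorem pi_sum_dirac (A : Fin n → Finset ℝ) :
    Measure.pi (fun i => ∑ a ∈ A i, Measure.dirac a) =
      ∑ x ∈ Fintype.piFinset A, (Measure.dirac x : Measure (Fin n → ℝ)) := by
  have hfin : ∀ i, SigmaFinite (∑ a ∈ A i, Measure.dirac a) := fun _ => inferInstance
  refine @Measure.pi_eq (Fin n) (fun _ => ℝ) _ _ (fun i => ∑ a ∈ A i, Measure.dirac a) hfin _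
    fun s hs => ?_
  have h1 : ∀ x : Fin n → ℝ, Measure.dirac x (Set.univ.pi s) = ∏ i, Measure.dirac (x i) (s i) := by
    intro x
    rw [Measure.dirac_apply' _ (MeasurableSet.univ_pi hs)]
    simp_rw [Measure.dirac_apply' _ (hs _)]
    by_cases h : x ∈ Set.univ.pi s
    · rw [Set.indicator_of_mem h]
      symm
      refine Finset.prod_eq_one fun i _ => ?_
      rw [Set.indicator_of_mem (h i trivial)]; rfl
    · rw [Set.indicator_of_notMem h]
      rw [Set.mem_univ_pi, not_forall] at h
      obtain ⟨i, hi⟩ := h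
      exact (Finset.prod_eq_zero (Finset.mem_univ i) (Set.indicator_of_notMem hi _)).symm
  simp only [Measure.finsetSum_apply, h1]
  exact (Finset.prod_univ_sum A fun i a => Measure.dirac a (s i)).symm

theorem pi_smul_restrict (c : Fin n → ENNReal) (hc : ∀ i, c i ≠ ⊤) (S : Set ℝ)
    (hS : volume S ≠ ⊤) :
    Measure.pi (fun i => c i • (volume : Measure ℝ).restrict S) =
      (∏ i, c i) • (volume : Measure (Fin n → ℝ)).restrict (Set.univ.pi fun _ => S) := by
  have : ∀ i, IsFiniteMeasure (c i • (volume : Measure ℝ).restrict S) := fun i => by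
    have : IsFiniteMeasure ((volume : Measure ℝ).restrict S) := ⟨by simpa using hS.lt_top⟩
    exact Measure.smul_finite _ (hc i)
  refine Measure.pi_eq fun s hs => ?_
  rw [volume_pi, Measure.restrict_pi_pi]
  simp only [Measure.smul_apply, smul_eq_mul]
  have : IsFiniteMeasure ((volume : Measure ℝ).restrict S) := ⟨by simpa using hS.lt_top⟩
  rw [Measure.pi_pi, Finset.prod_mul_distrib]

end Hybrid

section Progression

/-- The points `1 ≤ a ≤ M` of a residue class. -/
def progression (M q c : ℕ) : Finset ℕ := (Finset.Icc 1 M).filter fun a => a ≡ c [MOD q]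

theorem volume_le_of_ordConnected {S : Set ℝ} (hS : S.OrdConnected) {a b : ℝ} (ha : a ∈ S)
    (hb : b ∈ S) : ENNReal.ofReal (b - a) ≤ volume S := by
  rw [← Real.volume_Icc]
  exact measure_mono (hS.out ha hb)

/-- An interval contains at most `length / q + 1` points of a residue class modulo `q`. -/
theorem card_progression_le (M : ℕ) {q : ℕ} (hq : 0 < q) (c : ℕ) (S : Set ℝ) (hS : S.OrdConnected)
    [DecidablePred fun a : ℕ => (a : ℝ) ∈ S] :
    (((progression M q c).filter fun a : ℕ => (a : ℝ) ∈ S).card : ENNReal) ≤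
      ENNReal.ofReal (1 / q) * volume S + 1 := by
  set N := (progression M q c).filter fun a : ℕ => (a : ℝ) ∈ S with hN
  rcases N.eq_empty_or_nonempty with h | hne
  · rw [h]; simp
  have hmin := N.min'_mem hne
  have hmax := N.max'_mem hne
  set a := N.min' hne
  set b := N.max' hne
  have hab : a ≤ b := N.min'_le _ hmax
  have hvol := volume_le_of_ordConnected hS (Finset.mem_filter.1 hmin).2 (Finset.mem_filter.1 hmax).2
  have hcard : N.card ≤ (b - a) / q + 1 := by
    have hmaps : ∀ x ∈ N, (x - a) / q ∈ Finset.range ((b - a) / q + 1) := fun x hx => by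
      rw [Finset.mem_range, Nat.lt_succ_iff]
      exact Nat.div_le_div_right (Nat.sub_le_sub_right (N.le_max' x hx) a)
    have hmod : ∀ x ∈ N, q * ((x - a) / q) = x - a := fun x hx => by
      have h1 := (Finset.mem_filter.1 (Finset.mem_filter.1 hx).1).2
      have h2 := (Finset.mem_filter.1 (Finset.mem_filter.1 hmin).1).2
      exact Nat.mul_div_cancel' ((Nat.modEq_iff_dvd' (N.min'_le x hx)).1 (h2.trans h1.symm))
    have := Finset.card_le_card_of_injOn (fun x => (x - a) / q) hmaps (by
      intro x hx y hy hxy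
      have h1 := hmod x hx
      have h2 := hmod y hy
      have h3 := N.min'_le x hx
      have h4 := N.min'_le y hy
      simp only at hxy
      rw [hxy] at h1
      omega)
    simpa using this
  calc (N.card : ENNReal) ≤ (((b - a) / q + 1 : ℕ) : ENNReal) := by exact_mod_cast hcard
    _ = ENNReal.ofReal (((b - a) / q : ℕ) : ℝ) + 1 := by
        rw [ENNReal.ofReal_natCast]; push_cast; rfl
    _ ≤ ENNReal.ofReal (1 / q * ((b : ℝ) - a)) + 1 := by
        gcongr
        have := @Nat.cast_div_le ℝ _ _ _ (b - a) q
        rw [Nat.cast_sub hab] at this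
        rw [one_div_mul_eq_div]
        exact this
    _ ≤ _ := by
        rw [ENNReal.ofReal_mul (by positivity)]
        gcongr

/-- An interval of `[1, M]` contains at least `length / q - 1` points of a residue class. -/
theorem volume_le_card_progression (M : ℕ) {q : ℕ} (hq : 0 < q) (c : ℕ) (S : Set ℝ)
    (hS : S.OrdConnected) (hSM : S ⊆ Set.Icc 1 (M : ℝ)) [DecidablePred fun a : ℕ => (a : ℝ) ∈ S] :
    ENNReal.ofReal (1 / q) * volume S ≤
      (((progression M q c).filter fun a : ℕ => (a : ℝ) ∈ S).card : ENNReal) + 1 := by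
  classical
  set N := (progression M q c).filter fun a : ℕ => (a : ℝ) ∈ S with hN
  have hq' : (0 : ℝ) < q := by exact_mod_cast hq
  set r := c % q with hr
  have hrq : r < q := Nat.mod_lt _ hq
  have hrq' : (r : ℝ) < q := by exact_mod_cast hrq
  -- The half-open cell `[r + (j - 1) q, r + j q)` that contains `x` has index `j`. Every cell that
  -- meets `S`, except for the first one, has its left end in `S`.
  set idx : ℝ → ℕ := fun x => ⌊(x + q - r) / q⌋₊ with hidx
  have hidx1 : ∀ x ∈ S, (idx x : ℝ) * q ≤ x + q - r ∧ x + q - r < (idx x + 1) * q := by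
    intro x hx
    have h0 : 0 ≤ (x + q - r) / q := by
      have := (hSM hx).1
      apply div_nonneg <;> linarith
    constructor
    · rw [← le_div_iff₀ hq']; exact Nat.floor_le h0
    · rw [← div_lt_iff₀ hq']; exact Nat.lt_floor_add_one _
  have hbd : ∀ x ∈ S, idx x ∈ Finset.range (M + q + 1) := by
    intro x hx
    rw [Finset.mem_range]
    have h1 := (hidx1 x hx).1
    have h2 := (hSM hx).2
    have h3 : (idx x : ℝ) * 1 ≤ idx x * q := by
      gcongr; exact_mod_cast hq
    have h4 : (idx x : ℝ) < (M + q + 1 : ℕ) := by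
      push_cast
      have : (0 : ℝ) ≤ r := by positivity
      linarith
    exact_mod_cast h4
  set J := (Finset.range (M + q + 1)).filter fun j => ∃ x ∈ S, idx x = j with hJ
  have hcover : S ⊆ ⋃ j ∈ J, Set.Ico (r + (j - 1) * q : ℝ) (r + j * q) := by
    intro x hx
    simp only [Set.mem_iUnion]
    refine ⟨idx x, Finset.mem_filter.2 ⟨hbd x hx, x, hx, rfl⟩, ?_, ?_⟩
    · linarith [(hidx1 x hx).1]
    · linarith [(hidx1 x hx).2]
  have hvol : volume S ≤ J.card * ENNReal.ofReal q := by
    refine (measure_mono hcover).trans ((measure_biUnion_finset_le _ _).trans ?_)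
    refine (Finset.sum_le_card_nsmul _ _ (ENNReal.ofReal q) fun j _ => ?_).trans (by simp)
    rw [Real.volume_Ico]
    exact ENNReal.ofReal_le_ofReal (by linarith)
  have hcard : J.card ≤ N.card + 1 := by
    rcases J.eq_empty_or_nonempty with h | hne
    · rw [h]; simp
    have hmin := J.min'_mem hne
    set j₀ := J.min' hne
    have herase : (J.erase j₀).card ≤ N.card := by
      refine Finset.card_le_card_of_injOn (fun j => r + (j - 1) * q) ?_ ?_
      · intro j hj
        obtain ⟨hj1, hj2⟩ := Finset.mem_erase.1 hj
        have hlt : j₀ < j := lt_of_le_of_ne (J.min'_le j hj2) (Ne.symm hj1)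
        obtain ⟨-, x, hx, hxj⟩ := Finset.mem_filter.1 hj2
        obtain ⟨-, y, hy, hyj⟩ := Finset.mem_filter.1 hmin
        have hx1 := (hidx1 x hx).1
        have hy1 := (hidx1 y hy).2
        rw [hxj] at hx1
        rw [hyj] at hy1
        have hcast : ((r + (j - 1) * q : ℕ) : ℝ) = r + ((j : ℝ) - 1) * q := by
          push_cast [Nat.cast_sub (by omega : 1 ≤ j)]; ring
        have hj₀ : ((j₀ : ℝ) + 1) * q ≤ j * q := by
          gcongr; exact_mod_cast hlt
        have hmem : ((r + (j - 1) * q : ℕ) : ℝ) ∈ S := by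
          refine hS.out hy hx ⟨?_, ?_⟩
          · rw [hcast]; linarith
          · rw [hcast]; linarith
        have hM := hSM hmem
        refine Finset.mem_coe.2 (Finset.mem_filter.2 ⟨Finset.mem_filter.2 ⟨?_, ?_⟩, hmem⟩)
        · rw [Finset.mem_Icc]
          exact ⟨by exact_mod_cast hM.1, by exact_mod_cast hM.2⟩
        · simp [Nat.ModEq, hr]
      · intro j hj j' hj' h
        have h1 := (Finset.mem_erase.1 hj)
        have h2 := (Finset.mem_erase.1 hj')
        have h3 := lt_of_le_of_ne (J.min'_le j h1.2) (Ne.symm h1.1)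
        have h4 := lt_of_le_of_ne (J.min'_le j' h2.2) (Ne.symm h2.1)
        simp only at h
        have h5 : (j - 1) * q = (j' - 1) * q := by omega
        have h6 := Nat.eq_of_mul_eq_mul_right hq h5
        omega
    rw [Finset.card_erase_of_mem hmin] at herase
    omega
  calc ENNReal.ofReal (1 / q) * volume S
      ≤ ENNReal.ofReal (1 / q) * (J.card * ENNReal.ofReal q) := by gcongr
    _ = (ENNReal.ofReal (1 / q) * ENNReal.ofReal q) * J.card := by ring
    _ = J.card := by
        rw [← ENNReal.ofReal_mul (by positivity), one_div, inv_mul_cancel₀ hq'.ne']; simp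
    _ ≤ ((N.card + 1 : ℕ) : ENNReal) := by exact_mod_cast hcard
    _ = _ := by push_cast; rfl

end Progression

section Count

variable {n : ℕ}

/-- The number of points of a residue class in a region with interval fibres is the normalized
volume of the region, with an error term that does not depend on the moduli. -/
theorem abs_card_sub_volume_le (D : Set (Fin n → ℝ)) (hD : MeasurableSet D) (M : ℕ)
    (hDM : ∀ x ∈ D, ∀ i, x i ∈ Set.Icc 1 (M : ℝ)) (G : Finset (Fin n → ℕ))
    (hord : ∀ x i, {t | Function.update x i t ∈ D}.OrdConnected)
    (hG : ∀ x ∈ D, ∀ k, Function.update (fun j => ⌊x j⌋₊) k 1 ∈ G)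
    (q c : Fin n → ℕ) (hq : ∀ i, 0 < q i) :
    |(({X : Fin n → ℕ | (fun i => (X i : ℝ)) ∈ D ∧ ∀ i, X i ≡ c i [MOD q i]}).ncard : ℝ) -
        volume.real D / ∏ i, (q i : ℝ)| ≤
      ((∑ k, (G.filter fun m => m k = 1).card : ℕ) : ℝ) := by
  classical
  set A : Fin n → Finset ℝ := fun i => (progression M (q i) (c i)).image (fun a : ℕ => (a : ℝ))
    with hA
  set μ : Fin n → Measure ℝ := fun i => ∑ a ∈ A i, Measure.dirac a with hμ
  set ν : Fin n → Measure ℝ := fun i =>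
    ENNReal.ofReal (1 / q i) • (volume : Measure ℝ).restrict (Set.Icc 1 (M : ℝ)) with hν
  have hμfin : ∀ i, IsFiniteMeasure (μ i) := fun i => inferInstance
  have hIcc : (volume : Measure ℝ) (Set.Icc 1 (M : ℝ)) ≠ ⊤ := by simp
  have hνfin : ∀ i, IsFiniteMeasure (ν i) := fun i => by
    have : IsFiniteMeasure ((volume : Measure ℝ).restrict (Set.Icc 1 (M : ℝ))) :=
      ⟨by simp⟩
    exact Measure.smul_finite _ ENNReal.ofReal_ne_top
  have hμS : ∀ i, ∀ S : Set ℝ, MeasurableSet S →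
      μ i S = ((progression M (q i) (c i)).filter fun a : ℕ => (a : ℝ) ∈ S).card := by
    intro i S hS
    simp only [hμ, Measure.finsetSum_apply, hA]
    rw [Finset.sum_image (fun a _ b _ h => Nat.cast_injective h)]
    simp_rw [Measure.dirac_apply' _ hS]
    rw [Finset.card_filter]
    push_cast
    exact Finset.sum_congr rfl fun a _ => by by_cases h : (a : ℝ) ∈ S <;> simp [h]
  have hνS : ∀ i, ∀ S : Set ℝ, MeasurableSet S → ν i S =
      ENNReal.ofReal (1 / q i) * volume (S ∩ Set.Icc 1 (M : ℝ)) := by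
    intro i S hS
    simp only [hν, Measure.smul_apply, smul_eq_mul, Measure.restrict_apply hS]
  have hμbox : ∀ j, ∀ m : ℕ, μ j (Set.Ico (m : ℝ) (m + 1)) ≤ 1 := by
    intro j m
    rw [hμS _ _ measurableSet_Ico]
    have : ((progression M (q j) (c j)).filter fun a : ℕ => (a : ℝ) ∈ Set.Ico (m : ℝ) (m + 1)) ⊆
        {m} := by
      intro a ha
      have h1 := (Finset.mem_filter.1 ha).2
      have h2 : m ≤ a := by exact_mod_cast h1.1
      have h3 : a < m + 1 := by exact_mod_cast h1.2
      rw [Finset.mem_singleton]; omega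
    have := Finset.card_le_card this
    rw [Finset.card_singleton] at this
    exact_mod_cast this
  have hνbox : ∀ j, ∀ m : ℕ, ν j (Set.Ico (m : ℝ) (m + 1)) ≤ 1 := by
    intro j m
    rw [hνS _ _ measurableSet_Ico]
    have h1 : ENNReal.ofReal (1 / q j) ≤ 1 := by
      rw [ENNReal.ofReal_le_one]
      have : (1 : ℝ) ≤ q j := by exact_mod_cast hq j
      exact (div_le_one (by linarith)).2 this
    have h2 : volume (Set.Ico (m : ℝ) (m + 1) ∩ Set.Icc 1 (M : ℝ)) ≤ 1 := by
      refine (measure_mono Set.inter_subset_left).trans ?_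
      rw [Real.volume_Ico]; simp
    calc _ ≤ (1 : ENNReal) * 1 := mul_le_mul' h1 h2
      _ = 1 := one_mul 1
  have hcmp1 : ∀ k, ∀ S : Set ℝ, S.OrdConnected → MeasurableSet S → S ⊆ Set.Icc 1 (M : ℝ) →
      μ k S ≤ ν k S + 1 := by
    intro k S h1 h2 h3
    rw [hμS k S h2, hνS k S h2, Set.inter_eq_left.2 h3]
    exact card_progression_le M (hq k) (c k) S h1
  have hcmp2 : ∀ k, ∀ S : Set ℝ, S.OrdConnected → MeasurableSet S → S ⊆ Set.Icc 1 (M : ℝ) →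
      ν k S ≤ μ k S + 1 := by
    intro k S h1 h2 h3
    rw [hμS k S h2, hνS k S h2, Set.inter_eq_left.2 h3]
    exact volume_le_card_progression M (hq k) (c k) S h1 h3
  have hle1 := pi_apply_le_add_sum_card D hD M hDM G hord hG μ ν hcmp1 hμbox hνbox
  have hle2 := pi_apply_le_add_sum_card D hD M hDM G hord hG ν μ hcmp2 hνbox hμbox
  have hcount : Measure.pi μ D =
      (({X : Fin n → ℕ | (fun i => (X i : ℝ)) ∈ D ∧ ∀ i, X i ≡ c i [MOD q i]}).ncard : ENNReal) := by
    have hset : {X : Fin n → ℕ | (fun i => (X i : ℝ)) ∈ D ∧ ∀ i, X i ≡ c i [MOD q i]} =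
        ((Fintype.piFinset fun i => progression M (q i) (c i)).filter
          fun X : Fin n → ℕ => (fun i => (X i : ℝ)) ∈ D : Finset (Fin n → ℕ)) := by
      ext X
      simp only [Set.mem_ofPred_eq, Finset.coe_filter, Fintype.mem_piFinset, progression,
        Finset.mem_filter, Finset.mem_Icc]
      constructor
      · rintro ⟨h1, h2⟩
        refine ⟨fun i => ⟨⟨?_, ?_⟩, h2 i⟩, h1⟩
        · exact_mod_cast (hDM _ h1 i).1
        · exact_mod_cast (hDM _ h1 i).2
      · rintro ⟨h1, h2⟩
        exact ⟨h2, fun i => (h1 i).2⟩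
    rw [hset, Set.ncard_coe_finset, hμ, pi_sum_dirac, Measure.finsetSum_apply]
    simp_rw [Measure.dirac_apply' _ hD]
    have himg : Fintype.piFinset A = (Fintype.piFinset fun i => progression M (q i) (c i)).image
        (fun (X : Fin n → ℕ) i => (X i : ℝ)) := by
      ext x
      simp only [hA, Fintype.mem_piFinset, Finset.mem_image]
      constructor
      · intro h
        choose f hf1 hf2 using h
        exact ⟨f, hf1, funext hf2⟩
      · rintro ⟨X, hX, rfl⟩ i
        exact ⟨X i, hX i, rfl⟩
    rw [himg, Finset.sum_image (fun X _ Y _ h => by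
      ext i; exact_mod_cast congrFun h i), Finset.card_filter]
    push_cast
    refine Finset.sum_congr rfl fun X _ => ?_
    by_cases h : (fun i => (X i : ℝ)) ∈ D <;> simp [h]
  have hvol : Measure.pi ν D = (∏ i, ENNReal.ofReal (1 / q i)) * volume D := by
    rw [hν, pi_smul_restrict _ (fun _ => ENNReal.ofReal_ne_top) _ hIcc, Measure.smul_apply,
      smul_eq_mul, Measure.restrict_apply hD, Set.inter_eq_left.2]
    exact fun x hx i _ => hDM x hx i
  have hvolfin : volume D ≠ ⊤ := by
    have : D ⊆ Set.univ.pi fun _ => Set.Icc 1 (M : ℝ) := fun x hx i _ => hDM x hx i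
    refine ((measure_mono this).trans_lt ?_).ne
    rw [volume_pi_pi]
    exact ENNReal.prod_lt_top fun i _ => by simp
  have hreal : (∏ i, ENNReal.ofReal (1 / q i)) * volume D =
      ENNReal.ofReal (volume.real D / ∏ i, (q i : ℝ)) := by
    rw [← ENNReal.ofReal_prod_of_nonneg (fun i _ => by positivity), ← ofReal_measureReal hvolfin,
      ← ENNReal.ofReal_mul (Finset.prod_nonneg fun i _ => by positivity)]
    congr 1
    rw [Finset.prod_div_distrib, Finset.prod_const_one, one_div_mul_eq_div]
  rw [hcount, hvol, hreal] at hle1 hle2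
  set E := ∑ k, (G.filter fun m => m k = 1).card
  set N := ({X : Fin n → ℕ | (fun i => (X i : ℝ)) ∈ D ∧ ∀ i, X i ≡ c i [MOD q i]}).ncard
  have hV0 : 0 ≤ volume.real D / ∏ i, (q i : ℝ) := by positivity
  have h1 := ENNReal.toReal_mono (by simp) hle1
  have h2 := ENNReal.toReal_mono (by simp) hle2
  rw [ENNReal.toReal_add (by simp) (by simp), ENNReal.toReal_ofReal hV0] at h1
  rw [ENNReal.toReal_add (by simp) (by simp), ENNReal.toReal_ofReal hV0] at h2
  simp only [ENNReal.toReal_natCast] at h1 h2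
  rw [abs_le]
  constructor <;> linarith

end Count

/-! ### The region of bounded height in the box -/

/-- A set of nonnegative tuples is covered by the unit boxes at their floors. -/
theorem volume_le_card_of_floor_mem {n : ℕ} (D : Set (Fin n → ℝ)) (G : Finset (Fin n → ℕ))
    (hD : ∀ x ∈ D, (∀ i, 0 ≤ x i) ∧ (fun i => ⌊x i⌋₊) ∈ G) : volume D ≤ G.card := by
  have hsub : D ⊆ ⋃ g ∈ G, Set.univ.pi fun j => Set.Ico (g j : ℝ) (g j + 1) := by
    intro x hx
    simp only [Set.mem_iUnion]
    exact ⟨_, (hD x hx).2, fun j _ => ⟨Nat.floor_le ((hD x hx).1 j), Nat.lt_floor_add_one _⟩⟩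
  refine (measure_mono hsub).trans ((measure_biUnion_finset_le _ _).trans ?_)
  refine (Finset.sum_le_card_nsmul _ _ 1 fun g _ => ?_).trans (by simp)
  rw [volume_pi_pi]
  exact Finset.prod_le_one' fun j _ => by rw [Real.volume_Ico]; simp

namespace RegularCompleteFan

variable {d n : ℕ} (F : RegularCompleteFan d n)

/-- The monomial `x^{D₀(σ)}` at a real tuple. -/
noncomputable def realHeight (σ : F.MaxCone) (x : Fin n → ℝ) : ℝ :=
  ∏ ρ, x ρ ^ (F.heightExponent σ ρ).toNat

theorem cast_heightMonomial (σ : F.MaxCone) (X : Fin n → ℕ) :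
    (F.heightMonomial σ X : ℝ) = F.realHeight σ fun ρ => (X ρ : ℝ) := by
  simp [heightMonomial, realHeight]

theorem realHeight_mono (σ : F.MaxCone) {x y : Fin n → ℝ} (hx : ∀ ρ, 0 ≤ x ρ)
    (hxy : ∀ ρ, x ρ ≤ y ρ) : F.realHeight σ x ≤ F.realHeight σ y :=
  Finset.prod_le_prod (fun ρ _ => pow_nonneg (hx ρ) _) fun ρ _ => pow_le_pow_left₀ (hx ρ) (hxy ρ) _

theorem mem_boundedTuples_of_le {B : ℝ} {x : Fin n → ℝ} (hx : ∀ σ, F.realHeight σ x ≤ B)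
    {X : Fin n → ℕ} (hX : ∀ ρ, 0 < X ρ) (hXx : ∀ ρ, (X ρ : ℝ) ≤ x ρ) : X ∈ F.boundedTuples B :=
  ⟨hX, fun σ => by
    rw [cast_heightMonomial]
    exact (F.realHeight_mono σ (fun ρ => Nat.cast_nonneg _) hXx).trans (hx σ)⟩

/-- The real tuples with coordinates at least `1`, of height at most `B`, with `π(x)` in the box. -/
def region (σ₀ : F.MaxCone) (lam : σ₀.1 → ℝ) (B : ℝ) : Set (Fin n → ℝ) :=
  {x | (∀ ρ, 1 ≤ x ρ) ∧ (∀ σ, F.realHeight σ x ≤ B) ∧ F.torsorMap σ₀ x ∈ standardBox σ₀ lam}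

theorem measurable_realHeight (σ : F.MaxCone) : Measurable (F.realHeight σ) := by
  unfold realHeight
  exact Finset.measurable_prod _ fun ρ _ => (measurable_pi_apply ρ).pow_const _

theorem measurable_torsorMap (σ : F.MaxCone) : Measurable (F.torsorMap σ) := by
  refine measurable_pi_lambda _ fun ρ => ?_
  unfold torsorMap
  refine Finset.measurable_prod _ fun ρ' _ => ?_
  obtain ⟨k, hk | hk⟩ := Int.eq_nat_or_neg ((F.coneBasis σ).coord ρ (F.ray ρ'))
  · simp only [hk, zpow_natCast]
    exact (measurable_pi_apply ρ').pow_const k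
  · simp only [hk, zpow_neg, zpow_natCast]
    exact ((measurable_pi_apply ρ').pow_const k).inv

theorem measurableSet_standardBox (σ₀ : F.MaxCone) (lam : σ₀.1 → ℝ) :
    MeasurableSet (standardBox σ₀ lam) :=
  MeasurableSet.univ_pi fun _ => measurableSet_Ioc

theorem measurableSet_region (σ₀ : F.MaxCone) (lam : σ₀.1 → ℝ) (B : ℝ) :
    MeasurableSet (F.region σ₀ lam B) := by
  have h1 : MeasurableSet {x : Fin n → ℝ | ∀ ρ, 1 ≤ x ρ} := by
    simp only [Set.ofPred_forall]
    exact MeasurableSet.iInter fun ρ => measurableSet_le measurable_const (measurable_pi_apply ρ)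
  have h2 : MeasurableSet {x : Fin n → ℝ | ∀ σ, F.realHeight σ x ≤ B} := by
    simp only [Set.ofPred_forall]
    exact MeasurableSet.iInter fun σ => measurableSet_le (F.measurable_realHeight σ) measurable_const
  exact h1.inter (h2.inter (F.measurable_torsorMap σ₀ (F.measurableSet_standardBox σ₀ lam)))

/-- The region has interval fibres: the heights are increasing in every coordinate, and the
coordinates of `π` are monotone, increasing or decreasing, in every coordinate. -/
theorem ordConnected_region_fibre (σ₀ : F.MaxCone) (lam : σ₀.1 → ℝ) (B : ℝ) (x : Fin n → ℝ)
    (i : Fin n) : {t | Function.update x i t ∈ F.region σ₀ lam B}.OrdConnected := by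
  refine ⟨fun s hs t ht u hu => ?_⟩
  obtain ⟨hs1, -, hs3⟩ := hs
  obtain ⟨ht1, ht2, ht3⟩ := ht
  have hpos : ∀ ρ, 1 ≤ Function.update x i u ρ := by
    intro ρ
    by_cases h : ρ = i
    · subst h
      have := hs1 ρ
      simp only [Function.update_self] at this ⊢
      exact this.trans hu.1
    · have := hs1 ρ
      simpa only [Function.update_of_ne h] using this
  have hle : ∀ ρ, Function.update x i u ρ ≤ Function.update x i t ρ := by
    intro ρ
    by_cases h : ρ = i
    · subst h; simpa using hu.2
    · simp [Function.update_of_ne h]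
  have hge : ∀ ρ, Function.update x i s ρ ≤ Function.update x i u ρ := by
    intro ρ
    by_cases h : ρ = i
    · subst h; simpa using hu.1
    · simp [Function.update_of_ne h]
  refine ⟨hpos, fun σ => (F.realHeight_mono σ (fun ρ => by linarith [hpos ρ]) hle).trans (ht2 σ),
    fun ρ _ => ⟨?_, ?_⟩⟩
  · exact Finset.prod_pos fun ρ' _ => zpow_pos (by linarith [hpos ρ']) _
  · rcases le_or_gt 0 ((F.coneBasis σ₀).coord ρ (F.ray i)) with hexp | hexp
    · refine le_trans (Finset.prod_le_prod (fun ρ' _ => zpow_nonneg (by linarith [hpos ρ']) _)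
        fun ρ' _ => ?_) (ht3 ρ trivial).2
      by_cases h : ρ' = i
      · subst h
        exact zpow_le_zpow_left₀ hexp (by linarith [hpos ρ']) (hle ρ')
      · simp only [Function.update_of_ne h]; exact le_rfl
    · refine le_trans (Finset.prod_le_prod (fun ρ' _ => zpow_nonneg (by linarith [hpos ρ']) _)
        fun ρ' _ => ?_) (hs3 ρ trivial).2
      by_cases h : ρ' = i
      · subst h
        rw [← neg_neg ((F.coneBasis σ₀).coord ρ (F.ray ρ')), zpow_neg, zpow_neg _ (- _)]
        refine inv_anti₀ (zpow_pos (by linarith [hs1 ρ']) _) ?_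
        exact zpow_le_zpow_left₀ (by omega) (by linarith [hs1 ρ']) (hge ρ')
      · simp only [Function.update_of_ne h]; exact le_rfl

theorem floor_mem_boundedTuples {B : ℝ} {x : Fin n → ℝ} (hx1 : ∀ ρ, 1 ≤ x ρ)
    (hx : ∀ σ, F.realHeight σ x ≤ B) : (fun ρ => ⌊x ρ⌋₊) ∈ F.boundedTuples B :=
  F.mem_boundedTuples_of_le hx (fun ρ => Nat.floor_pos.2 (hx1 ρ))
    fun ρ => Nat.floor_le (by linarith [hx1 ρ])

/-- The number of tuples of height at most `B` with a coordinate equal to `1`, counted once for every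
such coordinate. It controls all boundary terms. -/
noncomputable def sliceCount (B : ℝ) : ℕ := ∑ k, ({X ∈ F.boundedTuples B | X k = 1}).ncard

/-- Counting the points of the region in a product of residue classes, with an error term that does
not depend on the moduli. -/
theorem abs_card_region_sub_le (hgen : F.GloballyGenerated F.anticanonical) (σ₀ : F.MaxCone)
    (lam : σ₀.1 → ℝ) (B : ℝ) (q c : Fin n → ℕ) (hq : ∀ i, 0 < q i) :
    |(({X : Fin n → ℕ | (fun i => (X i : ℝ)) ∈ F.region σ₀ lam B ∧
        ∀ i, X i ≡ c i [MOD q i]}).ncard : ℝ) -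
        volume.real (F.region σ₀ lam B) / ∏ i, (q i : ℝ)| ≤ F.sliceCount B := by
  classical
  have hfin := F.finite_boundedTuples hgen B
  have h := abs_card_sub_volume_le (F.region σ₀ lam B) (F.measurableSet_region σ₀ lam B)
    (2 ^ (Nat.log 2 ⌊B⌋₊ + 1)) (fun x hx i => ⟨hx.1 i, ?_⟩) hfin.toFinset
    (F.ordConnected_region_fibre σ₀ lam B) (fun x hx k => ?_) q c hq
  · refine h.trans (le_of_eq ?_)
    norm_cast
    refine Finset.sum_congr rfl fun k _ => ?_
    rw [← Set.ncard_coe_finset]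
    congr 1
    ext X
    simp
  · have h1 := F.boundedTuples_lt hgen (F.floor_mem_boundedTuples hx.1 hx.2.1) i
    have h2 := (Nat.lt_floor_add_one (x i)).le
    refine h2.trans ?_
    exact_mod_cast h1
  · rw [Set.Finite.mem_toFinset]
    refine F.mem_boundedTuples_of_le hx.2.1 (fun ρ => ?_) fun ρ => ?_
    · by_cases h : ρ = k
      · subst h; simp
      · simp only [Function.update_of_ne h]
        exact Nat.floor_pos.2 (hx.1 ρ)
    · by_cases h : ρ = k
      · subst h; simpa using hx.1 ρ
      · simp only [Function.update_of_ne h]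
        exact Nat.floor_le (by linarith [hx.1 ρ])

theorem volume_region_le (hgen : F.GloballyGenerated F.anticanonical) (σ₀ : F.MaxCone)
    (lam : σ₀.1 → ℝ) (B : ℝ) :
    volume.real (F.region σ₀ lam B) ≤ (F.boundedTuples B).ncard := by
  have hfin := F.finite_boundedTuples hgen B
  have h := volume_le_card_of_floor_mem (F.region σ₀ lam B) hfin.toFinset fun x hx =>
    ⟨fun i => by linarith [hx.1 i], by
      rw [Set.Finite.mem_toFinset]; exact F.floor_mem_boundedTuples hx.1 hx.2.1⟩
  rw [Set.ncard_eq_toFinset_card _ hfin]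
  exact ENNReal.toReal_le_of_le_ofReal (by positivity) (by simpa using h)

theorem sliceCount_le (hgen : F.GloballyGenerated F.anticanonical) (σ₀ : F.MaxCone)
    {c : ℝ} (hc : 1 ≤ c) :
    ∃ C : ℝ, 0 ≤ C ∧ ∀ B : ℝ, 3 ≤ B →
      (F.sliceCount (c * B) : ℝ) ≤ C * (B * Real.log B ^ ((n : ℝ) - d - 2)) := by
  choose C hC0 hC using fun i => F.ncard_slice_le hgen σ₀ hc i
  refine ⟨∑ i, C i, Finset.sum_nonneg fun i _ => hC0 i, fun B hB => ?_⟩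
  rw [sliceCount, Finset.sum_mul]
  push_cast
  exact Finset.sum_le_sum fun i _ => hC i B hB

/-- At most one in `∏ δ_ρ` of the tuples of bounded height is divisible by `δ`: lowering the
coordinates `X ρ` by all `j ρ < δ ρ` maps the pairs `(X, j)` injectively to tuples of bounded
height. -/
theorem ncard_dvd_mul_le (hgen : F.GloballyGenerated F.anticanonical) (B : ℝ) (δ : Fin n → ℕ) :
    ({X ∈ F.boundedTuples B | ∀ ρ, δ ρ ∣ X ρ}).ncard * ∏ ρ, δ ρ ≤ (F.boundedTuples B).ncard := by
  classical
  have hfin := F.finite_boundedTuples hgen B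
  have hfin' : ({X ∈ F.boundedTuples B | ∀ ρ, δ ρ ∣ X ρ}).Finite := hfin.subset fun X hX => hX.1
  rw [Set.ncard_eq_toFinset_card _ hfin, Set.ncard_eq_toFinset_card _ hfin']
  have hprod : ∏ ρ, δ ρ = (Fintype.piFinset fun ρ => Finset.range (δ ρ)).card := by simp
  rw [hprod, ← Finset.card_product]
  refine Finset.card_le_card_of_injOn (fun p ρ => p.1 ρ - p.2 ρ) ?_ ?_
  · rintro ⟨X, j⟩ hp
    simp only [Finset.coe_product, Set.mem_prod, Finset.mem_coe, Set.Finite.mem_toFinset,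
      Set.mem_ofPred_eq, Fintype.mem_piFinset, Finset.mem_range] at hp
    obtain ⟨⟨hX, hdvd⟩, hj⟩ := hp
    simp only [Finset.mem_coe, Set.Finite.mem_toFinset]
    refine F.mem_boundedTuples_of_le (x := fun ρ => (X ρ : ℝ))
      (fun σ => by rw [← cast_heightMonomial]; exact hX.2 σ) (fun ρ => ?_) fun ρ => ?_
    · have := Nat.le_of_dvd (hX.1 ρ) (hdvd ρ)
      have := hj ρ
      omega
    · exact_mod_cast Nat.sub_le _ _
  · rintro ⟨X, j⟩ hp ⟨Y, j'⟩ hp' h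
    simp only [Finset.coe_product, Set.mem_prod, Finset.mem_coe, Set.Finite.mem_toFinset,
      Set.mem_ofPred_eq, Fintype.mem_piFinset, Finset.mem_range] at hp hp'
    have key : ∀ ρ, X ρ = Y ρ ∧ j ρ = j' ρ := by
      intro ρ
      have h1 := congrFun h ρ
      simp only at h1
      have hj := hp.2 ρ
      have hj' := hp'.2 ρ
      have hXp := hp.1.1.1 ρ
      have hYp := hp'.1.1.1 ρ
      obtain ⟨a, ha⟩ := hp.1.2 ρ
      obtain ⟨b, hb⟩ := hp'.1.2 ρ
      have ha0 : 0 < a := Nat.pos_of_ne_zero fun h => by rw [h] at ha; omega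
      have hb0 : 0 < b := Nat.pos_of_ne_zero fun h => by rw [h] at hb; omega
      have hXδ : δ ρ ≤ X ρ := by rw [ha]; exact Nat.le_mul_of_pos_right _ ha0
      have hYδ : δ ρ ≤ Y ρ := by rw [hb]; exact Nat.le_mul_of_pos_right _ hb0
      have h2 : X ρ + j' ρ = Y ρ + j ρ := by omega
      have hab : a = b := by
        rcases lt_trichotomy a b with hlt | heq | hgt
        · have : δ ρ * (a + 1) ≤ δ ρ * b := Nat.mul_le_mul_left _ hlt
          rw [mul_add] at this
          omega
        · exact heq
        · have : δ ρ * (b + 1) ≤ δ ρ * a := Nat.mul_le_mul_left _ hgt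
          rw [mul_add] at this
          omega
      subst hab
      omega
    exact Prod.ext (funext fun ρ => (key ρ).1) (funext fun ρ => (key ρ).2)

end RegularCompleteFan

/-! ### Sums over squarefree numbers -/

/-- The function `K ^ ω(s)`, on squarefree numbers `s`, grows more slowly than any power of `s`. -/
theorem exists_pow_card_le_prod_rpow {K : ℝ} (hK : 1 ≤ K) {ε : ℝ} (hε : 0 < ε) :
    ∃ C : ℝ, 0 < C ∧ ∀ P : Finset ℕ, (∀ p ∈ P, p.Prime) →
      K ^ P.card ≤ C * ((∏ p ∈ P, p : ℕ) : ℝ) ^ ε := by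
  set N := ⌈K ^ (1 / ε)⌉₊ with hN
  refine ⟨K ^ N, by positivity, fun P hP => ?_⟩
  have hlarge : ∀ p : ℕ, N ≤ p → K ≤ (p : ℝ) ^ ε := by
    intro p hp
    have h1 : K ^ (1 / ε) ≤ p := (Nat.le_ceil _).trans (by exact_mod_cast hp)
    calc K = (K ^ (1 / ε)) ^ ε := by
          rw [← Real.rpow_mul (by linarith), one_div, inv_mul_cancel₀ hε.ne', Real.rpow_one]
      _ ≤ (p : ℝ) ^ ε := Real.rpow_le_rpow (by positivity) h1 hε.le
  have hterm : ∀ p ∈ P, K ≤ (if p < N then K else 1) * (p : ℝ) ^ ε := by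
    intro p hp
    split_ifs with h
    · have : 1 ≤ (p : ℝ) ^ ε := Real.one_le_rpow (by exact_mod_cast (hP p hp).one_le) hε.le
      nlinarith
    · rw [one_mul]; exact hlarge p (not_lt.1 h)
  calc K ^ P.card = ∏ _p ∈ P, K := by simp
    _ ≤ ∏ p ∈ P, (if p < N then K else 1) * (p : ℝ) ^ ε :=
        Finset.prod_le_prod (fun _ _ => by linarith) hterm
    _ = (∏ p ∈ P, if p < N then K else 1) * ((∏ p ∈ P, p : ℕ) : ℝ) ^ ε := by
        rw [Finset.prod_mul_distrib]
        push_cast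
        rw [← Real.finsetProd_rpow _ _ fun p _ => Nat.cast_nonneg p]
    _ ≤ K ^ N * ((∏ p ∈ P, p : ℕ) : ℝ) ^ ε := by
        gcongr
        rw [← Finset.prod_filter, Finset.prod_const]
        refine pow_le_pow_right₀ hK ?_
        have : P.filter (· < N) ⊆ Finset.range N := fun p hp =>
          Finset.mem_range.2 (Finset.mem_filter.1 hp).2
        simpa using Finset.card_le_card this

theorem prod_injOn_primes {T : Finset (Finset ℕ)} (hT : ∀ P ∈ T, ∀ p ∈ P, p.Prime) :
    Set.InjOn (fun P : Finset ℕ => ∏ p ∈ P, p) (T : Set (Finset ℕ)) := by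
  intro P hP Q hQ h
  simp only at h
  rw [← Nat.primeFactors_prod (hT P hP), ← Nat.primeFactors_prod (hT Q hQ), h]

/-- Sets of primes of product at most `z`. -/
theorem sum_pow_card_le {K : ℝ} (hK : 1 ≤ K) {ε : ℝ} (hε : 0 < ε) :
    ∃ C : ℝ, 0 < C ∧ ∀ Q : Finset ℕ, (∀ p ∈ Q, p.Prime) → ∀ z : ℝ, 1 ≤ z →
      ∑ P ∈ Q.powerset with ((∏ p ∈ P, p : ℕ) : ℝ) ≤ z, K ^ P.card ≤ C * z ^ (1 + ε) := by
  obtain ⟨C, hC0, hC⟩ := exists_pow_card_le_prod_rpow hK hε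
  refine ⟨C, hC0, fun Q hQ z hz => ?_⟩
  set T := Q.powerset.filter fun P => ((∏ p ∈ P, p : ℕ) : ℝ) ≤ z with hT
  have hTP : ∀ P ∈ T, ∀ p ∈ P, p.Prime := fun P hP p hp =>
    hQ p (Finset.mem_powerset.1 (Finset.mem_filter.1 hP).1 hp)
  have hcard : T.card ≤ ⌊z⌋₊ := by
    have := Finset.card_le_card_of_injOn (t := Finset.Icc 1 ⌊z⌋₊) _ (fun P hP => ?_)
      (prod_injOn_primes hTP)
    · simpa using this
    · rw [Finset.mem_coe, Finset.mem_Icc]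
      exact ⟨Finset.prod_pos fun p hp => (hTP P hP p hp).pos,
        Nat.le_floor (Finset.mem_filter.1 hP).2⟩
  have hterm : ∀ P ∈ T, K ^ P.card ≤ C * z ^ ε := fun P hP =>
    (hC P (hTP P hP)).trans (mul_le_mul_of_nonneg_left
      (Real.rpow_le_rpow (Nat.cast_nonneg _) (Finset.mem_filter.1 hP).2 hε.le) hC0.le)
  refine (Finset.sum_le_card_nsmul _ _ _ hterm).trans ?_
  rw [nsmul_eq_mul, Real.rpow_add (by linarith), Real.rpow_one]
  have h1 : (T.card : ℝ) ≤ z := (Nat.cast_le.2 hcard).trans (Nat.floor_le (by linarith))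
  calc (T.card : ℝ) * (C * z ^ ε) ≤ z * (C * z ^ ε) := by gcongr
    _ = _ := by ring

/-- Sets of primes of product larger than `z`. -/
theorem sum_pow_card_mul_rpow_le {K : ℝ} (hK : 1 ≤ K) {ε : ℝ} (hε : 0 < ε) {α : ℝ}
    (hα : 1 + 2 * ε ≤ α) :
    ∃ C : ℝ, 0 < C ∧ ∀ Q : Finset ℕ, (∀ p ∈ Q, p.Prime) → ∀ z : ℝ, 1 ≤ z →
      ∑ P ∈ Q.powerset with ¬ ((∏ p ∈ P, p : ℕ) : ℝ) ≤ z,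
        K ^ P.card * ((∏ p ∈ P, p : ℕ) : ℝ) ^ (-α) ≤ C * z ^ (1 - α + 2 * ε) := by
  obtain ⟨C, hC0, hC⟩ := exists_pow_card_le_prod_rpow hK hε
  have hsum : Summable fun m : ℕ => (m : ℝ) ^ (-1 - ε) :=
    Real.summable_nat_rpow.2 (by linarith)
  have hS0 : 0 ≤ ∑' m : ℕ, (m : ℝ) ^ (-1 - ε) := tsum_nonneg fun m => by positivity
  refine ⟨C * (∑' m : ℕ, (m : ℝ) ^ (-1 - ε) + 1), by positivity, fun Q hQ z hz => ?_⟩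
  set T := Q.powerset.filter fun P => ¬ ((∏ p ∈ P, p : ℕ) : ℝ) ≤ z with hT
  have hTP : ∀ P ∈ T, ∀ p ∈ P, p.Prime := fun P hP p hp =>
    hQ p (Finset.mem_powerset.1 (Finset.mem_filter.1 hP).1 hp)
  have hterm : ∀ P ∈ T, K ^ P.card * ((∏ p ∈ P, p : ℕ) : ℝ) ^ (-α) ≤
      C * z ^ (1 - α + 2 * ε) * ((∏ p ∈ P, p : ℕ) : ℝ) ^ (-1 - ε) := by
    intro P hP
    have h1 := hC P (hTP P hP)
    have h2 := not_le.1 (Finset.mem_filter.1 hP).2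
    set s : ℝ := ((∏ p ∈ P, p : ℕ) : ℝ) with hs
    have hs0 : 0 < s := by linarith
    have h3 : s ^ (1 - α + 2 * ε) ≤ z ^ (1 - α + 2 * ε) :=
      Real.rpow_le_rpow_of_nonpos (by linarith) h2.le (by linarith)
    calc K ^ P.card * s ^ (-α) ≤ C * s ^ ε * s ^ (-α) := by gcongr
      _ = C * s ^ (1 - α + 2 * ε) * s ^ (-1 - ε) := by
          rw [mul_assoc, mul_assoc, ← Real.rpow_add hs0, ← Real.rpow_add hs0]
          congr 2; ring
      _ ≤ _ := by gcongr
  refine (Finset.sum_le_sum hterm).trans ?_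
  rw [← Finset.mul_sum]
  have h4 : ∑ P ∈ T, ((∏ p ∈ P, p : ℕ) : ℝ) ^ (-1 - ε) ≤ ∑' m : ℕ, (m : ℝ) ^ (-1 - ε) := by
    rw [← Finset.sum_image (f := fun m : ℕ => (m : ℝ) ^ (-1 - ε)) (prod_injOn_primes hTP)]
    exact hsum.sum_le_tsum _ fun m _ => by positivity
  have h5 : 0 ≤ C * z ^ (1 - α + 2 * ε) := by positivity
  nlinarith

namespace RegularCompleteFan

variable {d n : ℕ} (F : RegularCompleteFan d n)

/-! ### Local conditions -/

open Classical in
/-- Möbius inversion on the subsets of the set of rays, for the indicator function of the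
nonfaces. -/
theorem exists_nonface_coeff : ∃ c : Finset (Fin n) → ℝ,
    ∀ T, ∑ S ∈ T.powerset, c S = if F.Nonface T then 1 else 0 := by
  let c : Finset (Fin n) → ℝ := Finset.strongInduction (p := fun _ => ℝ) fun T ih =>
    (if F.Nonface T then 1 else 0) - ∑ S ∈ T.ssubsets.attach, ih S.1 (Finset.mem_ssubsets.1 S.2)
  have hc : ∀ T, c T = (if F.Nonface T then 1 else 0) - ∑ S ∈ T.ssubsets, c S := by
    intro T
    refine (Finset.strongInduction_eq _ T).trans ?_
    exact congrArg _ (Finset.sum_attach T.ssubsets c)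
  refine ⟨c, fun T => ?_⟩
  have h1 : T.powerset = insert T T.ssubsets := by
    ext S
    simp only [Finset.mem_powerset, Finset.mem_insert, Finset.mem_ssubsets]
    exact le_iff_eq_or_lt
  rw [h1, Finset.sum_insert (by simp), hc T]
  ring

/-- The rays whose coordinate is divisible by `p`. -/
def divRays (p : ℕ) (X : Fin n → ℕ) : Finset (Fin n) := Finset.univ.filter fun ρ => p ∣ X ρ

theorem mem_divRays {p : ℕ} {X : Fin n → ℕ} {ρ : Fin n} : ρ ∈ divRays p X ↔ p ∣ X ρ := by
  simp [divRays]

/-- A tuple is primitive if it is good at all primes: the rays whose coordinate is divisible by the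
prime lie in a common cone. -/
theorem gcd_coneMonomial_eq_one_iff (X : Fin n → ℕ) :
    (Finset.univ.gcd fun σ : F.MaxCone => coneMonomial σ.1 X) = 1 ↔
      ∀ p : ℕ, p.Prime → ¬ F.Nonface (divRays p X) := by
  have key : ∀ p : ℕ, p.Prime → (p ∣ (Finset.univ.gcd fun σ : F.MaxCone => coneMonomial σ.1 X) ↔
      F.Nonface (divRays p X)) := by
    intro p hp
    rw [Finset.dvd_gcd_iff]
    simp only [Finset.mem_univ, true_implies, Nonface, coneMonomial]
    refine forall_congr' fun σ => ?_
    rw [hp.prime.dvd_finsetProd_iff, Finset.not_subset]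
    simp only [Finset.mem_compl, mem_divRays]
    exact exists_congr fun ρ => and_comm
  rw [Nat.eq_one_iff_not_exists_prime_dvd]
  exact forall₂_congr fun p hp => not_congr (key p hp)

/-- Over a field, the points of the torsor are the tuples whose vanishing coordinates belong to a
common cone. -/
theorem mem_torsorPoints_field {R : Type*} [Field R] [DecidableEq R] (x : Fin n → R) :
    x ∈ F.torsorPoints R ↔ ¬ F.Nonface (Finset.univ.filter fun ρ => x ρ = 0) := by
  have h1 : x ∈ F.torsorPoints R ↔ ∃ σ : F.MaxCone, coneMonomial σ.1 x ≠ 0 := by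
    simp only [torsorPoints, Set.mem_ofPred_eq]
    constructor
    · intro h
      by_contra hcon
      push Not at hcon
      have : Ideal.span (Set.range fun σ : F.MaxCone => coneMonomial σ.1 x) = ⊥ := by
        rw [Ideal.span_eq_bot]
        rintro _ ⟨σ, rfl⟩
        exact hcon σ
      rw [this] at h
      exact bot_ne_top h
    · rintro ⟨σ, hσ⟩
      exact Ideal.eq_top_of_isUnit_mem _ (Ideal.subset_span ⟨σ, rfl⟩) (isUnit_iff_ne_zero.2 hσ)
  rw [h1, Nonface, not_forall]
  refine exists_congr fun σ => ?_
  rw [not_not, coneMonomial, Finset.prod_ne_zero_iff]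
  simp only [Finset.mem_compl, Finset.subset_iff, Finset.mem_filter, Finset.mem_univ, true_and]
  exact forall_congr' fun ρ => ⟨fun h h0 => by by_contra hn; exact h hn h0,
    fun h hn h0 => hn (h h0)⟩

/-- The points of the torsor over `ℤ/l` are good at the primes dividing `l`. -/
theorem not_nonface_of_congr {l : ℕ} {ξ : Fin n → ZMod l} (hξ : ξ ∈ F.torsorPoints (ZMod l))
    {X : Fin n → ℕ} (hX : ∀ ρ, (X ρ : ZMod l) = ξ ρ) {p : ℕ} (hp : p.Prime) (hpl : p ∣ l) :
    ¬ F.Nonface (divRays p X) := by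
  have : Fact p.Prime := ⟨hp⟩
  have h1 : (fun ρ => (X ρ : ZMod p)) ∈ F.torsorPoints (ZMod p) := by
    simp only [torsorPoints, Set.mem_ofPred_eq] at hξ ⊢
    have h2 := congrArg (Ideal.map (ZMod.castHom hpl (ZMod p))) hξ
    rw [Ideal.map_span, Ideal.map_top, ← Set.range_comp] at h2
    rw [← h2]
    congr 2
    ext σ
    simp only [Function.comp_apply, coneMonomial, map_prod, ← hX, map_natCast]
  rw [mem_torsorPoints_field] at h1
  convert h1 using 2
  ext ρ
  simp [mem_divRays, ZMod.natCast_eq_zero_iff]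

/-- The proportion of the tuples modulo `p` that vanish at the rays of `S`. -/
theorem card_vanishing (p : ℕ) [Fact p.Prime] (S : Finset (Fin n)) :
    ((Finset.univ.filter fun x : Fin n → ZMod p => ∀ ρ ∈ S, x ρ = 0).card : ℝ) / (p : ℝ) ^ n =
      ((p : ℝ)⁻¹) ^ S.card := by
  classical
  have hp0 : (p : ℝ) ≠ 0 := by exact_mod_cast (Fact.out : p.Prime).ne_zero
  have h1 : (Finset.univ.filter fun x : Fin n → ZMod p => ∀ ρ ∈ S, x ρ = 0) =
      Fintype.piFinset fun ρ => if ρ ∈ S then {0} else Finset.univ := by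
    ext x
    simp only [Finset.mem_filter, Finset.mem_univ, true_and, Fintype.mem_piFinset]
    refine forall_congr' fun ρ => ?_
    by_cases h : ρ ∈ S <;> simp [h]
  have h2 : (Fintype.piFinset fun ρ : Fin n =>
      if ρ ∈ S then ({0} : Finset (ZMod p)) else Finset.univ).card = p ^ Sᶜ.card := by
    rw [Fintype.card_piFinset]
    have : ∀ ρ : Fin n, (if ρ ∈ S then ({0} : Finset (ZMod p)) else Finset.univ).card =
        if ρ ∈ S then 1 else p := fun ρ => by split_ifs <;> simp [ZMod.card]
    simp only [this]
    rw [Finset.prod_ite]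
    simp [Finset.filter_not, Finset.compl_eq_univ_sdiff]
  rw [h1, h2]
  have h3 : Sᶜ.card + S.card = n := by
    rw [Finset.card_compl_add_card, Fintype.card_fin]
  have h4 : (p : ℝ) ^ n = (p : ℝ) ^ Sᶜ.card * (p : ℝ) ^ S.card := by rw [← pow_add, h3]
  rw [h4, inv_pow]
  push_cast
  field_simp

open Classical in
theorem one_sub_localDensity (p : ℕ) [Fact p.Prime] :
    1 - F.localDensity p = ((Finset.univ.filter fun x : Fin n → ZMod p =>
      F.Nonface (Finset.univ.filter fun ρ => x ρ = 0)).card : ℝ) / (p : ℝ) ^ n := by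
  have hp0 : (p : ℝ) ≠ 0 := by exact_mod_cast (Fact.out : p.Prime).ne_zero
  have h1 : F.torsorPoints (ZMod p) = ((Finset.univ.filter fun x : Fin n → ZMod p =>
      ¬ F.Nonface (Finset.univ.filter fun ρ => x ρ = 0) : Finset (Fin n → ZMod p)) :
        Set (Fin n → ZMod p)) := by
    ext x
    rw [mem_torsorPoints_field]
    simp
  rw [localDensity, h1, Set.ncard_coe_finset]
  have h2 := Finset.card_filter_add_card_filter_not (s := (Finset.univ : Finset (Fin n → ZMod p)))
    (fun x : Fin n → ZMod p => F.Nonface (Finset.univ.filter fun ρ => x ρ = 0))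
  have h3 : (Finset.univ : Finset (Fin n → ZMod p)).card = p ^ n := by
    simp [ZMod.card]
  rw [h3] at h2
  have h4 : (p : ℝ) ^ n = ((p ^ n : ℕ) : ℝ) := by push_cast; rfl
  rw [eq_div_iff (pow_ne_zero _ hp0), sub_mul, div_mul_cancel₀ _ (pow_ne_zero _ hp0), one_mul, h4,
    ← h2]
  push_cast
  ring

open Classical in
/-- The proportion of bad tuples modulo `p`, in terms of divisibility conditions. -/
theorem one_sub_localDensity_eq_sum {c : Finset (Fin n) → ℝ}
    (hc : ∀ T, ∑ S ∈ T.powerset, c S = if F.Nonface T then 1 else 0) (p : ℕ) [Fact p.Prime] :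
    1 - F.localDensity p = ∑ S, c S * ((p : ℝ)⁻¹) ^ S.card := by
  rw [one_sub_localDensity]
  simp only [← card_vanishing p]
  rw [Finset.card_filter]
  push_cast
  simp only [← hc]
  have h1 : ∀ x : Fin n → ZMod p, ∑ S ∈ (Finset.univ.filter fun ρ => x ρ = 0).powerset, c S =
      ∑ S, c S * if (∀ ρ ∈ S, x ρ = 0) then 1 else 0 := by
    intro x
    simp only [mul_ite, mul_one, mul_zero]
    rw [← Finset.sum_filter]
    refine Finset.sum_congr ?_ fun _ _ => rfl
    ext S
    simp [Finset.subset_iff]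
  simp only [h1]
  rw [Finset.sum_comm, Finset.sum_div]
  refine Finset.sum_congr rfl fun S _ => ?_
  rw [← Finset.mul_sum, mul_div_assoc, Finset.card_filter]
  push_cast
  rfl

theorem one_sub_localDensity_nonneg (p : ℕ) [Fact p.Prime] : 0 ≤ 1 - F.localDensity p := by
  rw [one_sub_localDensity]; positivity

/-- A nonface has at least `α₀` elements, whence `1 - κ_p ≪ p ^ (-α₀)`. -/
theorem one_sub_localDensity_le (p : ℕ) [Fact p.Prime] :
    1 - F.localDensity p ≤ 2 ^ n * (p : ℝ) ^ (-(F.alphaZero : ℝ)) := by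
  classical
  have hp : p.Prime := Fact.out
  have hp1 : (1 : ℝ) ≤ p := by exact_mod_cast hp.one_le
  rw [one_sub_localDensity]
  have hsub : (Finset.univ.filter fun x : Fin n → ZMod p =>
      F.Nonface (Finset.univ.filter fun ρ => x ρ = 0)) ⊆
      (Finset.univ.filter fun S => F.Nonface S).biUnion fun S =>
        Finset.univ.filter fun x : Fin n → ZMod p => ∀ ρ ∈ S, x ρ = 0 := by
    intro x hx
    rw [Finset.mem_biUnion]
    exact ⟨_, Finset.mem_filter.2 ⟨Finset.mem_univ _, (Finset.mem_filter.1 hx).2⟩,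
      Finset.mem_filter.2 ⟨Finset.mem_univ _, fun ρ hρ => (Finset.mem_filter.1 hρ).2⟩⟩
  have h1 := (Finset.card_le_card hsub).trans Finset.card_biUnion_le
  calc _ ≤ ((∑ S ∈ Finset.univ.filter fun S => F.Nonface S,
        (Finset.univ.filter fun x : Fin n → ZMod p => ∀ ρ ∈ S, x ρ = 0).card : ℕ) : ℝ) /
          (p : ℝ) ^ n := by gcongr
    _ = ∑ S ∈ Finset.univ.filter fun S => F.Nonface S, ((p : ℝ)⁻¹) ^ S.card := by
        push_cast
        rw [Finset.sum_div]
        exact Finset.sum_congr rfl fun S _ => card_vanishing p S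
    _ ≤ ∑ S ∈ Finset.univ.filter fun S => F.Nonface S, (p : ℝ) ^ (-(F.alphaZero : ℝ)) := by
        refine Finset.sum_le_sum fun S hS => ?_
        rw [Real.rpow_neg (by linarith), Real.rpow_natCast, inv_pow]
        refine inv_anti₀ (by positivity) (pow_le_pow_right₀ hp1 ?_)
        exact (Finset.mem_filter.1 hS).2.alphaZero_le
    _ ≤ _ := by
        rw [Finset.sum_const, nsmul_eq_mul]
        gcongr
        have := Finset.card_filter_le (Finset.univ : Finset (Finset (Fin n))) fun S => F.Nonface S
        simp only [Finset.card_univ, Fintype.card_finset, Fintype.card_fin] at this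
        exact_mod_cast this

/-- The Euler products defining the constants `κ_(l)` converge, as `κ_p = 1 + O(p ^ (-2))`. -/
theorem multipliable_localDensity (h2 : 2 ≤ F.alphaZero) (l : ℕ) :
    Multipliable fun p : {p : ℕ // p.Prime ∧ ¬ p ∣ l} => F.localDensity p := by
  have hsum : Summable fun p : {p : ℕ // p.Prime ∧ ¬ p ∣ l} => F.localDensity p - 1 := by
    have h1 : Summable fun m : ℕ => (2 : ℝ) ^ n * (m : ℝ) ^ (-(F.alphaZero : ℝ)) := by
      refine (Real.summable_nat_rpow.2 ?_).mul_left _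
      have : (2 : ℝ) ≤ F.alphaZero := by exact_mod_cast h2
      linarith
    refine Summable.of_norm_bounded (h1.comp_injective
      (Subtype.val_injective (p := fun p : ℕ => p.Prime ∧ ¬ p ∣ l))) fun p => ?_
    have : Fact (p : ℕ).Prime := ⟨p.2.1⟩
    rw [Real.norm_eq_abs, abs_sub_comm, abs_of_nonneg (F.one_sub_localDensity_nonneg p)]
    exact F.one_sub_localDensity_le p
  have := Real.multipliable_one_add_of_summable hsum
  simpa using this

/-! ### The sieve -/

/-- The integral points of the region in a residue class modulo `l`. -/
def regionTuples (σ₀ : F.MaxCone) (lam : σ₀.1 → ℝ) (B : ℝ) {l : ℕ} (ξ : Fin n → ZMod l) :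
    Set (Fin n → ℕ) :=
  {X | (fun ρ => (X ρ : ℝ)) ∈ F.region σ₀ lam B ∧ ∀ ρ, (X ρ : ZMod l) = ξ ρ}

theorem regionTuples_subset (σ₀ : F.MaxCone) (lam : σ₀.1 → ℝ) (B : ℝ) {l : ℕ}
    (ξ : Fin n → ZMod l) : F.regionTuples σ₀ lam B ξ ⊆ F.boundedTuples B := fun X hX =>
  ⟨fun ρ => Nat.one_le_cast.1 (hX.1.1 ρ), fun σ => by
    rw [cast_heightMonomial]; exact hX.1.2.1 σ⟩

section Pattern

variable {P : Finset ℕ} (φ : P → Finset (Fin n))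

/-- For a choice `φ` of a set of rays for every prime of `P`, the product of the primes whose set
contains `ρ`. Thus `X ρ` is divisible by `patternModulus φ ρ` for all `ρ` if and only if `p` divides
`X ρ` for all `p ∈ P` and `ρ ∈ φ p`. -/
def patternModulus (ρ : Fin n) : ℕ := ∏ p : P, if ρ ∈ φ p then (p : ℕ) else 1

theorem patternModulus_dvd_iff (hP : ∀ p ∈ P, p.Prime) (ρ : Fin n) (m : ℕ) :
    patternModulus φ ρ ∣ m ↔ ∀ p : P, ρ ∈ φ p → (p : ℕ) ∣ m := by
  constructor
  · intro h p hp
    refine dvd_trans ?_ h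
    have := Finset.dvd_prod_of_mem (fun p : P => if ρ ∈ φ p then (p : ℕ) else 1)
      (Finset.mem_univ p)
    rwa [if_pos hp] at this
  · intro h
    refine Finset.prod_dvd_of_isRelPrime ?_ fun p _ => ?_
    · intro p _ q _ hpq
      have hne : (p : ℕ) ≠ q := fun h => hpq (Subtype.ext h)
      have hco := (Nat.coprime_primes (hP p p.2) (hP q q.2)).2 hne
      simp only [Function.onFun]
      rw [← Nat.coprime_iff_isRelPrime]
      split_ifs
      exacts [hco, Nat.coprime_one_right _, Nat.coprime_one_left _, Nat.coprime_one_left _]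
    · split_ifs with hp
      · exact h p hp
      · exact one_dvd _

theorem patternModulus_pos (hP : ∀ p ∈ P, p.Prime) (ρ : Fin n) : 0 < patternModulus φ ρ :=
  Finset.prod_pos fun p _ => by
    split_ifs
    · exact (hP p p.2).pos
    · exact one_pos

theorem prod_patternModulus : ∏ ρ, patternModulus φ ρ = ∏ p : P, (p : ℕ) ^ (φ p).card := by
  unfold patternModulus
  rw [Finset.prod_comm]
  refine Finset.prod_congr rfl fun p _ => ?_
  rw [Finset.prod_ite_mem, Finset.univ_inter, Finset.prod_const]

theorem coprime_patternModulus (hP : ∀ p ∈ P, p.Prime) {l : ℕ} (hPl : ∀ p ∈ P, ¬ p ∣ l)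
    (ρ : Fin n) : l.Coprime (patternModulus φ ρ) :=
  Nat.Coprime.prod_right fun p _ => by
    split_ifs
    · exact ((Nat.Prime.coprime_iff_not_dvd (hP p p.2)).2 (hPl p p.2)).symm
    · exact Nat.coprime_one_right l

theorem prod_inv_pow_eq :
    ∏ p : P, ((p : ℝ)⁻¹) ^ (φ p).card = (∏ ρ, (patternModulus φ ρ : ℝ))⁻¹ := by
  have h : (∏ ρ, (patternModulus φ ρ : ℝ)) = ∏ p : P, (p : ℝ) ^ (φ p).card := by
    exact_mod_cast prod_patternModulus φ
  rw [h, ← Finset.prod_inv_distrib]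
  exact Finset.prod_congr rfl fun p _ => inv_pow _ _

/-- Divisibility conditions at primes not dividing `l` are combined with the congruence modulo `l`
by the Chinese remainder theorem. -/
theorem abs_card_pattern_sub_le (hgen : F.GloballyGenerated F.anticanonical) (σ₀ : F.MaxCone)
    (lam : σ₀.1 → ℝ) (B : ℝ) {l : ℕ} (hl : 1 ≤ l) (ξ : Fin n → ZMod l)
    (hP : ∀ p ∈ P, p.Prime) (hPl : ∀ p ∈ P, ¬ p ∣ l) :
    |(({X ∈ F.regionTuples σ₀ lam B ξ | ∀ p : P, ∀ ρ ∈ φ p, (p : ℕ) ∣ X ρ}).ncard : ℝ) -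
        volume.real (F.region σ₀ lam B) / (l : ℝ) ^ n * ∏ p : P, ((p : ℝ)⁻¹) ^ (φ p).card| ≤
      F.sliceCount B := by
  have : NeZero l := ⟨by omega⟩
  have hco := coprime_patternModulus φ hP hPl
  set c : Fin n → ℕ := fun ρ => Nat.chineseRemainder (hco ρ) (ξ ρ).val 0 with hc
  have h := F.abs_card_region_sub_le hgen σ₀ lam B (fun ρ => l * patternModulus φ ρ) c
    fun ρ => Nat.mul_pos (by omega) (patternModulus_pos φ hP ρ)
  have hset : {X ∈ F.regionTuples σ₀ lam B ξ | ∀ p : P, ∀ ρ ∈ φ p, (p : ℕ) ∣ X ρ} =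
      {X : Fin n → ℕ | (fun i => (X i : ℝ)) ∈ F.region σ₀ lam B ∧
        ∀ i, X i ≡ c i [MOD l * patternModulus φ i]} := by
    ext X
    simp only [regionTuples, Set.mem_ofPred_eq, and_assoc]
    refine and_congr_right fun _ => ?_
    have key : ∀ ρ, X ρ ≡ c ρ [MOD l * patternModulus φ ρ] ↔
        (X ρ : ZMod l) = ξ ρ ∧ ∀ p : P, ρ ∈ φ p → (p : ℕ) ∣ X ρ := by
      intro ρ
      have hcρ := (Nat.chineseRemainder (hco ρ) (ξ ρ).val 0).2
      rw [← Nat.modEq_and_modEq_iff_modEq_mul (hco ρ), ← patternModulus_dvd_iff φ hP]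
      refine and_congr ?_ ?_
      · have e1 : (X ρ : ZMod l) = ξ ρ ↔ X ρ ≡ (ξ ρ).val [MOD l] := by
          rw [← ZMod.natCast_eq_natCast_iff, ZMod.natCast_zmod_val]
        rw [e1]
        exact ⟨fun h => h.trans hcρ.1, fun h => h.trans hcρ.1.symm⟩
      · rw [← Nat.modEq_zero_iff_dvd]
        exact ⟨fun h => h.trans hcρ.2, fun h => h.trans hcρ.2.symm⟩
    constructor
    · rintro ⟨h1, h2⟩ ρ
      exact (key ρ).2 ⟨h1 ρ, fun p hp => h2 p ρ hp⟩
    · intro h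
      exact ⟨fun ρ => ((key ρ).1 (h ρ)).1, fun p ρ hp => ((key ρ).1 (h ρ)).2 p hp⟩
  rw [hset]
  have hprod : volume.real (F.region σ₀ lam B) / (l : ℝ) ^ n *
      ∏ p : P, ((p : ℝ)⁻¹) ^ (φ p).card =
      volume.real (F.region σ₀ lam B) / ∏ i, ((l * patternModulus φ i : ℕ) : ℝ) := by
    push_cast
    rw [prod_inv_pow_eq, Finset.prod_mul_distrib]
    rw [Finset.prod_const, Finset.card_univ, Fintype.card_fin, div_eq_mul_inv, div_eq_mul_inv,
      mul_inv, mul_assoc]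
  rw [hprod]
  exact h

/-- An upper bound for the same count, useful for large moduli. -/
theorem card_pattern_le (hgen : F.GloballyGenerated F.anticanonical) (σ₀ : F.MaxCone)
    (lam : σ₀.1 → ℝ) (B : ℝ) {l : ℕ} (ξ : Fin n → ZMod l) (hP : ∀ p ∈ P, p.Prime) :
    (({X ∈ F.regionTuples σ₀ lam B ξ | ∀ p : P, ∀ ρ ∈ φ p, (p : ℕ) ∣ X ρ}).ncard : ℝ) ≤
      (F.boundedTuples B).ncard * ∏ p : P, ((p : ℝ)⁻¹) ^ (φ p).card := by
  have h := F.ncard_dvd_mul_le hgen B (patternModulus φ)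
  have hfin := F.finite_boundedTuples hgen B
  have hsub : {X ∈ F.regionTuples σ₀ lam B ξ | ∀ p : P, ∀ ρ ∈ φ p, (p : ℕ) ∣ X ρ} ⊆
      {X ∈ F.boundedTuples B | ∀ ρ, patternModulus φ ρ ∣ X ρ} := fun X hX =>
    ⟨F.regionTuples_subset σ₀ lam B ξ hX.1, fun ρ =>
      (patternModulus_dvd_iff φ hP ρ _).2 fun p hp => hX.2 p ρ hp⟩
  have h1 := Set.ncard_le_ncard hsub (hfin.subset fun X hX => hX.1)
  have hpos : (0 : ℝ) < ∏ ρ, (patternModulus φ ρ : ℝ) :=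
    Finset.prod_pos fun ρ _ => by exact_mod_cast patternModulus_pos φ hP ρ
  rw [prod_inv_pow_eq, ← div_eq_mul_inv, le_div_iff₀ hpos]
  exact_mod_cast (Nat.mul_le_mul_right _ h1).trans h

end Pattern

theorem finite_regionTuples (hgen : F.GloballyGenerated F.anticanonical) (σ₀ : F.MaxCone)
    (lam : σ₀.1 → ℝ) (B : ℝ) {l : ℕ} (ξ : Fin n → ZMod l) :
    (F.regionTuples σ₀ lam B ξ).Finite :=
  (F.finite_boundedTuples hgen B).subset (F.regionTuples_subset σ₀ lam B ξ)

open Classical in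
/-- Expanding the condition to be bad at all primes of `P` into divisibility conditions. -/
theorem abs_card_bad_sub_le (hgen : F.GloballyGenerated F.anticanonical) (σ₀ : F.MaxCone)
    (lam : σ₀.1 → ℝ) (B : ℝ) {l : ℕ} (hl : 1 ≤ l) (ξ : Fin n → ZMod l)
    {c : Finset (Fin n) → ℝ} (hc : ∀ T, ∑ S ∈ T.powerset, c S = if F.Nonface T then 1 else 0)
    {P : Finset ℕ} (hP : ∀ p ∈ P, p.Prime) (hPl : ∀ p ∈ P, ¬ p ∣ l) :
    |(({X ∈ F.regionTuples σ₀ lam B ξ | ∀ p ∈ P, F.Nonface (divRays p X)}).ncard : ℝ) -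
        volume.real (F.region σ₀ lam B) / (l : ℝ) ^ n * ∏ p ∈ P, (1 - F.localDensity p)| ≤
      (∑ S, |c S|) ^ P.card * F.sliceCount B := by
  have hfin := F.finite_regionTuples hgen σ₀ lam B ξ
  set A := hfin.toFinset with hA
  set V := volume.real (F.region σ₀ lam B) / (l : ℝ) ^ n with hV
  set cnt : (P → Finset (Fin n)) → ℝ := fun φ =>
    (({X ∈ F.regionTuples σ₀ lam B ξ | ∀ p : P, ∀ ρ ∈ φ p, (p : ℕ) ∣ X ρ}).ncard : ℝ) with hcnt
  have hcnt' : ∀ φ, cnt φ = ∑ X ∈ A, ∏ p : P, if ∀ ρ ∈ φ p, (p : ℕ) ∣ X ρ then (1 : ℝ) else 0 := by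
    intro φ
    have : {X ∈ F.regionTuples σ₀ lam B ξ | ∀ p : P, ∀ ρ ∈ φ p, (p : ℕ) ∣ X ρ} =
        (A.filter fun X => ∀ p : P, ∀ ρ ∈ φ p, (p : ℕ) ∣ X ρ : Finset (Fin n → ℕ)) := by
      ext X; simp [hA]
    simp only [hcnt]
    rw [this, Set.ncard_coe_finset, Finset.card_filter]
    push_cast
    refine Finset.sum_congr rfl fun X _ => ?_
    rw [Finset.prod_ite_zero]
    simp
  have hbad : (({X ∈ F.regionTuples σ₀ lam B ξ | ∀ p ∈ P, F.Nonface (divRays p X)}).ncard : ℝ) =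
      ∑ φ : P → Finset (Fin n), (∏ p, c (φ p)) * cnt φ := by
    have h1 : {X ∈ F.regionTuples σ₀ lam B ξ | ∀ p ∈ P, F.Nonface (divRays p X)} =
        (A.filter fun X => ∀ p ∈ P, F.Nonface (divRays p X) : Finset (Fin n → ℕ)) := by
      ext X; simp [hA]
    have h2 : ∀ X : Fin n → ℕ, (if ∀ p ∈ P, F.Nonface (divRays p X) then (1 : ℝ) else 0) =
        ∑ φ : P → Finset (Fin n), (∏ p, c (φ p)) *
          ∏ p : P, if ∀ ρ ∈ φ p, (p : ℕ) ∣ X ρ then (1 : ℝ) else 0 := by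
      intro X
      simp only [← Finset.prod_mul_distrib]
      rw [← Fintype.piFinset_univ, ← Finset.prod_univ_sum (fun _ : P => Finset.univ)
        fun p S => c S * if ∀ ρ ∈ S, (p : ℕ) ∣ X ρ then (1 : ℝ) else 0]
      have h3 : ∀ p : P, ∑ S, (c S * if ∀ ρ ∈ S, (p : ℕ) ∣ X ρ then (1 : ℝ) else 0) =
          if F.Nonface (divRays p X) then 1 else 0 := by
        intro p
        rw [← hc]
        simp only [mul_ite, mul_one, mul_zero]
        rw [← Finset.sum_filter]
        refine Finset.sum_congr ?_ fun _ _ => rfl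
        ext S
        simp [Finset.subset_iff, mem_divRays]
      simp only [h3]
      rw [Finset.prod_ite_zero]
      simp
    rw [h1, Set.ncard_coe_finset, Finset.card_filter]
    push_cast
    simp only [h2, hcnt', Finset.mul_sum]
    exact Finset.sum_comm
  have hmain : V * ∏ p ∈ P, (1 - F.localDensity p) =
      ∑ φ : P → Finset (Fin n), (∏ p, c (φ p)) * (V * ∏ p : P, ((p : ℝ)⁻¹) ^ (φ p).card) := by
    have h1 : ∏ p ∈ P, (1 - F.localDensity p) =
        ∏ p : P, ∑ S, c S * ((p : ℝ)⁻¹) ^ S.card := by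
      rw [← Finset.prod_coe_sort P]
      refine Finset.prod_congr rfl fun p _ => ?_
      have : Fact (p : ℕ).Prime := ⟨hP p p.2⟩
      exact F.one_sub_localDensity_eq_sum hc p
    rw [h1, Finset.prod_univ_sum, Finset.mul_sum, Fintype.piFinset_univ]
    refine Finset.sum_congr rfl fun φ _ => ?_
    rw [Finset.prod_mul_distrib]
    ring
  rw [hbad, hmain, ← Finset.sum_sub_distrib]
  refine (Finset.abs_sum_le_sum_abs _ _).trans ?_
  have habs : (∑ S, |c S|) ^ P.card = ∑ φ : P → Finset (Fin n), ∏ p, |c (φ p)| := by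
    rw [← Fintype.piFinset_univ, ← Finset.prod_univ_sum (fun _ : P => Finset.univ) fun _ S => |c S|]
    simp
  rw [habs, Finset.sum_mul]
  refine Finset.sum_le_sum fun φ _ => ?_
  rw [← mul_sub, abs_mul, Finset.abs_prod]
  exact mul_le_mul_of_nonneg_left
    (F.abs_card_pattern_sub_le φ hgen σ₀ lam B hl ξ hP hPl)
    (Finset.prod_nonneg fun _ _ => abs_nonneg _)

/-- Tuples that are bad at all primes of `P` are rare, since a nonface has at least `α₀` elements. -/
theorem card_bad_le (hgen : F.GloballyGenerated F.anticanonical) (σ₀ : F.MaxCone)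
    (lam : σ₀.1 → ℝ) (B : ℝ) {l : ℕ} (ξ : Fin n → ZMod l)
    {P : Finset ℕ} (hP : ∀ p ∈ P, p.Prime) :
    (({X ∈ F.regionTuples σ₀ lam B ξ | ∀ p ∈ P, F.Nonface (divRays p X)}).ncard : ℝ) ≤
      (F.boundedTuples B).ncard *
        ((2 ^ n) ^ P.card * ((∏ p ∈ P, p : ℕ) : ℝ) ^ (-(F.alphaZero : ℝ))) := by
  classical
  have hfin := F.finite_regionTuples hgen σ₀ lam B ξ
  set Φ : Finset (P → Finset (Fin n)) := Finset.univ.filter fun φ => ∀ p, F.Nonface (φ p) with hΦ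
  have hsub : {X ∈ F.regionTuples σ₀ lam B ξ | ∀ p ∈ P, F.Nonface (divRays p X)} ⊆
      ⋃ φ ∈ Φ, {X ∈ F.regionTuples σ₀ lam B ξ | ∀ p : P, ∀ ρ ∈ φ p, (p : ℕ) ∣ X ρ} := by
    intro X hX
    simp only [Set.mem_iUnion]
    refine ⟨fun p => divRays p X, Finset.mem_filter.2 ⟨Finset.mem_univ _, fun p => hX.2 p p.2⟩,
      hX.1, fun p ρ hρ => mem_divRays.1 hρ⟩
  have hfinU : (⋃ φ ∈ Φ, {X ∈ F.regionTuples σ₀ lam B ξ |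
      ∀ p : P, ∀ ρ ∈ φ p, (p : ℕ) ∣ X ρ}).Finite :=
    Φ.finite_toSet.biUnion fun φ _ => hfin.subset fun X hX => hX.1
  have h1 := (Set.ncard_le_ncard hsub hfinU).trans (Finset.set_ncard_biUnion_le _ _)
  have hterm : ∀ φ ∈ Φ, (({X ∈ F.regionTuples σ₀ lam B ξ |
      ∀ p : P, ∀ ρ ∈ φ p, (p : ℕ) ∣ X ρ}).ncard : ℝ) ≤
        (F.boundedTuples B).ncard * ((∏ p ∈ P, p : ℕ) : ℝ) ^ (-(F.alphaZero : ℝ)) := by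
    intro φ hφ
    refine (F.card_pattern_le φ hgen σ₀ lam B ξ hP).trans ?_
    refine mul_le_mul_of_nonneg_left ?_ (Nat.cast_nonneg _)
    push_cast
    rw [← Real.finsetProd_rpow _ _ (fun p _ => Nat.cast_nonneg p), ← Finset.prod_coe_sort P]
    refine Finset.prod_le_prod (fun p _ => by positivity) fun p _ => ?_
    have hp1 : (1 : ℝ) ≤ p := by exact_mod_cast (hP p p.2).one_le
    rw [Real.rpow_neg (by linarith), Real.rpow_natCast, inv_pow]
    exact inv_anti₀ (by positivity)
      (pow_le_pow_right₀ hp1 ((Finset.mem_filter.1 hφ).2 p).alphaZero_le)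
  have hcard : Φ.card ≤ (2 ^ n) ^ P.card := by
    refine (Finset.card_filter_le _ _).trans ?_
    simp
  calc _ ≤ ((∑ φ ∈ Φ, ({X ∈ F.regionTuples σ₀ lam B ξ |
      ∀ p : P, ∀ ρ ∈ φ p, (p : ℕ) ∣ X ρ}).ncard : ℕ) : ℝ) := by exact_mod_cast h1
    _ ≤ Φ.card * ((F.boundedTuples B).ncard *
          ((∏ p ∈ P, p : ℕ) : ℝ) ^ (-(F.alphaZero : ℝ))) := by
        push_cast
        exact (Finset.sum_le_card_nsmul _ _ _ hterm).trans (by rw [nsmul_eq_mul]; push_cast; rfl)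
    _ ≤ ((2 ^ n) ^ P.card : ℕ) * ((F.boundedTuples B).ncard *
          ((∏ p ∈ P, p : ℕ) : ℝ) ^ (-(F.alphaZero : ℝ))) := by gcongr
    _ = _ := by push_cast; ring

theorem prod_one_sub_localDensity_le {P : Finset ℕ} (hP : ∀ p ∈ P, p.Prime) :
    0 ≤ ∏ p ∈ P, (1 - F.localDensity p) ∧ ∏ p ∈ P, (1 - F.localDensity p) ≤
      (2 ^ n) ^ P.card * ((∏ p ∈ P, p : ℕ) : ℝ) ^ (-(F.alphaZero : ℝ)) := by
  have h0 : ∀ p ∈ P, 0 ≤ 1 - F.localDensity p := fun p hp => by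
    have : Fact p.Prime := ⟨hP p hp⟩
    exact F.one_sub_localDensity_nonneg p
  refine ⟨Finset.prod_nonneg h0, ?_⟩
  push_cast
  rw [← Real.finsetProd_rpow _ _ (fun p _ => Nat.cast_nonneg p), ← Finset.prod_const,
    ← Finset.prod_mul_distrib]
  refine Finset.prod_le_prod h0 fun p hp => ?_
  have : Fact p.Prime := ⟨hP p hp⟩
  exact F.one_sub_localDensity_le p

/-- Inclusion-exclusion over the sets of bad primes. -/
theorem card_good_eq_sum (hgen : F.GloballyGenerated F.anticanonical) (σ₀ : F.MaxCone)
    (lam : σ₀.1 → ℝ) (B : ℝ) {l : ℕ} (ξ : Fin n → ZMod l) (Q : Finset ℕ) :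
    (({X ∈ F.regionTuples σ₀ lam B ξ | ∀ p ∈ Q, ¬ F.Nonface (divRays p X)}).ncard : ℝ) =
      ∑ P ∈ Q.powerset, (-1) ^ P.card *
        (({X ∈ F.regionTuples σ₀ lam B ξ | ∀ p ∈ P, F.Nonface (divRays p X)}).ncard : ℝ) := by
  classical
  have hfin := F.finite_regionTuples hgen σ₀ lam B ξ
  set A := hfin.toFinset with hA
  have hgood : {X ∈ F.regionTuples σ₀ lam B ξ | ∀ p ∈ Q, ¬ F.Nonface (divRays p X)} =
      (A.filter fun X => ∀ p ∈ Q, ¬ F.Nonface (divRays p X) : Finset (Fin n → ℕ)) := by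
    ext X; simp [hA]
  have hbad : ∀ P : Finset ℕ, {X ∈ F.regionTuples σ₀ lam B ξ | ∀ p ∈ P, F.Nonface (divRays p X)} =
      (A.filter fun X => ∀ p ∈ P, F.Nonface (divRays p X) : Finset (Fin n → ℕ)) := fun P => by
    ext X; simp [hA]
  simp only [hgood, hbad, Set.ncard_coe_finset, Finset.card_filter]
  push_cast
  simp only [Finset.mul_sum]
  rw [Finset.sum_comm]
  refine Finset.sum_congr rfl fun X _ => ?_
  have h1 : (if ∀ p ∈ Q, ¬ F.Nonface (divRays p X) then (1 : ℝ) else 0) =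
      ∏ p ∈ Q, (1 + -(if F.Nonface (divRays p X) then (1 : ℝ) else 0)) := by
    have : ∀ p, (1 : ℝ) + -(if F.Nonface (divRays p X) then (1 : ℝ) else 0) =
        if ¬ F.Nonface (divRays p X) then 1 else 0 := fun p => by
      by_cases h : F.Nonface (divRays p X) <;> simp [h]
    simp only [this]
    rw [Finset.prod_ite_zero]
    simp
  rw [h1, Finset.prod_one_add]
  refine Finset.sum_congr rfl fun P _ => ?_
  rw [Finset.prod_neg, Finset.prod_ite_zero]
  simp

/-- The sieve by the primes of `Q`. In the inclusion-exclusion formula, the sets of primes of product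
at most `z` are treated by the uniform count, and the other ones by upper bounds. -/
theorem exists_sieve_bound (hgen : F.GloballyGenerated F.anticanonical) (h2 : 2 ≤ F.alphaZero)
    (σ₀ : F.MaxCone) (lam : σ₀.1 → ℝ) {ε : ℝ} (hε : 0 < ε) (hε' : ε ≤ 1 / 2) :
    ∃ C : ℝ, 0 ≤ C ∧ ∀ (l : ℕ) (ξ : Fin n → ZMod l) (B z : ℝ) (Q : Finset ℕ), 1 ≤ l → 1 ≤ z →
      (∀ p ∈ Q, p.Prime) → (∀ p ∈ Q, ¬ p ∣ l) →
      |(({X ∈ F.regionTuples σ₀ lam B ξ | ∀ p ∈ Q, ¬ F.Nonface (divRays p X)}).ncard : ℝ) -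
          volume.real (F.region σ₀ lam B) / (l : ℝ) ^ n * ∏ p ∈ Q, F.localDensity p| ≤
        C * (F.sliceCount B * z ^ (1 + ε) +
          (F.boundedTuples B).ncard * z ^ (1 - (F.alphaZero : ℝ) + 2 * ε)) := by
  classical
  obtain ⟨c, hc⟩ := F.exists_nonface_coeff
  set K : ℝ := 2 ^ n + ∑ S, |c S| with hK
  have hS0 : 0 ≤ ∑ S, |c S| := Finset.sum_nonneg fun _ _ => abs_nonneg _
  have h2n : (1 : ℝ) ≤ 2 ^ n := one_le_pow₀ (by norm_num)
  have hK1 : 1 ≤ K := by linarith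
  have hα : (2 : ℝ) ≤ F.alphaZero := by exact_mod_cast h2
  obtain ⟨C₁, hC₁0, hC₁⟩ := sum_pow_card_le hK1 hε
  obtain ⟨C₂, hC₂0, hC₂⟩ := sum_pow_card_mul_rpow_le hK1 hε
    (α := F.alphaZero) (by linarith)
  refine ⟨C₁ + C₂, by positivity, fun l ξ B z Q hl hz hQ hQl => ?_⟩
  set V := volume.real (F.region σ₀ lam B) / (l : ℝ) ^ n with hV
  set T : ℝ := ((F.boundedTuples B).ncard : ℝ) with hT
  set E : ℝ := (F.sliceCount B : ℝ) with hE
  have hl1 : (1 : ℝ) ≤ (l : ℝ) ^ n := one_le_pow₀ (by exact_mod_cast hl)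
  have hV0 : 0 ≤ V := by positivity
  have hVT : V ≤ T := by
    refine (div_le_self measureReal_nonneg hl1).trans ?_
    exact F.volume_region_le hgen σ₀ lam B
  set Ab : Finset ℕ → ℝ := fun P =>
    (({X ∈ F.regionTuples σ₀ lam B ξ | ∀ p ∈ P, F.Nonface (divRays p X)}).ncard : ℝ) with hAb
  have hmain : ∏ p ∈ Q, F.localDensity p =
      ∑ P ∈ Q.powerset, (-1) ^ P.card * ∏ p ∈ P, (1 - F.localDensity p) := by
    have : ∀ p, F.localDensity p = 1 + -(1 - F.localDensity p) := fun p => by ring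
    rw [Finset.prod_congr rfl fun p _ => this p, Finset.prod_one_add]
    exact Finset.sum_congr rfl fun P _ => Finset.prod_neg _
  rw [F.card_good_eq_sum hgen σ₀ lam B ξ Q, hmain, Finset.mul_sum, ← Finset.sum_sub_distrib]
  refine (Finset.abs_sum_le_sum_abs _ _).trans ?_
  have hbound : ∀ P ∈ Q.powerset,
      |(-1) ^ P.card * Ab P - V * ((-1) ^ P.card * ∏ p ∈ P, (1 - F.localDensity p))| =
        |Ab P - V * ∏ p ∈ P, (1 - F.localDensity p)| := by
    intro P _
    have : (-1) ^ P.card * Ab P - V * ((-1) ^ P.card * ∏ p ∈ P, (1 - F.localDensity p)) =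
        (-1) ^ P.card * (Ab P - V * ∏ p ∈ P, (1 - F.localDensity p)) := by ring
    rw [this, abs_mul, abs_pow, abs_neg, abs_one, one_pow, one_mul]
  rw [Finset.sum_congr rfl hbound,
    ← Finset.sum_filter_add_sum_filter_not _ (fun P => ((∏ p ∈ P, p : ℕ) : ℝ) ≤ z)]
  have hsmall : ∀ P ∈ Q.powerset.filter (fun P => ((∏ p ∈ P, p : ℕ) : ℝ) ≤ z),
      |Ab P - V * ∏ p ∈ P, (1 - F.localDensity p)| ≤ E * K ^ P.card := by
    intro P hP
    have hPQ := Finset.mem_powerset.1 (Finset.mem_filter.1 hP).1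
    refine (F.abs_card_bad_sub_le hgen σ₀ lam B hl ξ hc (fun p hp => hQ p (hPQ hp))
      fun p hp => hQl p (hPQ hp)).trans ?_
    rw [mul_comm]
    refine mul_le_mul_of_nonneg_left ?_ (Nat.cast_nonneg _)
    exact pow_le_pow_left₀ hS0 (by linarith) _
  have hlarge : ∀ P ∈ Q.powerset.filter (fun P => ¬ ((∏ p ∈ P, p : ℕ) : ℝ) ≤ z),
      |Ab P - V * ∏ p ∈ P, (1 - F.localDensity p)| ≤
        T * (K ^ P.card * ((∏ p ∈ P, p : ℕ) : ℝ) ^ (-(F.alphaZero : ℝ))) := by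
    intro P hP
    have hPQ := Finset.mem_powerset.1 (Finset.mem_filter.1 hP).1
    have hPp : ∀ p ∈ P, p.Prime := fun p hp => hQ p (hPQ hp)
    set s : ℝ := ((∏ p ∈ P, p : ℕ) : ℝ) ^ (-(F.alphaZero : ℝ)) with hs
    have hs0 : 0 ≤ s := by positivity
    have hpow : ((2 : ℝ) ^ n) ^ P.card * s ≤ K ^ P.card * s := by
      gcongr; linarith
    have hT0 : 0 ≤ T := Nat.cast_nonneg _
    have a1 : Ab P ≤ T * (K ^ P.card * s) :=
      (F.card_bad_le hgen σ₀ lam B ξ hPp).trans (mul_le_mul_of_nonneg_left hpow hT0)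
    obtain ⟨b0, b1⟩ := F.prod_one_sub_localDensity_le hPp
    have a2 : V * ∏ p ∈ P, (1 - F.localDensity p) ≤ T * (K ^ P.card * s) :=
      mul_le_mul hVT (b1.trans hpow) b0 hT0
    have a3 : 0 ≤ V * ∏ p ∈ P, (1 - F.localDensity p) := mul_nonneg hV0 b0
    have a4 : 0 ≤ Ab P := Nat.cast_nonneg _
    rw [abs_le]
    constructor <;> linarith
  have hT0 : 0 ≤ T := Nat.cast_nonneg _
  have hE0 : 0 ≤ E := Nat.cast_nonneg _
  have hz1 : 0 ≤ z ^ (1 + ε) := by positivity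
  have hz2 : 0 ≤ z ^ (1 - (F.alphaZero : ℝ) + 2 * ε) := by positivity
  calc _ ≤ E * (C₁ * z ^ (1 + ε)) + T * (C₂ * z ^ (1 - (F.alphaZero : ℝ) + 2 * ε)) := by
        refine add_le_add ((Finset.sum_le_sum hsmall).trans ?_)
          ((Finset.sum_le_sum hlarge).trans ?_)
        · rw [← Finset.mul_sum]
          exact mul_le_mul_of_nonneg_left (hC₁ Q hQ z hz) hE0
        · rw [← Finset.mul_sum]
          exact mul_le_mul_of_nonneg_left (hC₂ Q hQ z hz) hT0
    _ ≤ _ := by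
        have : 0 ≤ C₂ * (E * z ^ (1 + ε)) := by positivity
        have : 0 ≤ C₁ * (T * z ^ (1 - (F.alphaZero : ℝ) + 2 * ε)) := by positivity
        linarith

/-- The tuples to be counted are those points of the region in the residue class that are good at
all primes. -/
theorem mem_congruenceTuples_iff (σ₀ : F.MaxCone) (lam : σ₀.1 → ℝ) (B : ℝ) {l : ℕ}
    (ξ : Fin n → ZMod l) (X : Fin n → ℕ) :
    X ∈ F.congruenceTuples σ₀ (standardBox σ₀ lam) ξ B ↔
      X ∈ F.regionTuples σ₀ lam B ξ ∧ ∀ p : ℕ, p.Prime → ¬ F.Nonface (divRays p X) := by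
  rw [← gcd_coneMonomial_eq_one_iff]
  simp only [congruenceTuples, primitiveTuples, regionTuples, region, Set.mem_ofPred_eq,
    cast_heightMonomial, Nat.one_le_cast, Nat.succ_le_iff]
  tauto

/-- The count of primitive tuples in terms of the volume of the region. The primes below a growing
bound are sieved, and the bound is sent to infinity for fixed `B`. -/
theorem exists_congruenceTuples_bound (hgen : F.GloballyGenerated F.anticanonical)
    (h2 : 2 ≤ F.alphaZero) (σ₀ : F.MaxCone) (lam : σ₀.1 → ℝ) {ε : ℝ} (hε : 0 < ε)
    (hε' : ε ≤ 1 / 2) :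
    ∃ C : ℝ, 0 ≤ C ∧ ∀ (l : ℕ) (ξ : Fin n → ZMod l) (B z : ℝ), 1 ≤ l → 1 ≤ z →
      ξ ∈ F.torsorPoints (ZMod l) →
      |((F.congruenceTuples σ₀ (standardBox σ₀ lam) ξ B).ncard : ℝ) -
          F.kappa l * volume.real (F.region σ₀ lam B)| ≤
        C * (F.sliceCount B * z ^ (1 + ε) +
          (F.boundedTuples B).ncard * z ^ (1 - (F.alphaZero : ℝ) + 2 * ε)) := by
  classical
  obtain ⟨C, hC0, hC⟩ := F.exists_sieve_bound hgen h2 σ₀ lam hε hε'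
  refine ⟨C, hC0, fun l ξ B z hl hz hξ => ?_⟩
  set R := C * (F.sliceCount B * z ^ (1 + ε) +
          (F.boundedTuples B).ncard * z ^ (1 - (F.alphaZero : ℝ) + 2 * ε)) with hR
  set V := volume.real (F.region σ₀ lam B) with hV
  set s : ℕ → Finset {p : ℕ // p.Prime ∧ ¬ p ∣ l} := fun m => (Finset.range m).subtype _ with hs
  have hs_tendsto : Filter.Tendsto s Filter.atTop Filter.atTop := by
    refine Filter.tendsto_atTop_finset_of_monotone (fun a b hab p hp => ?_) fun p => ⟨p + 1, ?_⟩
    · simp only [hs, Finset.mem_subtype, Finset.mem_range] at hp ⊢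
      omega
    · simp [hs]
  have hlim := (F.multipliable_localDensity h2 l).hasProd.comp hs_tendsto
  have hlim2 : Filter.Tendsto (fun m => |((F.congruenceTuples σ₀ (standardBox σ₀ lam) ξ B).ncard : ℝ) -
      V / (l : ℝ) ^ n * ∏ p ∈ s m, F.localDensity p|) Filter.atTop
      (nhds |((F.congruenceTuples σ₀ (standardBox σ₀ lam) ξ B).ncard : ℝ) - F.kappa l * V|) := by
    have := ((hlim.const_mul (V / (l : ℝ) ^ n)).const_sub
      ((F.congruenceTuples σ₀ (standardBox σ₀ lam) ξ B).ncard : ℝ)).abs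
    have e : F.kappa l * V = V / (l : ℝ) ^ n *
        ∏' p : {p : ℕ // p.Prime ∧ ¬ p ∣ l}, F.localDensity p := by
      rw [kappa]; ring
    rw [e]
    exact this
  refine le_of_tendsto hlim2 ?_
  -- All coordinates are smaller than this bound, so that larger primes are never bad.
  filter_upwards [Filter.eventually_ge_atTop (2 ^ (Nat.log 2 ⌊B⌋₊ + 1))] with m hm
  set Q : Finset ℕ := (Finset.range m).filter fun p => p.Prime ∧ ¬ p ∣ l with hQ
  have hprod : ∏ p ∈ s m, F.localDensity p = ∏ p ∈ Q, F.localDensity p := by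
    rw [hQ, ← Finset.subtype_map, Finset.prod_map]
    rfl
  have hset : F.congruenceTuples σ₀ (standardBox σ₀ lam) ξ B =
      {X ∈ F.regionTuples σ₀ lam B ξ | ∀ p ∈ Q, ¬ F.Nonface (divRays p X)} := by
    ext X
    rw [mem_congruenceTuples_iff]
    refine and_congr_right fun hX => ⟨fun h p hp => h p (Finset.mem_filter.1 hp).2.1,
      fun h p hp hbad => ?_⟩
    by_cases hpl : p ∣ l
    · exact F.not_nonface_of_congr hξ hX.2 hp hpl hbad
    · refine h p (Finset.mem_filter.2 ⟨Finset.mem_range.2 ?_, hp, hpl⟩) hbad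
      obtain ⟨ρ, hρ⟩ := hbad.nonempty
      have hXb := F.regionTuples_subset σ₀ lam B ξ hX
      have h1 := Nat.le_of_dvd (hXb.1 ρ) (mem_divRays.1 hρ)
      exact (h1.trans_lt (F.boundedTuples_lt hgen hXb ρ)).trans_le hm
  rw [hprod, hset]
  exact hC l ξ B z Q hl hz (fun p hp => (Finset.mem_filter.1 hp).2.1)
    fun p hp => (Finset.mem_filter.1 hp).2.2

end RegularCompleteFan

/-! ### Integrals over cones -/

section ConeIntegral

variable {ι : Type*} [Fintype ι] {C : Set (ι → ℝ)} {ℓ : (ι → ℝ) →ₗ[ℝ] ℝ}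

theorem volume_sublevel_lt_top (hℓ : ∀ t ∈ C, ∀ j, 0 ≤ t j ∧ t j ≤ ℓ t) (s : ℝ) :
    volume (C ∩ {t | ℓ t ≤ s}) < ⊤ := by
  have hsub : C ∩ {t | ℓ t ≤ s} ⊆ Set.univ.pi fun _ => Set.Icc 0 s := fun t ht j _ =>
    ⟨(hℓ t ht.1 j).1, (hℓ t ht.1 j).2.trans ht.2⟩
  refine (measure_mono hsub).trans_lt ?_
  rw [volume_pi_pi]
  exact ENNReal.prod_lt_top fun i _ => by simp

theorem volume_sublevel_zero [Nonempty ι] (hℓ : ∀ t ∈ C, ∀ j, 0 ≤ t j ∧ t j ≤ ℓ t) {s : ℝ}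
    (hs : s ≤ 0) : volume (C ∩ {t | ℓ t ≤ s}) = 0 := by
  have hsub : C ∩ {t | ℓ t ≤ s} ⊆ Set.univ.pi fun _ => Set.Icc 0 0 := fun t ht j _ =>
    ⟨(hℓ t ht.1 j).1, ((hℓ t ht.1 j).2.trans ht.2).trans hs⟩
  refine measure_mono_null hsub ?_
  rw [volume_pi_pi]
  simp

open scoped Pointwise in
/-- The volume of a truncated cone, by homogeneity. -/
theorem volume_sublevel [Nonempty ι] (hsmul : ∀ s : ℝ, 0 < s → ∀ t ∈ C, s • t ∈ C)
    (hℓ : ∀ t ∈ C, ∀ j, 0 ≤ t j ∧ t j ≤ ℓ t) {s : ℝ} (hs : 0 ≤ s) :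
    volume (C ∩ {t | ℓ t ≤ s}) =
      ENNReal.ofReal (volume.real (C ∩ {t | ℓ t ≤ 1}) * s ^ Fintype.card ι) := by
  rcases hs.eq_or_lt with rfl | hs
  · rw [volume_sublevel_zero hℓ le_rfl, zero_pow Fintype.card_ne_zero]; simp
  have hset : C ∩ {t | ℓ t ≤ s} = s • (C ∩ {t | ℓ t ≤ 1}) := by
    ext t
    rw [Set.mem_smul_set_iff_inv_smul_mem₀ hs.ne']
    simp only [Set.mem_inter_iff, Set.mem_ofPred_eq, map_smul, smul_eq_mul]
    have h1 : s⁻¹ * ℓ t ≤ 1 ↔ ℓ t ≤ s := by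
      rw [inv_mul_le_iff₀ hs, mul_one]
    rw [h1]
    refine and_congr_left fun _ => ⟨fun h => hsmul _ (inv_pos.2 hs) t h, fun h => ?_⟩
    have := hsmul s hs _ h
    rwa [smul_smul, mul_inv_cancel₀ hs.ne', one_smul] at this
  rw [hset, Measure.addHaar_smul, Module.finrank_fintype_fun_eq_card,
    abs_of_nonneg (by positivity), mul_comm, ENNReal.ofReal_mul measureReal_nonneg,
    ofReal_measureReal (volume_sublevel_lt_top hℓ 1).ne]

/-- The distribution of a linear form on a cone. -/
theorem map_restrict_cone [Nonempty ι] (hC : MeasurableSet C)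
    (hsmul : ∀ s : ℝ, 0 < s → ∀ t ∈ C, s • t ∈ C)
    (hℓ : ∀ t ∈ C, ∀ j, 0 ≤ t j ∧ t j ≤ ℓ t) :
    Measure.map ℓ (volume.restrict C) = (volume.restrict (Set.Ioi 0)).withDensity fun s =>
      ENNReal.ofReal (volume.real (C ∩ {t | ℓ t ≤ 1}) *
        (Fintype.card ι * s ^ (Fintype.card ι - 1))) := by
  set r := Fintype.card ι with hr
  have hr1 : 1 ≤ r := Fintype.card_pos
  set V := volume.real (C ∩ {t | ℓ t ≤ 1}) with hV
  have hV0 : 0 ≤ V := measureReal_nonneg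
  have hℓm : Measurable ℓ := (LinearMap.continuous_of_finiteDimensional ℓ).measurable
  have hleft : ∀ a b : ℝ, Measure.map ℓ (volume.restrict C) (Set.Ioc a b) =
      volume ((C ∩ {t | ℓ t ≤ b}) \ (C ∩ {t | ℓ t ≤ a})) := by
    intro a b
    rw [Measure.map_apply hℓm measurableSet_Ioc, Measure.restrict_apply (hℓm measurableSet_Ioc)]
    congr 1
    ext t
    simp only [Set.mem_inter_iff, Set.mem_preimage, Set.mem_Ioc, Set.mem_sdiff, Set.mem_ofPred_eq,
      not_and, not_le]
    tauto
  have hdiff : ∀ a b : ℝ, a ≤ b → volume ((C ∩ {t | ℓ t ≤ b}) \ (C ∩ {t | ℓ t ≤ a})) =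
      volume (C ∩ {t | ℓ t ≤ b}) - volume (C ∩ {t | ℓ t ≤ a}) := by
    intro a b hab
    refine measure_sdiff (fun t ht => ⟨ht.1, le_trans ht.2 hab⟩) ?_ (volume_sublevel_lt_top hℓ a).ne
    exact (hC.inter (measurableSet_le hℓm measurable_const)).nullMeasurableSet
  refine Measure.ext_of_Ioc' _ _ (fun a b _ => ?_) fun a b hab => ?_
  · rw [hleft]
    exact ((measure_mono Set.sdiff_subset).trans_lt (volume_sublevel_lt_top hℓ b)).ne
  · rw [hleft, hdiff a b hab.le, withDensity_apply _ measurableSet_Ioc,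
      Measure.restrict_restrict measurableSet_Ioc]
    rcases le_or_gt b 0 with hb | hb
    · have he : Set.Ioc a b ∩ Set.Ioi 0 = ∅ := by
        ext s
        simp only [Set.mem_inter_iff, Set.mem_Ioc, Set.mem_Ioi, Set.mem_empty_iff_false, iff_false]
        intro h
        linarith [h.1.2, h.2]
      rw [he, volume_sublevel_zero hℓ hb]
      simp
    · have he : Set.Ioc a b ∩ Set.Ioi 0 = Set.Ioc (max a 0) b := by
        ext s
        simp only [Set.mem_inter_iff, Set.mem_Ioc, Set.mem_Ioi, max_lt_iff]
        tauto
      have ha : volume (C ∩ {t | ℓ t ≤ a}) = ENNReal.ofReal (V * (max a 0) ^ r) := by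
        rcases le_or_gt a 0 with h | h
        · rw [max_eq_right h, volume_sublevel_zero hℓ h, zero_pow (by omega)]; simp
        · rw [max_eq_left h.le, volume_sublevel hsmul hℓ h.le]
      have hmb : max a 0 ≤ b := max_le hab.le hb.le
      have hm0 : 0 ≤ max a 0 := le_max_right _ _
      rw [he, ha, volume_sublevel hsmul hℓ hb.le, ← hr, ← hV,
        ← ENNReal.ofReal_sub _ (by positivity)]
      have hcont : Continuous fun s : ℝ => V * (r * s ^ (r - 1)) := by fun_prop
      rw [← ofReal_integral_eq_lintegral_ofReal]
      · congr 1
        rw [← intervalIntegral.integral_of_le hmb,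
          intervalIntegral.integral_eq_sub_of_hasDerivAt (f := fun s => V * s ^ r)
            (fun s _ => (hasDerivAt_pow r s).const_mul V) (hcont.intervalIntegrable _ _)]
      · exact (hcont.integrableOn_Icc (a := max a 0) (b := b)).mono_set Set.Ioc_subset_Icc_self
      · refine (ae_restrict_iff' measurableSet_Ioc).2 (Filter.Eventually.of_forall fun s hs => ?_)
        have : 0 ≤ s := hm0.trans hs.1.le
        simp only [Pi.zero_apply]
        positivity

/-- The integral that defines `α(X)`, in terms of the volume of the truncated cone. -/
theorem integral_exp_neg_cone [Nonempty ι] (hC : MeasurableSet C)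
    (hsmul : ∀ s : ℝ, 0 < s → ∀ t ∈ C, s • t ∈ C)
    (hℓ : ∀ t ∈ C, ∀ j, 0 ≤ t j ∧ t j ≤ ℓ t) :
    ∫ t in C, Real.exp (-ℓ t) =
      volume.real (C ∩ {t | ℓ t ≤ 1}) * (Fintype.card ι).factorial := by
  set V := volume.real (C ∩ {t | ℓ t ≤ 1}) with hV
  set r := Fintype.card ι with hr
  have hr1 : 1 ≤ r := Fintype.card_pos
  have hV0 : 0 ≤ V := measureReal_nonneg
  have hℓm : Measurable ℓ := (LinearMap.continuous_of_finiteDimensional ℓ).measurable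
  have h1 := integral_map (μ := volume.restrict C) hℓm.aemeasurable
    (f := fun s => Real.exp (-s)) (by fun_prop)
  rw [← h1, map_restrict_cone hC hsmul hℓ, ← hV, ← hr,
    integral_withDensity_eq_integral_toReal_smul (by fun_prop)
      (Filter.Eventually.of_forall fun _ => ENNReal.ofReal_lt_top)]
  have h2 : ∫ s in Set.Ioi (0 : ℝ), (ENNReal.ofReal (V * (r * s ^ (r - 1)))).toReal • Real.exp (-s) =
      ∫ s in Set.Ioi (0 : ℝ), (V * r) * (Real.exp (-s) * s ^ ((r : ℝ) - 1)) := by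
    refine setIntegral_congr_fun measurableSet_Ioi fun s hs => ?_
    have hs0 : (0 : ℝ) < s := hs
    rw [ENNReal.toReal_ofReal (by positivity), smul_eq_mul]
    have : s ^ ((r : ℝ) - 1) = s ^ (r - 1) := by
      rw [← Real.rpow_natCast, Nat.cast_sub hr1, Nat.cast_one]
    rw [this]
    ring
  rw [h2, integral_const_mul, ← Real.Gamma_eq_integral (by exact_mod_cast hr1)]
  obtain ⟨m, hm⟩ : ∃ m, r = m + 1 := ⟨r - 1, by omega⟩
  rw [hm]
  push_cast
  rw [Real.Gamma_nat_eq_factorial, Nat.factorial_succ]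
  push_cast
  ring

theorem lintegral_exp_cone [Nonempty ι] (hC : MeasurableSet C)
    (hsmul : ∀ s : ℝ, 0 < s → ∀ t ∈ C, s • t ∈ C)
    (hℓ : ∀ t ∈ C, ∀ j, 0 ≤ t j ∧ t j ≤ ℓ t) {L : ℝ} (hL : 0 ≤ L) :
    ∫⁻ t in C ∩ {t | ℓ t ≤ L}, ENNReal.ofReal (Real.exp (ℓ t)) =
      ENNReal.ofReal (volume.real (C ∩ {t | ℓ t ≤ 1}) * (Fintype.card ι *
        ∫ s in (0 : ℝ)..L, s ^ (Fintype.card ι - 1) * Real.exp s)) := by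
  set V := volume.real (C ∩ {t | ℓ t ≤ 1}) with hV
  set r := Fintype.card ι with hr
  have hV0 : 0 ≤ V := measureReal_nonneg
  have hℓm : Measurable ℓ := (LinearMap.continuous_of_finiteDimensional ℓ).measurable
  have hLm : MeasurableSet {t : ι → ℝ | ℓ t ≤ L} := measurableSet_le hℓm measurable_const
  have e1 : ∫⁻ t in C ∩ {t | ℓ t ≤ L}, ENNReal.ofReal (Real.exp (ℓ t)) =
      ∫⁻ s in Set.Iic L, ENNReal.ofReal (Real.exp s) ∂(Measure.map ℓ (volume.restrict C)) := by
    rw [setLIntegral_map measurableSet_Iic (by fun_prop) hℓm]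
    have : ℓ ⁻¹' Set.Iic L = {t | ℓ t ≤ L} := rfl
    rw [this, Measure.restrict_restrict hLm, Set.inter_comm]
  rw [e1, map_restrict_cone hC hsmul hℓ, ← hV, ← hr, restrict_withDensity measurableSet_Iic,
    Measure.restrict_restrict measurableSet_Iic, lintegral_withDensity_eq_lintegral_mul _
      (by fun_prop) (by fun_prop), Set.inter_comm, Set.Ioi_inter_Iic]
  have hcont : Continuous fun s : ℝ => V * (r * (s ^ (r - 1) * Real.exp s)) := by fun_prop
  have e2 : ∫⁻ s in Set.Ioc 0 L, ((fun s => ENNReal.ofReal (V * (r * s ^ (r - 1)))) *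
      fun s => ENNReal.ofReal (Real.exp s)) s =
      ∫⁻ s in Set.Ioc 0 L, ENNReal.ofReal (V * (r * (s ^ (r - 1) * Real.exp s))) := by
    refine setLIntegral_congr_fun measurableSet_Ioc fun s hs => ?_
    have : 0 ≤ s := hs.1.le
    simp only [Pi.mul_apply]
    rw [← ENNReal.ofReal_mul (by positivity)]
    congr 1; ring
  rw [e2, ← ofReal_integral_eq_lintegral_ofReal]
  · rw [← intervalIntegral.integral_of_le hL, intervalIntegral.integral_const_mul,
      intervalIntegral.integral_const_mul]
  · exact (hcont.integrableOn_Icc (a := 0) (b := L)).mono_set Set.Ioc_subset_Icc_self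
  · refine (ae_restrict_iff' measurableSet_Ioc).2 (Filter.Eventually.of_forall fun s hs => ?_)
    have : 0 ≤ s := hs.1.le
    simp only [Pi.zero_apply]
    positivity

theorem integral_pow_mul_exp_le (m : ℕ) {L : ℝ} (hL : 0 ≤ L) :
    0 ≤ ∫ s in (0 : ℝ)..L, s ^ m * Real.exp s ∧
      ∫ s in (0 : ℝ)..L, s ^ m * Real.exp s ≤ L ^ m * Real.exp L := by
  refine ⟨intervalIntegral.integral_nonneg hL fun s hs => by have := hs.1; positivity, ?_⟩
  have hc1 : Continuous fun s : ℝ => s ^ m * Real.exp s := by fun_prop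
  have hc2 : Continuous fun s : ℝ => L ^ m * Real.exp s := by fun_prop
  have h1 := intervalIntegral.integral_mono_on hL (hc1.intervalIntegrable 0 L)
    (hc2.intervalIntegrable 0 L) (μ := volume) fun s hs => by
      have h0 := hs.1
      have h1 := hs.2
      show s ^ m * Real.exp s ≤ L ^ m * Real.exp s
      gcongr
  rw [intervalIntegral.integral_const_mul, integral_exp, Real.exp_zero] at h1
  have : 0 ≤ L ^ m := by positivity
  nlinarith

theorem abs_integral_pow_mul_exp_sub_le (m : ℕ) {L : ℝ} (hL : 1 ≤ L) :
    |(∫ s in (0 : ℝ)..L, s ^ m * Real.exp s) - Real.exp L * L ^ m| ≤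
      (m + 1) * (Real.exp L * L ^ ((m : ℝ) - 1)) := by
  obtain _ | m := m
  · simp only [pow_zero, one_mul, integral_exp, Real.exp_zero, mul_one, Nat.cast_zero, zero_sub,
      zero_add, Real.rpow_neg_one]
    have h1 : Real.exp L - 1 - Real.exp L = -1 := by ring
    rw [h1, abs_neg, abs_one, ← div_eq_mul_inv, le_div_iff₀ (by linarith)]
    linarith [Real.add_one_le_exp L]
  · have hc1 : Continuous fun s : ℝ => (((m + 1 : ℕ) : ℝ) * s ^ m) * Real.exp s := by fun_prop
    have hc2 : Continuous fun s : ℝ => s ^ (m + 1) * Real.exp s := by fun_prop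
    have h1 := intervalIntegral.integral_eq_sub_of_hasDerivAt (a := 0) (b := L)
      (f := fun s => s ^ (m + 1) * Real.exp s)
      (fun s _ => (hasDerivAt_pow (m + 1) s).mul (Real.hasDerivAt_exp s))
      ((hc1.add hc2).intervalIntegrable _ _)
    simp only [Nat.add_sub_cancel] at h1
    rw [intervalIntegral.integral_add (hc1.intervalIntegrable _ _) (hc2.intervalIntegrable _ _)]
      at h1
    simp only [mul_assoc] at h1
    rw [intervalIntegral.integral_const_mul] at h1
    simp only [zero_pow (Nat.succ_ne_zero m), zero_mul, sub_zero] at h1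
    obtain ⟨h2, h3⟩ := integral_pow_mul_exp_le m (L := L) (by linarith)
    have h4 : (∫ s in (0 : ℝ)..L, s ^ (m + 1) * Real.exp s) - Real.exp L * L ^ (m + 1) =
        -(((m + 1 : ℕ) : ℝ) * ∫ s in (0 : ℝ)..L, s ^ m * Real.exp s) := by linarith
    rw [h4, abs_neg, abs_of_nonneg (by positivity)]
    have h5 : L ^ (((m + 1 : ℕ) : ℝ) - 1) = L ^ m := by
      push_cast
      rw [add_sub_cancel_right, Real.rpow_natCast]
    rw [h5]
    have h6 : 0 ≤ Real.exp L * L ^ m := by positivity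
    push_cast
    have hm : (0 : ℝ) ≤ m := Nat.cast_nonneg m
    nlinarith

end ConeIntegral

/-! ### Logarithmic coordinates -/

section ExpCoordinates

variable {ι : Type*} [Fintype ι]

theorem lintegral_image_exp {A : Set (ι → ℝ)} (hA : MeasurableSet A) (g : (ι → ℝ) → ENNReal) :
    ∫⁻ y in (fun (t : ι → ℝ) j => Real.exp (t j)) '' A, g y =
      ∫⁻ t in A, ENNReal.ofReal (Real.exp (∑ j, t j)) * g fun j => Real.exp (t j) := by
  have hderiv : ∀ t ∈ A, HasFDerivWithinAt (fun (t : ι → ℝ) j => Real.exp (t j))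
      (ContinuousLinearMap.pi fun j => (Real.exp (t j) • ContinuousLinearMap.id ℝ ℝ) ∘L
        ContinuousLinearMap.proj j) A t := by
    intro t _
    refine HasFDerivAt.hasFDerivWithinAt (hasFDerivAt_pi.2 fun j => ?_)
    have h1 : HasFDerivAt (fun t : ι → ℝ => t j)
        (ContinuousLinearMap.proj (R := ℝ) (φ := fun _ : ι => ℝ) j) t := hasFDerivAt_apply j t
    have h2 : (Real.exp (t j) • ContinuousLinearMap.id ℝ ℝ) ∘L
        ContinuousLinearMap.proj (R := ℝ) (φ := fun _ : ι => ℝ) j =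
        Real.exp (t j) • ContinuousLinearMap.proj j := by ext; simp
    rw [h2]
    exact h1.exp
  have hinj : Set.InjOn (fun (t : ι → ℝ) j => Real.exp (t j)) A := fun t _ t' _ h =>
    funext fun j => Real.exp_injective (congrFun h j)
  rw [lintegral_image_eq_lintegral_abs_det_fderiv_mul volume hA hderiv hinj]
  refine lintegral_congr fun t => ?_
  have hdet : ∀ c : ℝ, (c • ContinuousLinearMap.id ℝ ℝ : ℝ →L[ℝ] ℝ).det = c := fun c => by
    rw [ContinuousLinearMap.det, LinearMap.det_ring]; simp
  rw [ContinuousLinearMap.det_pi]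
  simp only [hdet]
  rw [← Real.exp_sum, abs_of_pos (Real.exp_pos _)]

/-- The volume of a region that is a box over every point of an exponential image. -/
theorem volume_box_over_exp {κ : Type*} [Fintype κ] (z : κ → (ι → ℝ) →ₗ[ℝ] ℝ) (lam : κ → ℝ)
    (hlam : ∀ ρ, 0 ≤ lam ρ) {A : Set (ι → ℝ)} (hA : MeasurableSet A) :
    volume {x : (κ → ℝ) × (ι → ℝ) | (∀ j, 0 < x.2 j) ∧ (fun j => Real.log (x.2 j)) ∈ A ∧
        ∀ ρ, x.1 ρ ∈ Set.Ioc 0 (lam ρ * Real.exp (z ρ fun j => Real.log (x.2 j)))} =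
      ENNReal.ofReal (∏ ρ, lam ρ) *
        ∫⁻ t in A, ENNReal.ofReal (Real.exp (∑ j, t j + ∑ ρ, z ρ t)) := by
  set W : Set (ι → ℝ) := (fun (t : ι → ℝ) j => Real.exp (t j)) '' A with hW
  have hlog : Measurable fun (y : ι → ℝ) j => Real.log (y j) :=
    measurable_pi_lambda _ fun j => Real.measurable_log.comp (measurable_pi_apply j)
  have hWmem : ∀ y, y ∈ W ↔ (∀ j, 0 < y j) ∧ (fun j => Real.log (y j)) ∈ A := by
    intro y
    constructor
    · rintro ⟨t, ht, rfl⟩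
      refine ⟨fun j => Real.exp_pos _, ?_⟩
      simpa using ht
    · rintro ⟨h1, h2⟩
      exact ⟨_, h2, funext fun j => Real.exp_log (h1 j)⟩
  have hWm : MeasurableSet W := by
    have : W = {y | ∀ j, 0 < y j} ∩ (fun (y : ι → ℝ) j => Real.log (y j)) ⁻¹' A := by
      ext y; exact hWmem y
    rw [this]
    refine MeasurableSet.inter ?_ (hlog hA)
    simp only [Set.ofPred_forall]
    exact MeasurableSet.iInter fun j => measurableSet_lt measurable_const (measurable_pi_apply j)
  have hzm : ∀ ρ, Measurable fun y : ι → ℝ => lam ρ * Real.exp (z ρ fun j => Real.log (y j)) :=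
    fun ρ => measurable_const.mul (Real.measurable_exp.comp
      ((LinearMap.continuous_of_finiteDimensional (z ρ)).measurable.comp hlog))
  set S := {x : (κ → ℝ) × (ι → ℝ) | (∀ j, 0 < x.2 j) ∧ (fun j => Real.log (x.2 j)) ∈ A ∧
        ∀ ρ, x.1 ρ ∈ Set.Ioc 0 (lam ρ * Real.exp (z ρ fun j => Real.log (x.2 j)))} with hS
  have hSm : MeasurableSet S := by
    have : S = (Prod.snd ⁻¹' W) ∩ {x : (κ → ℝ) × (ι → ℝ) | ∀ ρ, x.1 ρ ∈
        Set.Ioc 0 (lam ρ * Real.exp (z ρ fun j => Real.log (x.2 j)))} := by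
      ext x
      simp only [hS, Set.mem_inter_iff, Set.mem_preimage, hWmem, Set.mem_ofPred_eq, and_assoc]
    rw [this]
    refine (measurable_snd hWm).inter ?_
    simp only [Set.ofPred_forall]
    refine MeasurableSet.iInter fun ρ => MeasurableSet.inter ?_ ?_
    · exact measurableSet_lt measurable_const ((measurable_pi_apply ρ).comp measurable_fst)
    · exact measurableSet_le ((measurable_pi_apply ρ).comp measurable_fst)
        ((hzm ρ).comp measurable_snd)
  have hfib : ∀ y, volume ((fun u => (u, y)) ⁻¹' S) = W.indicator (fun y =>
      ENNReal.ofReal (∏ ρ, (lam ρ * Real.exp (z ρ fun j => Real.log (y j))))) y := by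
    intro y
    by_cases hy : y ∈ W
    · rw [Set.indicator_of_mem hy]
      have : (fun u : κ → ℝ => (u, y)) ⁻¹' S = Set.univ.pi fun ρ =>
          Set.Ioc 0 (lam ρ * Real.exp (z ρ fun j => Real.log (y j))) := by
        ext u
        have := (hWmem y).1 hy
        simp only [hS, Set.mem_preimage, Set.mem_ofPred_eq, Set.mem_univ_pi]
        exact ⟨fun h => h.2.2, fun h => ⟨this.1, this.2, h⟩⟩
      rw [this, volume_pi_pi, ENNReal.ofReal_prod_of_nonneg fun ρ _ => by
        have := hlam ρ; positivity]
      simp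
    · rw [Set.indicator_of_notMem hy]
      have : (fun u : κ → ℝ => (u, y)) ⁻¹' S = ∅ := by
        rw [Set.eq_empty_iff_forall_notMem]
        intro u hu
        exact hy ((hWmem y).2 ⟨hu.1, hu.2.1⟩)
      rw [this, measure_empty]
  rw [Measure.volume_eq_prod, Measure.prod_apply_symm hSm]
  simp only [hfib]
  rw [lintegral_indicator hWm, hW, lintegral_image_exp hA,
    ← lintegral_const_mul' _ _ ENNReal.ofReal_ne_top]
  refine lintegral_congr fun t => ?_
  simp only [Real.log_exp]
  rw [Finset.prod_mul_distrib, ← Real.exp_sum, Real.exp_add,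
    ENNReal.ofReal_mul (Finset.prod_nonneg fun ρ _ => hlam ρ),
    ENNReal.ofReal_mul (Real.exp_pos _).le]
  ring

end ExpCoordinates

namespace RegularCompleteFan

variable {d n : ℕ} (F : RegularCompleteFan d n)

/-! ### The volume of the region -/

/-- The rays outside a maximal cone. Their divisors are a basis of the Picard group. -/
abbrev OuterRay (σ₀ : F.MaxCone) : Type := {ρ : Fin n // ¬ ρ ∈ σ₀.1}

/-- The class of `D_ρ`, `ρ ∈ σ₀(1)`, as a linear form in the coordinates of `Pic(X)^∨_ℝ` dual to
the divisors of the rays outside `σ₀`. -/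
noncomputable def innerForm (σ₀ : F.MaxCone) (ρ : σ₀.1) : (F.OuterRay σ₀ → ℝ) →ₗ[ℝ] ℝ :=
  -∑ j : F.OuterRay σ₀, ((F.coneBasis σ₀).coord ρ (F.ray j) : ℝ) • LinearMap.proj j

theorem innerForm_apply (σ₀ : F.MaxCone) (ρ : σ₀.1) (t : F.OuterRay σ₀ → ℝ) :
    F.innerForm σ₀ ρ t =
      -∑ j : F.OuterRay σ₀, ((F.coneBasis σ₀).coord ρ (F.ray j) : ℝ) * t j := by
  simp [innerForm]

/-- The anticanonical class as a linear form in the same coordinates. -/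
noncomputable def degForm (σ₀ : F.MaxCone) : (F.OuterRay σ₀ → ℝ) →ₗ[ℝ] ℝ :=
  ∑ j, LinearMap.proj j + ∑ ρ, F.innerForm σ₀ ρ

theorem degForm_apply (σ₀ : F.MaxCone) (t : F.OuterRay σ₀ → ℝ) :
    F.degForm σ₀ t = ∑ j, t j + ∑ ρ, F.innerForm σ₀ ρ t := by
  simp [degForm]

/-- The dual of the effective cone in the same coordinates. -/
def dualCone (σ₀ : F.MaxCone) : Set (F.OuterRay σ₀ → ℝ) :=
  {t | (∀ j, 0 ≤ t j) ∧ ∀ ρ, 0 ≤ F.innerForm σ₀ ρ t}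

theorem measurableSet_dualCone (σ₀ : F.MaxCone) : MeasurableSet (F.dualCone σ₀) := by
  have h1 : MeasurableSet {t : F.OuterRay σ₀ → ℝ | ∀ j, 0 ≤ t j} := by
    simp only [Set.ofPred_forall]
    exact MeasurableSet.iInter fun j => measurableSet_le measurable_const (measurable_pi_apply j)
  have h2 : MeasurableSet {t : F.OuterRay σ₀ → ℝ | ∀ ρ, 0 ≤ F.innerForm σ₀ ρ t} := by
    simp only [Set.ofPred_forall]
    exact MeasurableSet.iInter fun ρ => measurableSet_le measurable_const
      (LinearMap.continuous_of_finiteDimensional (F.innerForm σ₀ ρ)).measurable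
  exact h1.inter h2

theorem smul_mem_dualCone (σ₀ : F.MaxCone) (s : ℝ) (hs : 0 < s) (t : F.OuterRay σ₀ → ℝ)
    (ht : t ∈ F.dualCone σ₀) : s • t ∈ F.dualCone σ₀ :=
  ⟨fun j => mul_nonneg hs.le (ht.1 j), fun ρ => by
    rw [map_smul]; exact mul_nonneg hs.le (ht.2 ρ)⟩

theorem le_degForm (σ₀ : F.MaxCone) (t : F.OuterRay σ₀ → ℝ) (ht : t ∈ F.dualCone σ₀)
    (j : F.OuterRay σ₀) : 0 ≤ t j ∧ t j ≤ F.degForm σ₀ t := by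
  refine ⟨ht.1 j, ?_⟩
  rw [degForm_apply]
  have h1 := Finset.single_le_sum (f := t) (fun j _ => ht.1 j) (Finset.mem_univ j)
  have h2 : 0 ≤ ∑ ρ, F.innerForm σ₀ ρ t := Finset.sum_nonneg fun ρ _ => ht.2 ρ
  linarith

/-- The logarithms of the coordinates outside `σ₀`. -/
noncomputable def outerLog (σ₀ : F.MaxCone) (x : Fin n → ℝ) : F.OuterRay σ₀ → ℝ :=
  fun j => Real.log (x j)

theorem sum_eq_sum_inner_add_outer (σ₀ : F.MaxCone) (f : Fin n → ℝ) :
    ∑ ρ, f ρ = ∑ ρ : σ₀.1, f ρ + ∑ j : F.OuterRay σ₀, f j := by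
  rw [← Fintype.sum_subtype_add_sum_subtype (fun ρ => ρ ∈ σ₀.1) f]
  congr!

theorem sum_coord_log (σ₀ : F.MaxCone) (ρ : σ₀.1) (x : Fin n → ℝ) :
    ∑ ρ', ((F.coneBasis σ₀).coord ρ (F.ray ρ') : ℝ) * Real.log (x ρ') =
      Real.log (x ρ) - F.innerForm σ₀ ρ (F.outerLog σ₀ x) := by
  rw [F.sum_eq_sum_inner_add_outer σ₀, innerForm_apply, sub_neg_eq_add]
  congr 1
  rw [Finset.sum_eq_single ρ]
  · rw [F.coord_ray σ₀ ρ ρ, if_pos rfl]; simp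
  · intro ρ' _ h
    rw [F.coord_ray σ₀ ρ ρ', if_neg h]; simp
  · simp

/-- All the height monomials in terms of the one at `σ₀`, whose logarithm is the first summand, and
of the logarithms of the coordinates of `π(x)`. -/
theorem log_realHeight (σ₀ σ : F.MaxCone) (hgen : F.GloballyGenerated F.anticanonical)
    {x : Fin n → ℝ} (hx : ∀ ρ, 0 < x ρ) :
    Real.log (F.realHeight σ x) = F.degForm σ₀ (F.outerLog σ₀ x) +
      ∑ ρ : σ₀.1, (F.heightExponent σ ρ : ℝ) *
        (Real.log (x ρ) - F.innerForm σ₀ ρ (F.outerLog σ₀ x)) := by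
  have h1 : Real.log (F.realHeight σ x) = ∑ ρ, (F.heightExponent σ ρ : ℝ) * Real.log (x ρ) := by
    rw [realHeight, Real.log_prod fun ρ _ => (pow_pos (hx ρ) _).ne']
    refine Finset.sum_congr rfl fun ρ _ => ?_
    rw [Real.log_pow]
    congr 1
    have := Int.toNat_of_nonneg (F.heightExponent_nonneg hgen σ ρ)
    exact_mod_cast congrArg (Int.cast (R := ℝ)) this
  have h2 : ∑ ρ', (F.mSigma σ (F.ray ρ') : ℝ) * Real.log (x ρ') =
      ∑ ρ : σ₀.1, (F.mSigma σ (F.ray ρ) : ℝ) *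
        (Real.log (x ρ) - F.innerForm σ₀ ρ (F.outerLog σ₀ x)) := by
    simp only [← F.sum_coord_log σ₀, Finset.mul_sum]
    rw [Finset.sum_comm]
    refine Finset.sum_congr rfl fun ρ' _ => ?_
    rw [F.mSigma_ray_eq σ σ₀ ρ']
    push_cast
    rw [Finset.sum_mul]
    exact Finset.sum_congr rfl fun ρ _ => by ring
  rw [h1]
  simp only [heightExponent, Int.cast_sub, Int.cast_one, sub_mul, one_mul,
    Finset.sum_sub_distrib]
  rw [h2, F.sum_eq_sum_inner_add_outer σ₀, degForm_apply]
  simp only [mul_sub, Finset.sum_sub_distrib, outerLog]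
  ring

theorem heightExponent_self (σ : F.MaxCone) (ρ : σ.1) : F.heightExponent σ ρ = 0 := by
  rw [heightExponent, F.mSigma_ray σ ρ.2, sub_self]

/-- The condition on a coordinate of `π(x)`, as a bound for `x ρ` in terms of the coordinates outside
`σ₀`. -/
theorem torsorMap_le_iff (σ₀ : F.MaxCone) (ρ : σ₀.1) {x : Fin n → ℝ} (hx : ∀ ρ, 0 < x ρ)
    {a : ℝ} (ha : 0 < a) : F.torsorMap σ₀ x ρ ∈ Set.Ioc 0 a ↔
      x ρ ≤ a * Real.exp (F.innerForm σ₀ ρ (F.outerLog σ₀ x)) := by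
  have hpos : 0 < F.torsorMap σ₀ x ρ := Finset.prod_pos fun ρ' _ => zpow_pos (hx ρ') _
  have hlog : Real.log (F.torsorMap σ₀ x ρ) =
      Real.log (x ρ) - F.innerForm σ₀ ρ (F.outerLog σ₀ x) := by
    rw [← F.sum_coord_log σ₀, torsorMap, Real.log_prod fun ρ' _ => (zpow_pos (hx ρ') _).ne']
    exact Finset.sum_congr rfl fun ρ' _ => Real.log_zpow _ _
  have h1 : F.torsorMap σ₀ x ρ ∈ Set.Ioc 0 a ↔ F.torsorMap σ₀ x ρ ≤ a :=
    ⟨fun h => h.2, fun h => ⟨hpos, h⟩⟩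
  rw [h1, ← Real.log_le_log_iff hpos ha, hlog,
    ← Real.log_le_log_iff (hx ρ) (mul_pos ha (Real.exp_pos _)),
    Real.log_mul ha.ne' (Real.exp_pos _).ne', Real.log_exp]
  constructor <;> intro h <;> linarith

/-- The region with the condition `x ρ ≥ 1` dropped for the `ρ ∈ σ₀(1)`, so that its fibres over the
other coordinates are boxes. -/
def openRegion (σ₀ : F.MaxCone) (lam : σ₀.1 → ℝ) (B : ℝ) : Set (Fin n → ℝ) :=
  {x | (∀ j : F.OuterRay σ₀, 0 < x j) ∧
    F.outerLog σ₀ x ∈ F.dualCone σ₀ ∩ {t | F.degForm σ₀ t ≤ Real.log B} ∧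
    ∀ ρ : σ₀.1, x ρ ∈ Set.Ioc 0 (lam ρ * Real.exp (F.innerForm σ₀ ρ (F.outerLog σ₀ x)))}

/-- In the box, the height is given by the monomial of `σ₀` alone. -/
theorem region_eq (hgen : F.GloballyGenerated F.anticanonical) (σ₀ : F.MaxCone)
    (lam : σ₀.1 → ℝ) (hlam : ∀ ρ, lam ρ ∈ Set.Ioo (0 : ℝ) 1) {B : ℝ} (hB : 0 < B) :
    F.region σ₀ lam B = F.openRegion σ₀ lam B ∩ {x | ∀ ρ : σ₀.1, 1 ≤ x ρ} := by
  ext x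
  constructor
  · rintro ⟨h1, h2, h3⟩
    have hpos : ∀ ρ, 0 < x ρ := fun ρ => by linarith [h1 ρ]
    have hle : ∀ ρ : σ₀.1, x ρ ≤ lam ρ * Real.exp (F.innerForm σ₀ ρ (F.outerLog σ₀ x)) := fun ρ =>
      (F.torsorMap_le_iff σ₀ ρ hpos (hlam ρ).1).1 (h3 ρ trivial)
    refine ⟨⟨fun j => hpos j, ⟨⟨fun j => Real.log_nonneg (h1 j), fun ρ => ?_⟩, ?_⟩,
      fun ρ => ⟨hpos ρ, hle ρ⟩⟩, fun ρ => h1 ρ⟩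
    · rw [← Real.one_le_exp_iff]
      have := hle ρ
      have h4 := h1 ρ
      have h5 := (hlam ρ).2
      have h6 := Real.exp_pos (F.innerForm σ₀ ρ (F.outerLog σ₀ x))
      nlinarith
    · have hH := F.log_realHeight σ₀ σ₀ hgen hpos
      simp only [F.heightExponent_self, Int.cast_zero, zero_mul, Finset.sum_const_zero,
        add_zero] at hH
      change F.degForm σ₀ _ ≤ _
      rw [← hH]
      exact Real.log_le_log (Finset.prod_pos fun ρ _ => pow_pos (hpos ρ) _) (h2 σ₀)
  · rintro ⟨⟨h1, ⟨⟨h2, h3⟩, h4⟩, h5⟩, h6⟩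
    have hone : ∀ ρ, 1 ≤ x ρ := by
      intro ρ
      by_cases hρ : ρ ∈ σ₀.1
      · exact h6 ⟨ρ, hρ⟩
      · have h7 := h2 ⟨ρ, hρ⟩
        have h8 := h1 ⟨ρ, hρ⟩
        have := (Real.le_log_iff_exp_le h8).1 h7
        simpa using this
    have hpos : ∀ ρ, 0 < x ρ := fun ρ => by linarith [hone ρ]
    refine ⟨hone, fun σ => ?_, fun ρ _ => ?_⟩
    · have hHpos : 0 < F.realHeight σ x := Finset.prod_pos fun ρ _ => pow_pos (hpos ρ) _
      rw [← Real.log_le_log_iff hHpos hB, F.log_realHeight σ₀ σ hgen hpos]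
      have hsum : ∑ ρ : σ₀.1, (F.heightExponent σ ρ : ℝ) *
          (Real.log (x ρ) - F.innerForm σ₀ ρ (F.outerLog σ₀ x)) ≤ 0 := by
        refine Finset.sum_nonpos fun ρ _ => mul_nonpos_of_nonneg_of_nonpos ?_ ?_
        · exact_mod_cast F.heightExponent_nonneg hgen σ ρ
        · have := (h5 ρ).2
          have h7 := Real.log_le_log (hpos ρ) this
          rw [Real.log_mul (hlam ρ).1.ne' (Real.exp_pos _).ne', Real.log_exp] at h7
          have := Real.log_neg (hlam ρ).1 (hlam ρ).2
          linarith
      have h8 : F.degForm σ₀ (F.outerLog σ₀ x) ≤ Real.log B := h4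
      linarith
    · exact (F.torsorMap_le_iff σ₀ ρ hpos (hlam ρ).1).2 (h5 ρ).2

theorem volume_openRegion (σ₀ : F.MaxCone) (lam : σ₀.1 → ℝ) (hlam : ∀ ρ, 0 ≤ lam ρ) (B : ℝ) :
    volume (F.openRegion σ₀ lam B) = ENNReal.ofReal (∏ ρ, lam ρ) *
      ∫⁻ t in F.dualCone σ₀ ∩ {t | F.degForm σ₀ t ≤ Real.log B},
        ENNReal.ofReal (Real.exp (F.degForm σ₀ t)) := by
  have hA : MeasurableSet (F.dualCone σ₀ ∩ {t | F.degForm σ₀ t ≤ Real.log B}) :=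
    (F.measurableSet_dualCone σ₀).inter (measurableSet_le
      (LinearMap.continuous_of_finiteDimensional (F.degForm σ₀)).measurable measurable_const)
  have h := volume_box_over_exp (F.innerForm σ₀) lam hlam hA
  simp only [← degForm_apply] at h
  rw [← h]
  have hmp : MeasurePreserving
      (MeasurableEquiv.piEquivPiSubtypeProd (fun _ : Fin n => ℝ) (fun ρ => ρ ∈ σ₀.1)) volume
      (volume : Measure ((σ₀.1 → ℝ) × (F.OuterRay σ₀ → ℝ))) := by
    convert volume_preserving_piEquivPiSubtypeProd (fun _ : Fin n => ℝ) (fun ρ => ρ ∈ σ₀.1) <;>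
      rfl
  rw [← hmp.measure_preimage_equiv]
  rfl

theorem card_outerRay (σ₀ : F.MaxCone) : Fintype.card (F.OuterRay σ₀) = n - d := by
  rw [Fintype.card_subtype_compl, Fintype.card_fin, Fintype.card_coe, σ₀.2.2]

theorem nonempty_outerRay (σ₀ : F.MaxCone) (hn : 0 < n) : Nonempty (F.OuterRay σ₀) := by
  rw [← Fintype.card_pos_iff, card_outerRay]
  have := F.finrank_relSpace_inf σ₀ hn
  omega

/-- Increasing the coordinates of `σ₀` by `1` moves the open region into the tuples with coordinates
at least `1`, and multiplies the heights by a bounded factor only. -/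
theorem exists_shift_bound (hgen : F.GloballyGenerated F.anticanonical) (σ₀ : F.MaxCone)
    (lam : σ₀.1 → ℝ) (hlam : ∀ ρ, lam ρ ∈ Set.Ioo (0 : ℝ) 1) :
    ∃ c : ℝ, 1 ≤ c ∧ ∀ B : ℝ, 0 < B → ∀ x ∈ F.openRegion σ₀ lam B, ∀ y : Fin n → ℝ,
      (∀ ρ, y ρ = if ρ ∈ σ₀.1 then x ρ + 1 else x ρ) →
        (∀ ρ, 1 ≤ y ρ) ∧ ∀ σ, F.realHeight σ y ≤ c * B := by
  have ha : ∀ σ ρ, (0 : ℝ) ≤ F.heightExponent σ ρ := fun σ ρ => by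
    exact_mod_cast F.heightExponent_nonneg hgen σ ρ
  have hl2 : 0 < Real.log 2 := Real.log_pos (by norm_num)
  have hin : ∀ σ : F.MaxCone, 0 ≤ ∑ ρ : σ₀.1, (F.heightExponent σ ρ : ℝ) * Real.log 2 := fun σ =>
    Finset.sum_nonneg fun ρ _ => mul_nonneg (ha σ ρ) hl2.le
  refine ⟨Real.exp (∑ σ : F.MaxCone, ∑ ρ : σ₀.1, (F.heightExponent σ ρ : ℝ) * Real.log 2),
    Real.one_le_exp (Finset.sum_nonneg fun σ _ => hin σ), fun B hB x hx y hy => ?_⟩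
  obtain ⟨h1, ⟨⟨h2, h3⟩, h4⟩, h5⟩ := hx
  have hyin : ∀ ρ : σ₀.1, y ρ = x ρ + 1 := fun ρ => by rw [hy, if_pos ρ.2]
  have hyout : ∀ j : F.OuterRay σ₀, y j = x j := fun j => by rw [hy, if_neg j.2]
  have hone : ∀ ρ, 1 ≤ y ρ := by
    intro ρ
    by_cases hρ : ρ ∈ σ₀.1
    · have := (h5 ⟨ρ, hρ⟩).1
      rw [hyin ⟨ρ, hρ⟩]
      linarith
    · have := (Real.le_log_iff_exp_le (h1 ⟨ρ, hρ⟩)).1 (h2 ⟨ρ, hρ⟩)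
      rw [hyout ⟨ρ, hρ⟩]
      simpa using this
  have hpos : ∀ ρ, 0 < y ρ := fun ρ => by linarith [hone ρ]
  have hlog : F.outerLog σ₀ y = F.outerLog σ₀ x := funext fun j => by
    simp only [outerLog, hyout]
  refine ⟨hone, fun σ => ?_⟩
  have hHpos : 0 < F.realHeight σ y := Finset.prod_pos fun ρ _ => pow_pos (hpos ρ) _
  rw [← Real.log_le_log_iff hHpos (by positivity), Real.log_mul (Real.exp_pos _).ne' hB.ne',
    Real.log_exp, F.log_realHeight σ₀ σ hgen hpos, hlog]
  have h6 : ∑ ρ : σ₀.1, (F.heightExponent σ ρ : ℝ) *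
      (Real.log (y ρ) - F.innerForm σ₀ ρ (F.outerLog σ₀ x)) ≤
      ∑ ρ : σ₀.1, (F.heightExponent σ ρ : ℝ) * Real.log 2 := by
    refine Finset.sum_le_sum fun ρ _ => mul_le_mul_of_nonneg_left ?_ (ha σ ρ)
    have h7 := (h5 ρ).2
    have h8 := Real.one_le_exp (h3 ρ)
    have h9 : y ρ ≤ 2 * Real.exp (F.innerForm σ₀ ρ (F.outerLog σ₀ x)) := by
      rw [hyin]
      have := (hlam ρ).2
      nlinarith
    have h10 := Real.log_le_log (hpos ρ) h9
    rw [Real.log_mul (by norm_num) (Real.exp_pos _).ne', Real.log_exp] at h10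
    linarith
  have h7 := Finset.single_le_sum (f := fun σ : F.MaxCone =>
    ∑ ρ : σ₀.1, (F.heightExponent σ ρ : ℝ) * Real.log 2) (fun σ _ => hin σ) (Finset.mem_univ σ)
  have h8 : F.degForm σ₀ (F.outerLog σ₀ x) ≤ Real.log B := h4
  beta_reduce at h7
  linarith

/-- The volume of the region differs from that of the open region by the points with a coordinate
`x ρ < 1`, `ρ ∈ σ₀(1)`. After a shift by `1` they lie in unit boxes at tuples with a coordinate `1`. -/
theorem exists_volume_region_bound (hgen : F.GloballyGenerated F.anticanonical) (σ₀ : F.MaxCone)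
    (hn : 0 < n) (lam : σ₀.1 → ℝ) (hlam : ∀ ρ, lam ρ ∈ Set.Ioo (0 : ℝ) 1) :
    ∃ c : ℝ, 1 ≤ c ∧ ∀ B : ℝ, 1 ≤ B →
      |volume.real (F.region σ₀ lam B) - (∏ ρ, lam ρ) *
        (volume.real (F.dualCone σ₀ ∩ {t | F.degForm σ₀ t ≤ 1}) *
          ((n - d : ℕ) * ∫ s in (0 : ℝ)..Real.log B, s ^ (n - d - 1) * Real.exp s))| ≤
        F.sliceCount (c * B) := by
  classical
  have := F.nonempty_outerRay σ₀ hn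
  obtain ⟨c, hc1, hc⟩ := F.exists_shift_bound hgen σ₀ lam hlam
  refine ⟨c, hc1, fun B hB => ?_⟩
  have hL : 0 ≤ Real.log B := Real.log_nonneg hB
  have hI : 0 ≤ ∫ s in (0 : ℝ)..Real.log B, s ^ (n - d - 1) * Real.exp s :=
    (integral_pow_mul_exp_le _ hL).1
  have hprod : 0 ≤ ∏ ρ, lam ρ := Finset.prod_nonneg fun ρ _ => (hlam ρ).1.le
  set J := (∏ ρ, lam ρ) * (volume.real (F.dualCone σ₀ ∩ {t | F.degForm σ₀ t ≤ 1}) *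
          ((n - d : ℕ) * ∫ s in (0 : ℝ)..Real.log B, s ^ (n - d - 1) * Real.exp s)) with hJ
  have hJ0 : 0 ≤ J := by positivity
  have hvol : volume (F.openRegion σ₀ lam B) = ENNReal.ofReal J := by
    rw [F.volume_openRegion σ₀ lam (fun ρ => (hlam ρ).1.le),
      lintegral_exp_cone (F.measurableSet_dualCone σ₀) (F.smul_mem_dualCone σ₀)
        (F.le_degForm σ₀) hL, card_outerRay, ← ENNReal.ofReal_mul hprod]
  have hreg := F.region_eq hgen σ₀ lam hlam (by linarith : 0 < B)
  have hle : volume (F.region σ₀ lam B) ≤ ENNReal.ofReal J := by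
    rw [← hvol, hreg]; exact measure_mono Set.inter_subset_left
  -- The translation by `e` moves the difference of the two regions into the slabs `S i`.
  set e : Fin n → ℝ := fun ρ => if ρ ∈ σ₀.1 then 1 else 0 with he
  have hfin := F.finite_boundedTuples hgen (c * B)
  set G : Fin n → Finset (Fin n → ℕ) := fun i => hfin.toFinset.filter fun X => X i = 1 with hG
  set S : Fin n → Set (Fin n → ℝ) := fun i =>
    {y | (∀ ρ, 1 ≤ y ρ) ∧ (∀ σ, F.realHeight σ y ≤ c * B) ∧ y i < 2} with hS
  have hSvol : ∀ i, volume (S i) ≤ (G i).card := fun i =>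
    volume_le_card_of_floor_mem _ _ fun y hy => ⟨fun ρ => by linarith [hy.1 ρ], by
      rw [hG, Finset.mem_filter, Set.Finite.mem_toFinset]
      refine ⟨F.floor_mem_boundedTuples hy.1 hy.2.1, ?_⟩
      rw [Nat.floor_eq_iff (by linarith [hy.1 i])]
      refine ⟨by simpa using hy.1 i, ?_⟩
      have := hy.2.2
      norm_num
      exact this⟩
  have hcover : F.openRegion σ₀ lam B ⊆ F.region σ₀ lam B ∪
      ⋃ i ∈ (Finset.univ : Finset (Fin n)), (fun x => x + e) ⁻¹' S i := by
    intro x hx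
    by_cases h : ∀ ρ : σ₀.1, 1 ≤ x ρ
    · left; rw [hreg]; exact ⟨hx, h⟩
    · right
      push Not at h
      obtain ⟨ρ, hρ⟩ := h
      simp only [Set.mem_iUnion]
      obtain ⟨h1, h2⟩ := hc B (by linarith) x hx (x + e) fun ρ => by
        simp only [Pi.add_apply, he]; split_ifs <;> simp
      refine ⟨ρ, Finset.mem_univ _, h1, h2, ?_⟩
      simp only [Pi.add_apply, he, ρ.2, if_true]
      linarith
  have hub : ENNReal.ofReal J ≤ volume (F.region σ₀ lam B) + (F.sliceCount (c * B) : ENNReal) := by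
    rw [← hvol]
    refine (measure_mono hcover).trans ((measure_union_le _ _).trans ?_)
    gcongr
    refine (measure_biUnion_finset_le _ _).trans ?_
    rw [sliceCount]
    push_cast
    refine Finset.sum_le_sum fun i _ => ?_
    rw [measure_preimage_add_right]
    refine (hSvol i).trans (le_of_eq ?_)
    rw [← Set.ncard_coe_finset]
    congr 2
    ext X
    simp [hG]
  have hregfin : volume (F.region σ₀ lam B) ≠ ⊤ := (hle.trans_lt ENNReal.ofReal_lt_top).ne
  have h1 := ENNReal.toReal_mono ENNReal.ofReal_ne_top hle
  have h2 := ENNReal.toReal_mono (by simp [hregfin]) hub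
  rw [ENNReal.toReal_ofReal hJ0] at h1
  rw [ENNReal.toReal_ofReal hJ0, ENNReal.toReal_add hregfin (by simp), ENNReal.toReal_natCast] at h2
  have hr : (volume (F.region σ₀ lam B)).toReal = volume.real (F.region σ₀ lam B) := rfl
  rw [hr] at h1 h2
  have h3 : (0 : ℝ) ≤ F.sliceCount (c * B) := Nat.cast_nonneg _
  rw [abs_le]
  constructor <;> linarith

/-! ### The Picard group and the constant `α(X)` -/

/-- The coordinates of the class of a divisor in the basis `D_ρ`, `ρ ∉ σ₀(1)`, of the Picard
group. -/
noncomputable def outerCoords (σ₀ : F.MaxCone) : (Fin n → ℤ) →ₗ[ℤ] (F.OuterRay σ₀ → ℤ) :=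
  LinearMap.pi fun j => LinearMap.proj (j : Fin n) -
    ∑ ρ : σ₀.1, (F.coneBasis σ₀).coord ρ (F.ray j) • LinearMap.proj (ρ : Fin n)

theorem outerCoords_apply (σ₀ : F.MaxCone) (D : Fin n → ℤ) (j : F.OuterRay σ₀) :
    F.outerCoords σ₀ D j =
      D j - ∑ ρ : σ₀.1, (F.coneBasis σ₀).coord ρ (F.ray j) * D ρ := by
  simp [outerCoords]

theorem divMap_apply (m : Module.Dual ℤ (Fin d → ℤ)) (ρ : Fin n) : F.divMap m ρ = m (F.ray ρ) := rfl

theorem ker_outerCoords (σ₀ : F.MaxCone) :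
    LinearMap.ker (F.outerCoords σ₀) = LinearMap.range F.divMap := by
  have hexp : ∀ (m : Module.Dual ℤ (Fin d → ℤ)) (v : Fin d → ℤ),
      m v = ∑ ρ : σ₀.1, (F.coneBasis σ₀).coord ρ v * m (F.ray ρ) := by
    intro m v
    conv_lhs => rw [F.sum_coord_smul σ₀ v, map_sum]
    exact Finset.sum_congr rfl fun ρ _ => by rw [map_smul, smul_eq_mul]
  ext D
  rw [LinearMap.mem_ker, LinearMap.mem_range]
  constructor
  · intro h
    have hD : ∀ j : F.OuterRay σ₀, D j = ∑ ρ : σ₀.1, (F.coneBasis σ₀).coord ρ (F.ray j) * D ρ :=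
      fun j => by
        have := congrFun h j
        rw [outerCoords_apply, Pi.zero_apply, sub_eq_zero] at this
        exact this
    refine ⟨∑ ρ : σ₀.1, D ρ • (F.coneBasis σ₀).coord ρ, ?_⟩
    ext ρ'
    rw [divMap_apply, LinearMap.sum_apply]
    simp only [LinearMap.smul_apply, smul_eq_mul]
    by_cases hρ : ρ' ∈ σ₀.1
    · rw [Finset.sum_eq_single (⟨ρ', hρ⟩ : σ₀.1)]
      · rw [F.coord_ray σ₀ _ ⟨ρ', hρ⟩, if_pos rfl, mul_one]
      · intro ρ _ hne
        rw [F.coord_ray σ₀ _ ⟨ρ', hρ⟩, if_neg (Ne.symm hne), mul_zero]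
      · simp
    · rw [hD ⟨ρ', hρ⟩]
      exact Finset.sum_congr rfl fun ρ _ => mul_comm _ _
  · rintro ⟨m, rfl⟩
    ext j
    rw [outerCoords_apply, Pi.zero_apply, sub_eq_zero]
    simp only [divMap_apply]
    exact hexp m (F.ray j)

theorem outerCoords_surjective (σ₀ : F.MaxCone) : Function.Surjective (F.outerCoords σ₀) := by
  intro y
  refine ⟨fun ρ => if h : ρ ∈ σ₀.1 then 0 else y ⟨ρ, h⟩, ?_⟩
  ext j
  rw [outerCoords_apply, dif_neg j.2, Finset.sum_eq_zero fun ρ _ => by rw [dif_pos ρ.2, mul_zero],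
    sub_zero]

/-- The Picard group is free on the divisors of the rays outside `σ₀`. -/
noncomputable def picEquiv (σ₀ : F.MaxCone) : F.Pic ≃ₗ[ℤ] (F.OuterRay σ₀ → ℤ) :=
  (Submodule.quotEquivOfEq _ _ (F.ker_outerCoords σ₀).symm).trans
    ((F.outerCoords σ₀).quotKerEquivOfSurjective (F.outerCoords_surjective σ₀))

theorem picEquiv_cls (σ₀ : F.MaxCone) (D : Fin n → ℤ) :
    F.picEquiv σ₀ (F.cls D) = F.outerCoords σ₀ D := rfl

theorem picRank_eq (σ₀ : F.MaxCone) : F.picRank = n - d := by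
  rw [picRank, (F.picEquiv σ₀).finrank_eq, Module.finrank_fintype_fun_eq_card, card_outerRay]

/-- Pairing with the class of a divisor, in the coordinates given by `σ₀`. -/
theorem sum_mul_outerCoords (σ₀ : F.MaxCone) (t : F.OuterRay σ₀ → ℝ) (D : Fin n → ℤ) :
    ∑ j, t j * (F.outerCoords σ₀ D j : ℝ) =
      ∑ j : F.OuterRay σ₀, (D j : ℝ) * t j + ∑ ρ : σ₀.1, (D ρ : ℝ) * F.innerForm σ₀ ρ t := by
  simp only [outerCoords_apply, innerForm_apply]
  push_cast
  simp only [mul_sub, Finset.sum_sub_distrib, mul_neg, Finset.sum_neg_distrib, ← sub_eq_add_neg,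
    Finset.mul_sum]
  congr 1
  · exact Finset.sum_congr rfl fun j _ => mul_comm _ _
  · rw [Finset.sum_comm]
    exact Finset.sum_congr rfl fun ρ _ => Finset.sum_congr rfl fun j _ => by ring

/-- The change of coordinates on `Pic(X)^∨_ℝ` between two bases of the lattice is unimodular. -/
theorem exists_measurePreserving_coords (σ₀ : F.MaxCone) :
    ∃ Φ : (Fin (Module.finrank ℤ (Module.Dual ℤ F.Pic)) → ℝ) → (F.OuterRay σ₀ → ℝ),
      MeasurePreserving Φ volume volume ∧
      ∀ x t, F.picPairing x t = ∑ j, Φ t j * (F.picEquiv σ₀ x j : ℝ) := by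
  classical
  set b : Module.Basis (F.OuterRay σ₀) ℤ F.Pic := Module.Basis.ofEquivFun (F.picEquiv σ₀) with hb
  set g := F.picDualBasis.indexEquiv b.dualBasis with hg
  set p := F.picDualBasis.reindex g with hp
  set M : Matrix (F.OuterRay σ₀) (F.OuterRay σ₀) ℤ := b.dualBasis.toMatrix p with hM
  have hdet : IsUnit M.det := by
    have := b.dualBasis.isUnit_det p
    rwa [Module.Basis.det_apply] at this
  set A : Matrix (F.OuterRay σ₀) (F.OuterRay σ₀) ℝ := M.map (Int.castRingHom ℝ) with hA
  have hAdet : A.det = ((M.det : ℤ) : ℝ) := by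
    rw [hA, ← RingHom.mapMatrix_apply, ← RingHom.map_det]; rfl
  have habs : |A.det| = 1 := by
    rw [hAdet]
    rcases Int.isUnit_iff.1 hdet with h | h <;> rw [h] <;> simp
  have hA0 : A.det ≠ 0 := fun h => by rw [h] at habs; simp at habs
  have hmap : MeasurePreserving (Matrix.toLin' A) volume volume := by
    refine ⟨(LinearMap.continuous_of_finiteDimensional _).measurable, ?_⟩
    rw [Real.map_matrix_volume_pi_eq_smul_volume_pi hA0, abs_inv, habs]
    simp
  have hcongr := volume_measurePreserving_piCongrLeft (fun _ : F.OuterRay σ₀ => ℝ) g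
  refine ⟨_, hmap.comp hcongr, fun x t => ?_⟩
  have hcoord : ∀ j, b.dualBasis j x = F.picEquiv σ₀ x j := fun j => by
    rw [Module.Basis.dualBasis_apply]
    simp [hb]
  have hpk : ∀ i, (p i) x = ∑ j, M j i * F.picEquiv σ₀ x j := by
    intro i
    conv_lhs => rw [← b.dualBasis.sum_repr (p i)]
    rw [LinearMap.sum_apply]
    refine Finset.sum_congr rfl fun j _ => ?_
    rw [LinearMap.smul_apply, smul_eq_mul, hcoord]
    rfl
  rw [picPairing]
  have hpg : ∀ k, F.picDualBasis k = p (g k) := fun k => by simp [hp]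
  simp only [hpg, hpk]
  have hval : ∀ k, (MeasurableEquiv.piCongrLeft (fun _ : F.OuterRay σ₀ => ℝ) g) t (g k) = t k :=
    fun k => Equiv.piCongrLeft_apply_apply (P := fun _ : F.OuterRay σ₀ => ℝ) g t k
  simp only [Function.comp_apply, Matrix.toLin'_apply, Matrix.mulVec, dotProduct]
  simp only [Finset.sum_mul]
  rw [Finset.sum_comm, ← g.sum_comp]
  refine Finset.sum_congr rfl fun k _ => ?_
  rw [hval]
  push_cast
  rw [Finset.mul_sum]
  refine Finset.sum_congr rfl fun j _ => ?_
  simp only [hA, Matrix.map_apply, Int.coe_castRingHom]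
  ring

/-- The constant `α(X)` is `r` times the volume of the dual of the effective cone, truncated at
anticanonical degree `1`. -/
theorem alpha_eq (σ₀ : F.MaxCone) (hn : 0 < n) :
    F.alpha = volume.real (F.dualCone σ₀ ∩ {t | F.degForm σ₀ t ≤ 1}) * ((n - d : ℕ) : ℝ) := by
  classical
  have := F.nonempty_outerRay σ₀ hn
  obtain ⟨Φ, hΦ, hpair⟩ := F.exists_measurePreserving_coords σ₀
  have hcls : ∀ D t, F.picPairing (F.cls D) t = ∑ j : F.OuterRay σ₀, (D j : ℝ) * Φ t j +
      ∑ ρ : σ₀.1, (D ρ : ℝ) * F.innerForm σ₀ ρ (Φ t) := fun D t => by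
    rw [hpair, picEquiv_cls, sum_mul_outerCoords]
  have hset : F.effDual = Φ ⁻¹' F.dualCone σ₀ := by
    ext t
    constructor
    · intro h
      refine ⟨fun j => ?_, fun ρ => ?_⟩
      · have h1 := h (Pi.single j.1 1) (fun ρ => by
          by_cases hρ : ρ = j.1
          · subst hρ; simp
          · simp [hρ])
        rw [hcls, Finset.sum_eq_single j, Finset.sum_eq_zero] at h1
        · simpa using h1
        · intro ρ _
          rw [Pi.single_eq_of_ne (fun h : (ρ : Fin n) = j => j.2 (by rw [← h]; exact ρ.2))]; simp
        · intro j' _ hne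
          rw [Pi.single_eq_of_ne (fun h => hne (Subtype.ext h))]; simp
        · simp
      · have h1 := h (Pi.single ρ.1 1) (fun ρ' => by
          by_cases hρ : ρ' = ρ.1
          · subst hρ; simp
          · simp [hρ])
        rw [hcls, Finset.sum_eq_zero, Finset.sum_eq_single ρ] at h1
        · simpa using h1
        · intro ρ' _ hne
          rw [Pi.single_eq_of_ne (fun h => hne (Subtype.ext h))]; simp
        · simp
        · intro j _
          rw [Pi.single_eq_of_ne (fun h : (j : Fin n) = ρ => j.2 (by rw [h]; exact ρ.2))]; simp
    · rintro ⟨h1, h2⟩ D hD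
      rw [hcls]
      refine add_nonneg (Finset.sum_nonneg fun j _ => mul_nonneg ?_ (h1 j))
        (Finset.sum_nonneg fun ρ _ => mul_nonneg ?_ (h2 ρ))
      · exact_mod_cast hD j
      · exact_mod_cast hD ρ
  have hdeg : ∀ t, F.picPairing (F.cls F.anticanonical) t = F.degForm σ₀ (Φ t) := fun t => by
    rw [hcls, degForm_apply]
    simp [anticanonical]
  have hint : ∫ t in F.effDual, Real.exp (-F.picPairing (F.cls F.anticanonical) t) =
      ∫ t in F.dualCone σ₀, Real.exp (-F.degForm σ₀ t) := by
    simp only [hset, hdeg]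
    have hcont : Continuous fun t => Real.exp (-F.degForm σ₀ t) :=
      Real.continuous_exp.comp (LinearMap.continuous_of_finiteDimensional (F.degForm σ₀)).neg
    rw [← setIntegral_map (F.measurableSet_dualCone σ₀)
      (f := fun t => Real.exp (-F.degForm σ₀ t)) hcont.aestronglyMeasurable hΦ.measurable.aemeasurable,
      hΦ.map_eq]
  rw [alpha, hint, integral_exp_neg_cone (F.measurableSet_dualCone σ₀) (F.smul_mem_dualCone σ₀)
    (F.le_degForm σ₀), card_outerRay, F.picRank_eq σ₀]
  obtain ⟨m, hm⟩ : ∃ m, n - d = m + 1 :=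
    ⟨n - d - 1, by have := F.finrank_relSpace_inf σ₀ hn; omega⟩
  rw [hm, Nat.add_sub_cancel, Nat.factorial_succ]
  have : (m.factorial : ℝ) ≠ 0 := by positivity
  push_cast
  field_simp

/-! ### The asymptotic formula -/

theorem localDensity_mem_Icc (p : ℕ) [Fact p.Prime] : F.localDensity p ∈ Set.Icc (0 : ℝ) 1 :=
  ⟨by rw [localDensity]; positivity, by linarith [F.one_sub_localDensity_nonneg p]⟩

theorem kappa_mem_Icc (h2 : 2 ≤ F.alphaZero) {l : ℕ} (hl : 1 ≤ l) :
    F.kappa l ∈ Set.Icc (0 : ℝ) 1 := by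
  have hmem : ∀ p : {p : ℕ // p.Prime ∧ ¬ p ∣ l}, F.localDensity p ∈ Set.Icc (0 : ℝ) 1 :=
    fun p => by
      have := Fact.mk p.2.1
      exact F.localDensity_mem_Icc p
  have hlim := (F.multipliable_localDensity h2 l).hasProd
  have h0 : 0 ≤ ∏' p : {p : ℕ // p.Prime ∧ ¬ p ∣ l}, F.localDensity p :=
    ge_of_tendsto' hlim fun s => Finset.prod_nonneg fun p _ => (hmem p).1
  have h1 : ∏' p : {p : ℕ // p.Prime ∧ ¬ p ∣ l}, F.localDensity p ≤ 1 :=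
    le_of_tendsto' hlim fun s => Finset.prod_le_one (fun p _ => (hmem p).1) fun p _ => (hmem p).2
  have hl1 : (1 : ℝ) ≤ (l : ℝ) ^ n := one_le_pow₀ (by exact_mod_cast hl)
  have h2 : 1 / (l : ℝ) ^ n ≤ 1 := (div_le_one (by linarith)).2 hl1
  exact ⟨mul_nonneg (by positivity) h0, mul_le_one₀ h2 h0 h1⟩

theorem volume_real_standardBox (σ₀ : F.MaxCone) (lam : σ₀.1 → ℝ) (hlam : ∀ ρ, 0 ≤ lam ρ) :
    volume.real (standardBox σ₀ lam) = ∏ ρ, lam ρ := by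
  rw [standardBox, measureReal_def, volume_pi_pi, ENNReal.toReal_prod]
  exact Finset.prod_congr rfl fun ρ _ => by
    rw [Real.volume_Ioc, sub_zero, ENNReal.toReal_ofReal (hlam ρ)]

/-- The asymptotic volume of the region, with a saving of one logarithm. -/
theorem exists_volume_region_asymptotic (hgen : F.GloballyGenerated F.anticanonical)
    (σ₀ : F.MaxCone) (hn : 0 < n) (lam : σ₀.1 → ℝ) (hlam : ∀ ρ, lam ρ ∈ Set.Ioo (0 : ℝ) 1) :
    ∃ C : ℝ, 0 ≤ C ∧ ∀ B : ℝ, 3 ≤ B →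
      |volume.real (F.region σ₀ lam B) -
        (∏ ρ, lam ρ) * F.alpha * B * Real.log B ^ ((n : ℝ) - d - 1)| ≤
        C * (B * Real.log B ^ ((n : ℝ) - d - 2)) := by
  obtain ⟨c, hc, hvol⟩ := F.exists_volume_region_bound hgen σ₀ hn lam hlam
  obtain ⟨C, hC0, hC⟩ := F.sliceCount_le hgen σ₀ hc
  obtain ⟨m, hm⟩ : ∃ m, n - d = m + 1 :=
    ⟨n - d - 1, by have := F.finrank_relSpace_inf σ₀ hn; omega⟩
  have hmr : (n : ℝ) - d = m + 1 := by
    have : n = m + 1 + d := by omega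
    rw [this]; push_cast; ring
  have hP : 0 ≤ ∏ ρ, lam ρ := Finset.prod_nonneg fun ρ _ => (hlam ρ).1.le
  set A := (∏ ρ, lam ρ) * F.alpha with hA
  have hAeq : A = (∏ ρ, lam ρ) * (volume.real (F.dualCone σ₀ ∩ {t | F.degForm σ₀ t ≤ 1}) *
      ((m + 1 : ℕ) : ℝ)) := by rw [hA, F.alpha_eq σ₀ hn, hm]
  have hA0 : 0 ≤ A := by rw [hAeq]; positivity
  refine ⟨C + A * (m + 1), by positivity, fun B hB => ?_⟩
  have hL := one_le_log_of_three_le hB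
  have h1 := hvol B (by linarith)
  have h2 := abs_integral_pow_mul_exp_sub_le m hL
  have h3 := hC B hB
  rw [Real.exp_log (by linarith)] at h2
  rw [hm, Nat.add_sub_cancel, ← mul_assoc (volume.real _), ← mul_assoc, ← hAeq] at h1
  have e1 : (n : ℝ) - d - 1 = m := by rw [hmr]; ring
  have e2 : (n : ℝ) - d - 2 = m - 1 := by rw [hmr]; ring
  rw [e2] at h3 ⊢
  rw [e1, Real.rpow_natCast]
  set I := ∫ s in (0 : ℝ)..Real.log B, s ^ m * Real.exp s
  have h4 : |A * I - A * B * Real.log B ^ m| ≤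
      A * ((m + 1) * (B * Real.log B ^ ((m : ℝ) - 1))) := by
    rw [mul_assoc A B, ← mul_sub, abs_mul, abs_of_nonneg hA0]
    gcongr
  refine (abs_sub_le _ (A * I) _).trans ((add_le_add (h1.trans h3) h4).trans (le_of_eq ?_))
  ring

end RegularCompleteFan

theorem theorem5p3 {d n : ℕ} (hd : 1 ≤ d) (F : RegularCompleteFan d n)
    (hproj : F.Projective) (hgen : F.GloballyGenerated F.anticanonical)
    (σ₀ : F.MaxCone) (lam : σ₀.1 → ℝ) (hlam : ∀ ρ, lam ρ ∈ Set.Ioo (0 : ℝ) 1) :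
    (∀ l : ℕ, 1 ≤ l →
      Multipliable fun p : {p : ℕ // p.Prime ∧ ¬ p ∣ l} => F.localDensity p) ∧
    ∀ ε : ℝ, 0 < ε → ∃ C : ℝ, ∀ l : ℕ, 1 ≤ l →
      ∀ ξ ∈ F.torsorPoints (ZMod l), ∀ B : ℝ, 3 ≤ B →
        (F.congruenceTuples σ₀ (RegularCompleteFan.standardBox σ₀ lam) ξ B).Finite ∧
        |((F.congruenceTuples σ₀ (RegularCompleteFan.standardBox σ₀ lam) ξ B).ncard : ℝ)
            - F.kappa l * (MeasureTheory.volume.real (RegularCompleteFan.standardBox σ₀ lam)) *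
                F.alpha * B * Real.log B ^ ((F.picRank : ℝ) - 1)| ≤
          C * (B * Real.log B ^ ((F.picRank : ℝ) - 2 + 1 / (F.alphaZero : ℝ) + ε) *
            Real.log (Real.log B)) := by
  have h2 := F.two_le_alphaZero hd σ₀
  refine ⟨fun l _ => F.multipliable_localDensity h2 l, fun ε hε => ?_⟩
  have hcard : σ₀.1.card ≤ n := (Finset.card_le_univ _).trans_eq (Fintype.card_fin n)
  rw [σ₀.2.2] at hcard
  have hn : 0 < n := by omega
  have hrank : (F.picRank : ℝ) = (n : ℝ) - d := by
    rw [F.picRank_eq σ₀, Nat.cast_sub hcard]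
  rw [F.volume_real_standardBox σ₀ lam fun ρ => (hlam ρ).1.le, hrank]
  set η := min (ε / 2) (1 / 2) with hη
  have hη0 : 0 < η := lt_min (by linarith) (by norm_num)
  have hηε : 2 * η ≤ ε := by linarith [min_le_left (ε / 2) (1 / 2)]
  obtain ⟨C₁, hC₁, hcount⟩ := F.exists_congruenceTuples_bound hgen h2 σ₀ lam hη0 (min_le_right _ _)
  obtain ⟨C₂, hC₂, hslice⟩ := F.sliceCount_le hgen σ₀ le_rfl
  obtain ⟨C₃, hC₃, hbounded⟩ := F.ncard_boundedTuples_le hgen σ₀ hn le_rfl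
  obtain ⟨C₄, hC₄, hvol⟩ := F.exists_volume_region_asymptotic hgen σ₀ hn lam hlam
  simp only [one_mul] at hslice hbounded
  have ha : (2 : ℝ) ≤ F.alphaZero := by exact_mod_cast h2
  set a := (F.alphaZero : ℝ) with ha_def
  have ha0 : 0 < a := by linarith
  have hl3 : 1 < Real.log 3 := by
    rw [Real.lt_log_iff_exp_lt (by norm_num)]
    exact Real.exp_one_lt_d9.trans (by norm_num)
  -- The factor `log log B` is bounded below, so the constant absorbs it.
  have hll3 : 0 < Real.log (Real.log 3) := Real.log_pos hl3
  refine ⟨(C₁ * (C₂ + C₃) + C₄) / Real.log (Real.log 3), fun l hl ξ hξ B hB => ⟨?_, ?_⟩⟩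
  · exact (F.finite_regionTuples hgen σ₀ lam B ξ).subset fun X hX =>
      ((F.mem_congruenceTuples_iff σ₀ lam B ξ X).1 hX).1
  have hL := one_le_log_of_three_le hB
  have hB0 : 0 < B := by linarith
  have hL0 : 0 < Real.log B := by linarith
  set L := Real.log B with hL_def
  set E := B * L ^ ((n : ℝ) - d - 2 + 1 / a + ε) with hE
  have hE0 : 0 ≤ E := by positivity
  have hpow : ∀ u, u ≤ (n : ℝ) - d - 2 + 1 / a + ε → B * L ^ u ≤ E := fun u hu =>
    mul_le_mul_of_nonneg_left (Real.rpow_le_rpow_of_exponent_le hL hu) hB0.le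
  -- With `z = (log B) ^ (1 / α₀)`, the two error terms `B (log B) ^ (r - 2) * z` and
  -- `B (log B) ^ (r - 1) * z ^ (1 - α₀)` agree.
  have hz : 1 ≤ L ^ (1 / a) := Real.one_le_rpow hL (by positivity)
  have hdiv : ∀ u, u ≤ 2 * η → u * (1 / a) ≤ ε := fun u hu => by
    have h1 : 1 / a ≤ 1 := (div_le_one ha0).2 (by linarith)
    have h2 : 0 < 1 / a := by positivity
    nlinarith
  have hs : F.sliceCount B * (L ^ (1 / a)) ^ (1 + η) ≤ C₂ * E := by
    calc F.sliceCount B * (L ^ (1 / a)) ^ (1 + η)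
        ≤ C₂ * (B * L ^ ((n : ℝ) - d - 2)) * (L ^ (1 / a)) ^ (1 + η) := by
          gcongr
          exact hslice B hB
      _ = C₂ * (B * L ^ ((n : ℝ) - d - 2 + 1 / a * (1 + η))) := by
          rw [← Real.rpow_mul hL0.le, Real.rpow_add hL0]; ring
      _ ≤ C₂ * E := by
          refine mul_le_mul_of_nonneg_left (hpow _ ?_) hC₂
          linarith [hdiv η (by linarith)]
  have hb : (F.boundedTuples B).ncard * (L ^ (1 / a)) ^ (1 - a + 2 * η) ≤ C₃ * E := by
    calc (F.boundedTuples B).ncard * (L ^ (1 / a)) ^ (1 - a + 2 * η)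
        ≤ C₃ * (B * L ^ ((n : ℝ) - d - 1)) * (L ^ (1 / a)) ^ (1 - a + 2 * η) := by
          gcongr
          exact hbounded B hB
      _ = C₃ * (B * L ^ ((n : ℝ) - d - 1 + 1 / a * (1 - a + 2 * η))) := by
          rw [← Real.rpow_mul hL0.le, Real.rpow_add hL0]; ring
      _ ≤ C₃ * E := by
          refine mul_le_mul_of_nonneg_left (hpow _ ?_) hC₃
          have h1 : 1 / a * a = 1 := one_div_mul_cancel ha0.ne'
          linarith [hdiv (2 * η) le_rfl]
  have hv : B * L ^ ((n : ℝ) - d - 2) ≤ E := hpow _ (by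
    have : 0 < 1 / a := by positivity
    linarith)
  obtain ⟨hκ0, hκ1⟩ := F.kappa_mem_Icc h2 hl
  have h1 := hcount l ξ B _ hl hz hξ
  have h3 : |F.kappa l * volume.real (F.region σ₀ lam B) -
      F.kappa l * (∏ ρ, lam ρ) * F.alpha * B * L ^ ((n : ℝ) - d - 1)| ≤ C₄ * E := by
    have : F.kappa l * volume.real (F.region σ₀ lam B) -
        F.kappa l * (∏ ρ, lam ρ) * F.alpha * B * L ^ ((n : ℝ) - d - 1) =
        F.kappa l * (volume.real (F.region σ₀ lam B) -
          (∏ ρ, lam ρ) * F.alpha * B * L ^ ((n : ℝ) - d - 1)) := by ring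
    rw [this, abs_mul, abs_of_nonneg hκ0]
    refine (mul_le_of_le_one_left (abs_nonneg _) hκ1).trans ((hvol B hB).trans ?_)
    gcongr
  have hll : Real.log (Real.log 3) ≤ Real.log L :=
    Real.log_le_log (by linarith) (Real.log_le_log (by norm_num) hB)
  calc _ ≤ C₁ * (C₂ * E + C₃ * E) + C₄ * E :=
        (abs_sub_le _ _ _).trans (add_le_add (h1.trans (by gcongr)) h3)
    _ = (C₁ * (C₂ + C₃) + C₄) / Real.log (Real.log 3) * (E * Real.log (Real.log 3)) := by
        field_simp
    _ ≤ _ := by gcongr
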